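/- Let $n\ge 2$, $1\le k\le n$. Let $\Omega\subset\mathbb R^n$ be a bounded domain with $\partial\Omega\in C^{3,1}$, let $\rho(\bar x)=(\rho_1(\bar x),\dots,\rho_{n-1}(\bar x))$ be the principal curvatures of $\partial\Omega$ at $\bar x$ relative to the interior normal, and let $\sigma_j$ be the $j$-th elementary symmetric function ($\sigma_0=1$). Suppose $\Omega$ is strictly $(k-1)$-convex, i.e. $\sigma_j(\rho(\bar x))>0$ for all $\bar x\in\partial\Omega$ and $1\le j\le k-1$. Put $d(x)=\operatorname{dist}(x,\partial\Omega)$, $$L_0=\max_{\bar x\in\partial\Omega}\sigma_{k-1}(\rho(\bar x)),\qquad l_0=\min_{\bar x\in\partial\Omega}\sigma_{k-1}(\rho(\bar x)).$$ Assumptions on $f$ (a real function of which only the values on $(0,\infty)$ are restricted; where $u\le 0$, $f(u)$ may be any value): (f$_1$) $f\in C^1(0,\infty)$, $f>0$ and $f$ is nondecreasing on $(0,\infty)$. (f$_2$) With $F(\tau)=\int_0^\tau f(s)\,ds$ and $H(\tau)=((k+1)F(\tau))^{1/(k+1)}$, the integral $\Phi(s)=\int_s^\infty \frac{d\tau}{H(\tau)}$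 converges for every $s>0$. (f$_3$) There is $C_f>0$ with $\lim_{s\to\infty}H'(s)\int_s^\infty\frac{d\tau}{H(\tau)}=C_f$. Let $\varphi$ be the inverse of the strictly decreasing function $\Phi$ on $(0,\infty)$; it is defined at least for all small $t>0$. Assumptions on $b$: (b$_1$) $b\in C^{1,1}(\overline\Omega)$ and $b>0$ in $\Omega$. (b$_2$) There are $\delta_0>0$, a positive nondecreasing $m\in C^1(0,\delta_0)$ and constants $\underline b,\overline b>0$ with $$\underline b=\liminf_{x\in\Omega,\ d(x)\to0}\frac{b(x)}{m^{k+1}(d(x))}\le\limsup_{x\in\Omega,\ d(x)\to0}\frac{b(x)}{m^{k+1}(d(x))}=\overline b,$$ and, with $M(t)=\int_0^t m(s)\,ds<\infty$, there is $C_m\in[0,\infty)$ with $\lim_{t\to0^+}\left(\frac{M(t)}{m(t)}\right)'=C_m$. For a $C^2$ function $\psi$ put $S_j(D^2\psi)=\sigma_j(\lambda(D^2\psi))$, where $\lambda(D^2\psi)$ are the eigenvalues of the Hessian; $\psi$ is $k$-admissible if $S_j(D^2\psi)>0$ for $1\le j\le k$. A viscosity solution of $$S_k(D^2u)=b(x)f(u)\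 \text{ in }\Omega,\qquad u=\infty\ \text{ on }\partial\Omega,\qquad(*)$$ is a function $u\in C(\Omega)$ with $u(x)\to+\infty$ as $d(x)\to0$ such that, whenever $x_0\in\Omega$, $A$ is an open neighbourhood of $x_0$ and $\psi\in C^2(A)$ is $k$-admissible: if $u-\psi$ has a local maximum at $x_0$, then $S_k(D^2\psi(x_0))\ge b(x_0)f(u(x_0))$; if $u-\psi$ has a local minimum at $x_0$, then $S_k(D^2\psi(x_0))\le b(x_0)f(u(x_0))$. **Theorem.** Suppose all the above assumptions hold and $C_f>1-C_m$. Then every viscosity solution $u$ of $(*)$ satisfies $$1\le\liminf_{x\in\Omega,\ d(x)\to0}\frac{u(x)}{\varphi(\overline\xi\,M(d(x)))}\qquad\text{and}\qquad\limsup_{x\in\Omega,\ d(x)\to0}\frac{u(x)}{\varphi(\underline\xi\,M(d(x)))}\le1,$$ where $$\underline\xi=\left(\frac{\underline b}{L_0\,(1-C_f^{-1}(1-C_m))}\right)^{1/(k+1)},\qquad\overline\xi=\left(\frac{\overline b}{l_0\,(1-C_f^{-1}(1-C_m))}\right)^{1/(k+1)}.$$ -/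

import Mathlib

open Set Filter Topology MeasureTheory

noncomputable section

namespace HessianBlowup

/-- `ℝⁿ` with its Euclidean norm. -/
abbrev E (n : ℕ) : Type := EuclideanSpace ℝ (Fin n)

section Hessian

variable {V : Type*} [NormedAddCommGroup V] [InnerProductSpace ℝ V] [FiniteDimensional ℝ V]

/-- The Hessian `D²ψ(x)` as a bilinear form: `(v, w) ↦ ∂_v ∂_w ψ (x)`. -/
def hessianForm (ψ : V → ℝ) (x : V) : V →L[ℝ] V →L[ℝ] ℝ :=
  fderiv ℝ (fderiv ℝ ψ) x

/-- The Hessian matrix of `ψ` at `x` in an orthonormal basis of `V`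
(its eigenvalues do not depend on that basis). -/
def hessianMatrix (ψ : V → ℝ) (x : V) :
    Matrix (Fin (Module.finrank ℝ V)) (Fin (Module.finrank ℝ V)) ℝ :=
  Matrix.of fun i j =>
    hessianForm ψ x (stdOrthonormalBasis ℝ V i) (stdOrthonormalBasis ℝ V j)

/-- The eigenvalues `λ(D²ψ(x))`, listed with multiplicity (where `ψ` is `C²` the matrix is
symmetric, so that its characteristic polynomial has only real roots). -/
def hessianEigenvalues (ψ : V → ℝ) (x : V) : Multiset ℝ :=
  (hessianMatrix ψ x).charpoly.roots

/-- `S_j(D²ψ(x)) = σ_j(λ(D²ψ(x)))`, the `j`-th elementary symmetric function of the eigenvalues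
of the Hessian. -/
def S (j : ℕ) (ψ : V → ℝ) (x : V) : ℝ :=
  (hessianEigenvalues ψ x).esymm j

/-- `ψ ∈ C²(A)` is `k`-admissible in the open set `A`:
`σ_j(λ(D²ψ)) > 0` in `A` for `j = 1, …, k`. -/
def IsAdmissible (k : ℕ) (A : Set V) (ψ : V → ℝ) : Prop :=
  ContDiffOn ℝ 2 ψ A ∧ ∀ x ∈ A, ∀ j, 1 ≤ j → j ≤ k → 0 < S j ψ x

end Hessian

section Domain

variable {n : ℕ}

/-- A bounded domain: bounded, open, connected and nonempty. -/
def IsBoundedDomain (Ω : Set (E n)) : Prop :=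
  IsOpen Ω ∧ IsConnected Ω ∧ Bornology.IsBounded Ω

/-- In Euclidean coordinates centred at `x`, with last axis along the unit vector `ν`, the set `Ω`
is near `x` the set of points strictly above the graph of the `C²` function `g`, and the graph
passes through the origin horizontally. Thus `x ∈ ∂Ω`, `ν` is the interior unit normal at `x`, and
`g` is a function on the tangent space `νᗮ`. -/
structure IsNormalGraph (Ω : Set (E n)) (x ν : E n) (r : ℝ)
    (g : (Submodule.span ℝ {ν})ᗮ → ℝ) : Prop where
  norm_normal : ‖ν‖ = 1
  radius_pos : 0 < r
  contDiffOn : ContDiffOn ℝ 2 g (Metric.ball 0 r)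
  map_zero : g 0 = 0
  fderiv_zero : fderiv ℝ g 0 = 0
  mem_iff : ∀ v : (Submodule.span ℝ {ν})ᗮ, ∀ t : ℝ, ‖v‖ < r → |t| < r →
    (x + (v : E n) + t • ν ∈ Ω ↔ g v < t)

/-- `∂Ω ∈ C^{3,1}`: near each of its points, `∂Ω` is the graph over the tangent space of a `C³`
function with Lipschitz third derivatives, with `Ω` on one side of it. -/
def HasC31Boundary (Ω : Set (E n)) : Prop :=
  ∀ x ∈ frontier Ω, ∃ (ν : E n) (r : ℝ) (g : (Submodule.span ℝ {ν})ᗮ → ℝ),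
    IsNormalGraph Ω x ν r g ∧ ContDiffOn ℝ 3 g (Metric.ball 0 r) ∧
      ∃ K, LipschitzOnWith K (iteratedFDeriv ℝ 3 g) (Metric.ball 0 r)

/-- `ρ` lists, with multiplicity, the principal curvatures `ρ₁, …, ρ_{n-1}` of `∂Ω` at `x` relative
to the interior normal: the eigenvalues of the Hessian at the origin of the function whose graph
over the tangent space is `∂Ω` near `x`. They are positive for a ball. -/
def IsPrincipalCurvatures (Ω : Set (E n)) (x : E n) (ρ : Multiset ℝ) : Prop :=
  ∃ (ν : E n) (r : ℝ) (g : (Submodule.span ℝ {ν})ᗮ → ℝ),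
    IsNormalGraph Ω x ν r g ∧ ρ = hessianEigenvalues g 0

/-- `Ω` is strictly `l`-convex: `σ_j(ρ(x)) > 0` for all `x ∈ ∂Ω` and `j = 1, …, l`. -/
def IsStrictlyConvexOfOrder (l : ℕ) (Ω : Set (E n)) : Prop :=
  ∀ x ∈ frontier Ω, ∀ ρ, IsPrincipalCurvatures Ω x ρ → ∀ j, 1 ≤ j → j ≤ l → 0 < ρ.esymm j

/-- The set of values of `σ_j(ρ(x))`, `x ∈ ∂Ω`. -/
def curvatureValues (j : ℕ) (Ω : Set (E n)) : Set ℝ :=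
  {s | ∃ x ∈ frontier Ω, ∃ ρ, IsPrincipalCurvatures Ω x ρ ∧ s = ρ.esymm j}

/-- `L₀ = max_{∂Ω} σ_{k-1}(ρ)` (for a bounded domain with `C²` boundary the supremum is
attained). -/
def L₀ (k : ℕ) (Ω : Set (E n)) : ℝ := sSup (curvatureValues (k - 1) Ω)

/-- `l₀ = min_{∂Ω} σ_{k-1}(ρ)` (for a bounded domain with `C²` boundary the infimum is
attained). -/
def l₀ (k : ℕ) (Ω : Set (E n)) : ℝ := sInf (curvatureValues (k - 1) Ω)

/-- `d(x) = dist(x, ∂Ω)`. -/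
def d (Ω : Set (E n)) (x : E n) : ℝ := Metric.infDist x (frontier Ω)

/-- The filter "`x ∈ Ω`, `d(x) → 0`". -/
def nearBoundary (Ω : Set (E n)) : Filter (E n) := comap (d Ω) (𝓝 0) ⊓ 𝓟 Ω

/-- `b ∈ C^{1,1}(Ω̄)`: `b` is continuous on the closure and `C¹` in `Ω`, with Lipschitz gradient
in `Ω` (which therefore extends continuously to the closure). -/
def IsC11Closure (Ω : Set (E n)) (b : E n → ℝ) : Prop :=
  ContinuousOn b (closure Ω) ∧ ContDiffOn ℝ 1 b Ω ∧ ∃ K, LipschitzOnWith K (fderiv ℝ b) Ω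

end Domain

section Nonlinearity

/-- `F(τ) = ∫₀^τ f(s) ds`. -/
def F (f : ℝ → ℝ) (τ : ℝ) : ℝ := ∫ s in (0 : ℝ)..τ, f s

/-- `H(τ) = ((k+1) F(τ))^{1/(k+1)}`. -/
def H (k : ℕ) (f : ℝ → ℝ) (τ : ℝ) : ℝ := (((k : ℝ) + 1) * F f τ) ^ (1 / ((k : ℝ) + 1))

/-- `Φ(s) = ∫_s^∞ dτ / H(τ)`. -/
def Φ (k : ℕ) (f : ℝ → ℝ) (s : ℝ) : ℝ := ∫ τ in Ioi s, 1 / H k f τ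

/-- `φ`, the inverse of the function `Φ` on `(0, ∞)`: it is determined on the range
`(0, Φ(0⁺))` of `Φ`, in particular for all small `t > 0`. -/
def φ (k : ℕ) (f : ℝ → ℝ) : ℝ → ℝ := Function.invFunOn (Φ k f) (Ioi 0)

/-- Condition (f₁). Only the values of `f` on `(0, ∞)` are restricted. -/
def CondF1 (f : ℝ → ℝ) : Prop :=
  ContDiffOn ℝ 1 f (Ioi 0) ∧ (∀ s, 0 < s → 0 < f s) ∧ MonotoneOn f (Ioi 0)

/-- Condition (f₂): the integral defining `Φ(s)` converges for every `s > 0`. -/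
def CondF2 (k : ℕ) (f : ℝ → ℝ) : Prop :=
  ∀ s, 0 < s → IntegrableOn (fun τ => 1 / H k f τ) (Ioi s)

/-- Condition (f₃) with constant `Cf`: `Cf > 0` and `H'(s) Φ(s) → Cf` as `s → ∞`. -/
def CondF3 (k : ℕ) (f : ℝ → ℝ) (Cf : ℝ) : Prop :=
  0 < Cf ∧ Tendsto (fun s => deriv (H k f) s * Φ k f s) atTop (𝓝 Cf)

end Nonlinearity

section Weight

variable {n : ℕ}

/-- `M(t) = ∫₀ᵗ m(s) ds`. -/
def M (m : ℝ → ℝ) (t : ℝ) : ℝ := ∫ s in (0 : ℝ)..t, m s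

/-- Condition (b₁). -/
def CondB1 (Ω : Set (E n)) (b : E n → ℝ) : Prop :=
  IsC11Closure Ω b ∧ ∀ x ∈ Ω, 0 < b x

/-- Condition (b₂) with function `m` on `(0, δ₀)` and constants `blo = b̲`, `bhi = b̄` and `Cm`.
The lower and upper limits are taken in the extended reals. The integral `M(t)` is finite since
`m` is positive and nondecreasing, and `M / m` is differentiable on `(0, δ₀)`. -/
structure CondB2 (k : ℕ) (Ω : Set (E n)) (b : E n → ℝ) (m : ℝ → ℝ) (δ₀ blo bhi Cm : ℝ) :
    Prop where
  delta_pos : 0 < δ₀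
  m_contDiffOn : ContDiffOn ℝ 1 m (Ioo 0 δ₀)
  m_pos : ∀ t ∈ Ioo 0 δ₀, 0 < m t
  m_mono : MonotoneOn m (Ioo 0 δ₀)
  blo_pos : 0 < blo
  bhi_pos : 0 < bhi
  liminf_eq : liminf (fun x => ((b x / m (d Ω x) ^ (k + 1) : ℝ) : EReal)) (nearBoundary Ω)
    = (blo : EReal)
  limsup_eq : limsup (fun x => ((b x / m (d Ω x) ^ (k + 1) : ℝ) : EReal)) (nearBoundary Ω)
    = (bhi : EReal)
  Cm_nonneg : 0 ≤ Cm
  tendsto_deriv : Tendsto (fun t => deriv (fun s => M m s / m s) t) (𝓝[>] 0) (𝓝 Cm)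

end Weight

section Viscosity

variable {n : ℕ}

/-- `u` is a viscosity subsolution of `S_k(D²u) = b f(u)` in `Ω`. -/
def IsViscositySubsolution (k : ℕ) (Ω : Set (E n)) (b : E n → ℝ) (f : ℝ → ℝ) (u : E n → ℝ) :
    Prop :=
  ∀ x₀ ∈ Ω, ∀ A : Set (E n), IsOpen A → x₀ ∈ A → ∀ ψ : E n → ℝ, IsAdmissible k A ψ →
    IsLocalMax (fun x => u x - ψ x) x₀ → b x₀ * f (u x₀) ≤ S k ψ x₀

/-- `u` is a viscosity supersolution of `S_k(D²u) = b f(u)` in `Ω`. -/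
def IsViscositySupersolution (k : ℕ) (Ω : Set (E n)) (b : E n → ℝ) (f : ℝ → ℝ) (u : E n → ℝ) :
    Prop :=
  ∀ x₀ ∈ Ω, ∀ A : Set (E n), IsOpen A → x₀ ∈ A → ∀ ψ : E n → ℝ, IsAdmissible k A ψ →
    IsLocalMin (fun x => u x - ψ x) x₀ → S k ψ x₀ ≤ b x₀ * f (u x₀)

/-- `u ∈ C(Ω)` is a viscosity solution of the blow-up problem
`S_k(D²u) = b f(u)` in `Ω`, `u = ∞` on `∂Ω`. -/
structure IsBlowupSolution (k : ℕ) (Ω : Set (E n)) (b : E n → ℝ) (f : ℝ → ℝ) (u : E n → ℝ) :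
    Prop where
  continuousOn : ContinuousOn u Ω
  subsolution : IsViscositySubsolution k Ω b f u
  supersolution : IsViscositySupersolution k Ω b f u
  blowup : Tendsto u (nearBoundary Ω) atTop

end Viscosity

/-- `(β / (κ (1 - Cf⁻¹ (1 - Cm))))^{1/(k+1)}`; this is `ξ̲` for `β = b̲`, `κ = L₀` and `ξ̄` for
`β = b̄`, `κ = l₀`. -/
def ξ (k : ℕ) (β κ Cf Cm : ℝ) : ℝ :=
  (β / (κ * (1 - Cf⁻¹ * (1 - Cm)))) ^ (1 / ((k : ℝ) + 1))

end HessianBlowup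

end

open HessianBlowup

/-! Put `θ = 1 - Cf⁻¹(1 - Cm)`, which is positive exactly because `Cf > 1 - Cm`, and look for
barriers `h(d)` with `h(t) = φ(a M(t))`. As `φ' = -H(φ)`, one has `-h' = a m H(h)` and `h'' = a² m²
H H' (1 - (M m'/m²) / (a M H'))`, with `H`, `H'` taken at `h`. Here `a M = Φ(h)`, so (f₃) gives `a M
H' → Cf`, while (b₂) gives `M m'/m² → 1 - Cm`. With `H^k H' = f` it follows that `(-h')^(k-1) h'' ~
a^(k+1) θ m^(k+1) f(h)` and `-h' = o(h'')`.

Near `∂Ω` the Hessian of `d` is almost `-B`, with `B` the second fundamental form extended by zero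
in the normal direction. Hence `S_k(D²h(d))` is almost `(-h')^(k-1) (h'' σ_{k-1}(B) - h' σ_k(B))`,
and the last term is negligible. So `h(d)` is a strict supersolution near `∂Ω` if `a^(k+1) θ L₀ <
b̲`, and a strict subsolution if `a^(k+1) θ l₀ > b̄`; the constants `ξ` are the equality cases.
Smoothness of `d` is not needed: the viscosity inequalities are tested with `h(Q)`, where `Q` is a
quadratic touching `d` at one point from the appropriate side (`exists_touching`).

Comparison uses shifts. The function `h(d - σ)` is infinite on `d = σ`, where `u` is bounded, and
`h(d + σ)` is bounded at `∂Ω`, where `u` is infinite. So the extremum of the difference over a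
boundary strip avoids the inner or outer singular edge, and strictness with monotonicity of `f`
controls its sign at interior points. The other edge costs an additive constant, and `σ → 0` bounds
`u` by `h(d) ± C`.

Finally `t^N φ(t)` is nondecreasing near `0` for some `N` (`exists_pow_mul_φ_mono`), so changing `a`
by a factor `ρ` changes `h` by at most `ρ^N`. As `h → ∞`, the constant `C` disappears in the
quotient, and `ρ → 1` gives the theorem. -/

noncomputable section

namespace HessianBlowup

/-! ### Elementary symmetric functions of eigenvalues through `det (1 + X A)` -/

section MatrixSymm

open Polynomial Matrix

variable {ι κ : Type*} [Fintype ι] [DecidableEq ι] [Fintype κ] [DecidableEq κ]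

/-- The polynomial `det (1 + X A)`, whose coefficients are the elementary symmetric functions of
the eigenvalues of `A`. -/
def symmPoly (A : Matrix ι ι ℝ) : ℝ[X] := det (1 + (X : ℝ[X]) • A.map C)

/-- The coefficients are sums of principal minors, hence polynomials in the entries; no continuity
of eigenvalues is needed. -/
theorem continuous_symmPoly_coeff (j : ℕ) :
    Continuous fun A : Matrix ι ι ℝ => (symmPoly A).coeff j := by
  simp only [symmPoly, coeff_det_one_add_X_smul_eq_sum_minors]
  fun_prop

theorem symmPoly_coeff_zero (A : Matrix ι ι ℝ) : (symmPoly A).coeff 0 = 1 := by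
  simp [symmPoly, coeff_det_one_add_X_smul_eq_sum_minors]

theorem symmPoly_smul_coeff (p : ℝ) (A : Matrix ι ι ℝ) (j : ℕ) :
    (symmPoly (p • A)).coeff j = p ^ j * (symmPoly A).coeff j := by
  simp only [symmPoly, coeff_det_one_add_X_smul_eq_sum_minors, Finset.mul_sum]
  refine Finset.sum_congr rfl fun s hs => ?_
  rw [submatrix_smul, Pi.smul_apply, Pi.smul_apply, det_smul, Fintype.card_coe,
    (Finset.mem_powersetCard.mp hs).2]

/-- Sylvester's identity `det (1 + PQ) = det (1 + QP)`. The index types may differ in size: the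
additional eigenvalues are zero. -/
theorem symmPoly_mul_mul (U : Matrix ι κ ℝ) (A : Matrix κ κ ℝ) (W : Matrix κ ι ℝ)
    (h : W * U = 1) : symmPoly (U * (A * W)) = symmPoly A := by
  have h1 : (X : ℝ[X]) • (U * (A * W)).map C = U.map C * ((X : ℝ[X]) • (A * W).map C) := by
    rw [Matrix.mul_smul, ← Matrix.map_mul]
  have h2 : ((X : ℝ[X]) • (A * W).map C) * U.map C = (X : ℝ[X]) • A.map C := by
    rw [Matrix.smul_mul, ← Matrix.map_mul, Matrix.mul_assoc, h, Matrix.mul_one]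
  rw [symmPoly, h1, det_one_add_mul_comm, h2, symmPoly]

/-- Since `A v = 0`, the cross term in `(1 + X A)(1 + X q v vᵀ)` vanishes, so the determinant
factors; the rank-one factor has determinant `1 + q X`. -/
theorem symmPoly_add_vecMulVec (A : Matrix ι ι ℝ) (v : ι → ℝ) (q : ℝ) (hA : A *ᵥ v = 0)
    (hv : v ⬝ᵥ v = 1) :
    symmPoly (A + q • vecMulVec v v) = symmPoly A * (1 + C q * X) := by
  have h1 : (1 + (X : ℝ[X]) • (A + q • vecMulVec v v).map C) =
      (1 + (X : ℝ[X]) • A.map C) * (1 + (X : ℝ[X]) • (q • vecMulVec v v).map C) := by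
    have h3 : A * (q • vecMulVec v v) = 0 := by
      rw [Matrix.mul_smul, mul_vecMulVec, hA]
      simp
    have h4 : (X : ℝ[X]) • A.map C * (X : ℝ[X]) • (q • vecMulVec v v).map C = 0 := by
      rw [Matrix.smul_mul, Matrix.mul_smul, ← Matrix.map_mul, h3]
      ext i j
      simp
    rw [Matrix.add_mul, Matrix.mul_add, Matrix.mul_add, h4, Matrix.one_mul, Matrix.mul_one,
      add_zero,
      Matrix.one_mul, Matrix.map_add _ (fun _ _ => C_add), smul_add]
    abel
  have h2 : (X : ℝ[X]) • (q • vecMulVec v v).map C =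
      replicateCol Unit (fun i => X * C q * C (v i)) * replicateRow Unit (fun i => C (v i)) := by
    ext i j
    simp only [Matrix.smul_apply, Matrix.map_apply, vecMulVec_apply, Matrix.mul_apply,
      Finset.univ_unique, Finset.sum_singleton, replicateCol_apply, replicateRow_apply,
      smul_eq_mul, map_mul]
    ac_rfl
  have h4 : (∑ i, C (v i) * (X * C q * C (v i)) : ℝ[X]) = C q * X := by
    have : (∑ i, C (v i) * (X * C q * C (v i)) : ℝ[X]) = C (v ⬝ᵥ v) * (C q * X) := by
      simp only [dotProduct, map_sum, Finset.sum_mul, C_mul]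
      exact Finset.sum_congr rfl fun i _ => by ring
    rw [this, hv]; simp
  rw [symmPoly, h1, det_mul, h2, det_one_add_replicateCol_mul_replicateRow, dotProduct, h4,
    symmPoly]

/-- A symmetric matrix has a split characteristic polynomial, so Vieta's formulas apply. For `j`
above the dimension both sides are empty sums. -/
theorem esymm_roots_charpoly (A : Matrix ι ι ℝ) (hA : A.IsHermitian) (j : ℕ) :
    A.charpoly.roots.esymm j = (symmPoly A).coeff j := by
  have hs : A.charpoly.roots.card = A.charpoly.natDegree :=
    splits_iff_card_roots.mp hA.splits_charpoly
  have hd := A.charpoly_natDegree_eq_dim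
  by_cases hj : j ≤ Fintype.card ι
  · have h1 := coeff_eq_esymm_roots_of_card hs (k := Fintype.card ι - j) (by omega)
    rw [charpoly_coeff_eq_sum_minors _ _ hj, hd, A.charpoly_monic.leadingCoeff,
      Nat.sub_sub_self hj] at h1
    rw [symmPoly, coeff_det_one_add_X_smul_eq_sum_minors]
    have h2 : ((-1 : ℝ) ^ j) ≠ 0 := by simp
    rw [one_mul] at h1
    exact (mul_left_cancel₀ h2 h1).symm
  · rw [symmPoly, coeff_det_one_add_X_smul_eq_sum_minors, Finset.powersetCard_eq_empty.mpr,
      Finset.sum_empty, Multiset.esymm, Multiset.powersetCard_eq_empty]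
    · simp
    · omega
    · rw [Finset.card_univ]; omega

end MatrixSymm

/-! ### Symmetric functions of bilinear forms -/

section FormSymm

variable {V : Type*} [NormedAddCommGroup V] [InnerProductSpace ℝ V] [FiniteDimensional ℝ V]

/-- The matrix of a bilinear form in the standard orthonormal basis. -/
def formMatrix (B : V →L[ℝ] V →L[ℝ] ℝ) :
    Matrix (Fin (Module.finrank ℝ V)) (Fin (Module.finrank ℝ V)) ℝ :=
  Matrix.of fun i j => B (stdOrthonormalBasis ℝ V i) (stdOrthonormalBasis ℝ V j)

/-- The `j`-th elementary symmetric function of the eigenvalues of a bilinear form. -/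
def formSymm (j : ℕ) (B : V →L[ℝ] V →L[ℝ] ℝ) : ℝ := (symmPoly (formMatrix B)).coeff j

theorem continuous_formMatrix :
    Continuous (formMatrix : (V →L[ℝ] V →L[ℝ] ℝ) → _) := by
  refine continuous_matrix fun i j => ?_
  simp only [formMatrix, Matrix.of_apply]
  fun_prop

theorem continuous_formSymm (j : ℕ) :
    Continuous (formSymm j : (V →L[ℝ] V →L[ℝ] ℝ) → ℝ) :=
  (continuous_symmPoly_coeff j).comp continuous_formMatrix

theorem formSymm_zero (B : V →L[ℝ] V →L[ℝ] ℝ) : formSymm 0 B = 1 := symmPoly_coeff_zero _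

theorem S_eq_formSymm {ψ : V → ℝ} {x : V}
    (h : ∀ v w, hessianForm ψ x v w = hessianForm ψ x w v) (j : ℕ) :
    S j ψ x = formSymm j (hessianForm ψ x) := by
  refine esymm_roots_charpoly (hessianMatrix ψ x) ?_ j
  ext i j
  simp [hessianMatrix, h]

/-- The elementary symmetric functions of `p B + q ν ⊗ ν`, when `ν` is a unit null vector
of `B`. -/
theorem formSymm_succ_smul_add {B T : V →L[ℝ] V →L[ℝ] ℝ} {ν : V} {p q : ℝ} (hν : ‖ν‖ = 1)
    (hB : ∀ w, B w ν = 0)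
    (hT : ∀ v w, T v w = p * B v w + q * (inner ℝ ν v * inner ℝ ν w)) (j : ℕ) :
    formSymm (j + 1) T = p ^ (j + 1) * formSymm (j + 1) B + p ^ j * q * formSymm j B := by
  set b := stdOrthonormalBasis ℝ V
  set v : Fin (Module.finrank ℝ V) → ℝ := fun i => inner ℝ ν (b i) with hv
  have hexp : ∑ i, v i • b i = ν := by
    simp only [hv]
    simpa [real_inner_comm] using b.sum_repr' ν
  have h1 : formMatrix T = p • formMatrix B + q • Matrix.vecMulVec v v := by
    ext i j
    simp [formMatrix, hT, Matrix.vecMulVec_apply, hv, b]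
  have h2 : (p • formMatrix B).mulVec v = 0 := by
    ext i
    have : (formMatrix B).mulVec v i = B (b i) (∑ j, v j • b j) := by
      simp [Matrix.mulVec, dotProduct, formMatrix, b, mul_comm]
    rw [Matrix.smul_mulVec, Pi.smul_apply, this, hexp, hB]
    simp
  have h3 : v ⬝ᵥ v = 1 := by
    have : inner ℝ ν ν = ∑ i, inner ℝ ν (b i) * inner ℝ (b i) ν :=
      (b.sum_inner_mul_inner ν ν).symm
    rw [real_inner_self_eq_norm_sq, hν] at this
    simp only [dotProduct, hv]
    rw [show (1 : ℝ) = 1 ^ 2 by norm_num, this]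
    exact Finset.sum_congr rfl fun i _ => by rw [real_inner_comm (b i) ν]
  rw [formSymm, h1, symmPoly_add_vecMulVec _ _ _ h2 h3, mul_add, mul_one, Polynomial.coeff_add,
    mul_left_comm, Polynomial.coeff_C_mul, Polynomial.coeff_mul_X, symmPoly_smul_coeff,
    symmPoly_smul_coeff, formSymm, formSymm]
  ring

/-- The extension of a bilinear form on a subspace by zero on the orthogonal complement. -/
def extendForm (W : Submodule ℝ V) (G : W →L[ℝ] W →L[ℝ] ℝ) : V →L[ℝ] V →L[ℝ] ℝ :=
  G.bilinearComp W.orthogonalProjectionOnto W.orthogonalProjectionOnto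

@[simp] theorem extendForm_apply (W : Submodule ℝ V) (G : W →L[ℝ] W →L[ℝ] ℝ) (v w : V) :
    extendForm W G v w = G (W.orthogonalProjectionOnto v) (W.orthogonalProjectionOnto w) := rfl

/-- The matrix of the extension is `U G Uᵀ` with `Uᵀ U = 1`, where `U` expresses a basis of `W` in a
basis of `V`. Curvatures on varying tangent spaces can thus be read off forms on one fixed space. -/
theorem formSymm_extendForm (W : Submodule ℝ V) (G : W →L[ℝ] W →L[ℝ] ℝ) (j : ℕ) :
    formSymm j (extendForm W G) = formSymm j G := by
  set b := stdOrthonormalBasis ℝ V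
  set c := stdOrthonormalBasis ℝ W
  let U : Matrix (Fin (Module.finrank ℝ V)) (Fin (Module.finrank ℝ W)) ℝ :=
    Matrix.of fun i k => inner ℝ (b i) (c k : V)
  have hU : U.transpose * U = 1 := by
    ext k l
    have h1 : inner ℝ (c k : V) (c l : V) =
        ∑ i, inner ℝ (c k : V) (b i) * inner ℝ (b i) (c l : V) :=
      (b.sum_inner_mul_inner _ _).symm
    have h2 : inner ℝ (c k : V) (c l : V) = if k = l then 1 else 0 := by
      have := orthonormal_iff_ite.mp c.orthonormal k l
      simpa using this
    rw [Matrix.mul_apply, Matrix.one_apply, ← h2, h1]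
    exact Finset.sum_congr rfl fun i _ => by simp [U, real_inner_comm]
  have hM : formMatrix (extendForm W G) = U * (formMatrix G * U.transpose) := by
    have hp : ∀ i, W.orthogonalProjectionOnto (b i) = ∑ k, U i k • c k := by
      intro i
      rw [← c.sum_repr' (W.orthogonalProjectionOnto (b i))]
      refine Finset.sum_congr rfl fun k _ => ?_
      congr 1
      change inner ℝ (c k) (W.orthogonalProjectionOnto (b i)) = inner ℝ (b i) (c k : V)
      rw [← Submodule.inner_orthogonalProjectionOnto_eq_of_mem_right, real_inner_comm]
    ext i j
    simp only [formMatrix, Matrix.of_apply, extendForm_apply, Matrix.mul_apply]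
    change G (W.orthogonalProjectionOnto (b i)) (W.orthogonalProjectionOnto (b j)) = _
    rw [hp i, hp j]
    simp only [map_sum, map_smul, _root_.sum_apply, _root_.smul_apply,
      smul_eq_mul, Matrix.transpose_apply]
    simp only [Finset.mul_sum]
    rw [Finset.sum_comm]
    refine Finset.sum_congr rfl fun k _ => Finset.sum_congr rfl fun l _ => ?_
    change _ = U i k * (G (c k) (c l) * U j l)
    ring
  rw [formSymm, hM, symmPoly_mul_mul _ _ _ hU, formSymm]

end FormSymm

/-! ### Tangential and normal components -/

section TangentSpace

variable {n : ℕ} {ν : E n}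

/-- The orthogonal projection onto the hyperplane `νᗮ`. -/
abbrev tproj (ν : E n) : E n →L[ℝ] (Submodule.span ℝ {ν})ᗮ :=
  (Submodule.span ℝ {ν})ᗮ.orthogonalProjectionOnto

theorem coe_tproj (hν : ‖ν‖ = 1) (w : E n) : (tproj ν w : E n) = w - inner ℝ ν w • ν := by
  have h := Submodule.starProjection_add_starProjection_orthogonal (K := Submodule.span ℝ {ν}) w
  rw [Submodule.starProjection_unit_singleton ℝ hν] at h
  rw [Submodule.coe_orthogonalProjectionOnto_apply, eq_sub_iff_add_eq', h]

theorem inner_coe_tangent (v : (Submodule.span ℝ {ν})ᗮ) : inner ℝ ν (v : E n) = 0 :=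
  Submodule.mem_orthogonal_singleton_iff_inner_right.mp v.2

theorem tproj_normal : tproj ν ν = 0 :=
  Submodule.orthogonalProjectionOnto_orthogonal_apply_eq_zero
    (Submodule.mem_span_singleton_self ν)

theorem tproj_coe (v : (Submodule.span ℝ {ν})ᗮ) : tproj ν (v : E n) = v :=
  Submodule.orthogonalProjectionOnto_mem_subspace_eq_self v

theorem norm_tproj_le (w : E n) : ‖tproj ν w‖ ≤ ‖w‖ :=
  Submodule.norm_orthogonalProjectionOnto_apply_le _ _

theorem norm_coe_add_smul_sq (hν : ‖ν‖ = 1) (v : (Submodule.span ℝ {ν})ᗮ) (t : ℝ) :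
    ‖(v : E n) + t • ν‖ ^ 2 = ‖v‖ ^ 2 + t ^ 2 := by
  rw [norm_add_sq_real, real_inner_smul_right, real_inner_comm, inner_coe_tangent, norm_smul, hν]
  simp

end TangentSpace

/-! ### Local defining functions of the domain -/

section Defining

variable {n : ℕ} {Ω : Set (E n)}

/-- `ϕ` is a `C²` local defining function of `Ω` in the open set `U`, with derivative `1` in a
fixed unit direction. -/
structure IsLocalDefining (Ω : Set (E n)) (ϕ : E n → ℝ) (U : Set (E n)) : Prop where
  isOpen : IsOpen U
  contDiffOn : ContDiffOn ℝ 2 ϕ U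
  mem_iff : ∀ z ∈ U, z ∈ Ω ↔ 0 < ϕ z
  exists_dir : ∃ e : E n, ‖e‖ = 1 ∧ ∀ z ∈ U, fderiv ℝ ϕ z e = 1

theorem IsLocalDefining.eq_zero {ϕ : E n → ℝ} {U : Set (E n)} (h : IsLocalDefining Ω ϕ U)
    (hΩ : IsOpen Ω) {z : E n} (hz : z ∈ U) (hf : z ∈ frontier Ω) : ϕ z = 0 := by
  rw [hΩ.frontier_eq] at hf
  refine le_antisymm (not_lt.mp fun hlt => hf.2 ((h.mem_iff z hz).2 hlt)) (not_lt.mp fun hlt => ?_)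
  have hc : ContinuousAt ϕ z := (h.contDiffOn.continuousOn).continuousAt (h.isOpen.mem_nhds hz)
  have hnear : ∀ᶠ y in 𝓝 z, y ∉ Ω := by
    filter_upwards [hc.eventually_lt_const hlt, h.isOpen.mem_nhds hz] with y hy hyU hyΩ
    exact absurd ((h.mem_iff y hyU).1 hyΩ) (not_lt.mpr hy.le)
  exact (mem_closure_iff_frequently.mp hf.1) hnear

theorem IsLocalDefining.contDiffAt {ϕ : E n → ℝ} {U : Set (E n)} (h : IsLocalDefining Ω ϕ U)
    {z : E n} (hz : z ∈ U) : ContDiffAt ℝ 2 ϕ z :=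
  h.contDiffOn.contDiffAt (h.isOpen.mem_nhds hz)

theorem IsLocalDefining.hasFDerivAt {ϕ : E n → ℝ} {U : Set (E n)} (h : IsLocalDefining Ω ϕ U)
    {z : E n} (hz : z ∈ U) : HasFDerivAt ϕ (fderiv ℝ ϕ z) z :=
  ((h.contDiffAt hz).differentiableAt (by norm_num)).hasFDerivAt

/-- If a ray from a boundary point enters `Ω`, a local defining function does not decrease to
first order along it. -/
theorem IsLocalDefining.fderiv_nonneg {ϕ : E n → ℝ} {U : Set (E n)} (h : IsLocalDefining Ω ϕ U)
    (hΩ : IsOpen Ω) {y w : E n} (hy : y ∈ U) (hf : y ∈ frontier Ω)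
    (hw : ∀ᶠ s in 𝓝[>] (0 : ℝ), y + s • w ∈ Ω) : 0 ≤ fderiv ℝ ϕ y w := by
  have hline : HasDerivAt (fun s : ℝ => y + s • w) w 0 := by
    simpa using ((hasDerivAt_id (0 : ℝ)).smul_const w).const_add y
  have hd : HasDerivAt (fun s : ℝ => ϕ (y + s • w)) (fderiv ℝ ϕ y w) 0 := by
    have h0 : HasFDerivAt ϕ (fderiv ℝ ϕ y) (y + (0 : ℝ) • w) := by simpa using h.hasFDerivAt hy
    exact h0.comp_hasDerivAt 0 hline
  have hU : ∀ᶠ s in 𝓝[>] (0 : ℝ), y + s • w ∈ U := by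
    have : Tendsto (fun s : ℝ => y + s • w) (𝓝 0) (𝓝 y) := by
      simpa using hline.continuousAt.tendsto
    exact (this.mono_left nhdsWithin_le_nhds).eventually (h.isOpen.mem_nhds hy)
  have hs := (hasDerivAt_iff_tendsto_slope_zero.mp hd).mono_left
    (nhdsWithin_mono (0 : ℝ) (s := Ioi 0) (t := {0}ᶜ) (fun s hs => ne_of_gt hs))
  refine ge_of_tendsto hs ?_
  filter_upwards [hw, hU, self_mem_nhdsWithin] with s h1 h2 h3
  have h4 := (h.mem_iff _ h2).1 h1
  have h3' : (0 : ℝ) < s := h3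
  simp only [zero_add, zero_smul, add_zero, h.eq_zero hΩ hy hf, sub_zero, smul_eq_mul]
  positivity

/-- A linear functional which is nonnegative on an open half space is a nonnegative multiple of
the inner normal of the half space. -/
theorem eq_smul_innerSL_of_nonneg {ν : E n} (hν : ‖ν‖ = 1) (L : E n →L[ℝ] ℝ)
    (h : ∀ w, 0 < inner ℝ ν w → 0 ≤ L w) : 0 ≤ L ν ∧ L = L ν • innerSL ℝ ν := by
  have hνν : inner ℝ ν ν = (1 : ℝ) := by rw [real_inner_self_eq_norm_sq, hν]; norm_num
  have h0 : 0 ≤ L ν := h ν (by rw [hνν]; norm_num)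
  refine ⟨h0, ?_⟩
  have key : ∀ z, inner ℝ ν z = 0 → 0 ≤ L z := by
    intro z hz
    by_contra hneg
    push Not at hneg
    -- The coefficient makes `L` equal to `-1` at this vector, which still lies in the half space.
    have h1 := h (ν + (((L ν) + 1) / (-L z)) • z) (by
      rw [inner_add_right, real_inner_smul_right, hz, hνν]; norm_num)
    rw [map_add, map_smul, smul_eq_mul, div_mul_eq_mul_div, mul_div_assoc, div_neg,
      div_self hneg.ne] at h1
    linarith
  have key2 : ∀ z, inner ℝ ν z = 0 → L z = 0 := by
    intro z hz
    have h1 := key z hz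
    have h2 := key (-z) (by rw [inner_neg_right, hz, neg_zero])
    rw [map_neg] at h2
    linarith
  ext w
  have h3 := key2 (w - inner ℝ ν w • ν) (by
    rw [inner_sub_right, real_inner_smul_right, hνν]; ring)
  rw [map_sub, map_smul, smul_eq_mul, sub_eq_zero] at h3
  rw [h3]
  simp [mul_comm]

end Defining

/-! ### Normal graphs and their defining functions -/

section NormalGraph

variable {n : ℕ} {Ω : Set (E n)} {x ν : E n} {r : ℝ} {g : (Submodule.span ℝ {ν})ᗮ → ℝ}

/-- The height of a point above the graph of `g`. -/
def graphHeight (x ν : E n) (g : (Submodule.span ℝ {ν})ᗮ → ℝ) (z : E n) : ℝ :=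
  inner ℝ ν (z - x) - g (tproj ν (z - x))

theorem decomp (hν : ‖ν‖ = 1) (x z : E n) :
    z = x + (tproj ν (z - x) : E n) + inner ℝ ν (z - x) • ν := by
  rw [coe_tproj hν]; abel

/-- The height grows with unit speed along `ν`, so `ν` serves as the distinguished direction. -/
theorem IsNormalGraph.isLocalDefining (h : IsNormalGraph Ω x ν r g) :
    IsLocalDefining Ω (graphHeight x ν g) (Metric.ball x r) := by
  have hmem : ∀ z ∈ Metric.ball x r, ‖tproj ν (z - x)‖ < r ∧ |inner ℝ ν (z - x)| < r := by
    intro z hz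
    rw [mem_ball_iff_norm] at hz
    refine ⟨(norm_tproj_le _).trans_lt hz, (abs_real_inner_le_norm _ _).trans_lt ?_⟩
    rwa [h.norm_normal, one_mul]
  have hmaps : MapsTo (fun z => tproj ν (z - x)) (Metric.ball x r) (Metric.ball 0 r) := by
    intro z hz
    simpa using (hmem z hz).1
  have hcd : ContDiffOn ℝ 2 (graphHeight x ν g) (Metric.ball x r) := by
    refine ContDiffOn.sub ?_ (h.contDiffOn.comp ?_ hmaps)
    · exact (contDiff_const.inner ℝ (contDiff_id.sub contDiff_const)).contDiffOn
    · exact ((tproj ν).contDiff.comp (contDiff_id.sub contDiff_const)).contDiffOn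
  refine ⟨Metric.isOpen_ball, hcd, ?_, ν, h.norm_normal, ?_⟩
  · intro z hz
    rw [graphHeight, sub_pos, ← h.mem_iff _ _ (hmem z hz).1 (hmem z hz).2,
      ← decomp h.norm_normal]
  · intro z hz
    have hd := ((hcd.contDiffAt (Metric.isOpen_ball.mem_nhds hz)).differentiableAt
      (by norm_num)).hasFDerivAt
    have hline : HasDerivAt (fun s : ℝ => z + s • ν) ν 0 := by
      simpa using ((hasDerivAt_id (0 : ℝ)).smul_const ν).const_add z
    have h0 : HasFDerivAt (graphHeight x ν g) (fderiv ℝ (graphHeight x ν g) z)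
        (z + (0 : ℝ) • ν) := by simpa using hd
    have h1 := h0.comp_hasDerivAt 0 hline
    have h2 : (graphHeight x ν g ∘ fun s : ℝ => z + s • ν) =
        fun s : ℝ => s + graphHeight x ν g z := by
      funext s
      have : z + s • ν - x = (z - x) + s • ν := by abel
      simp only [Function.comp, graphHeight, this]
      rw [inner_add_right, real_inner_smul_right, map_add, map_smul, tproj_normal,
        real_inner_self_eq_norm_sq, h.norm_normal]
      simp
      ring
    rw [h2] at h1
    exact h1.unique ((hasDerivAt_id' (0 : ℝ)).add_const _)

theorem IsNormalGraph.hasFDerivAt_graphHeight (h : IsNormalGraph Ω x ν r g) :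
    HasFDerivAt (graphHeight x ν g) (innerSL ℝ ν) x := by
  have hg : HasFDerivAt g (0 : (Submodule.span ℝ {ν})ᗮ →L[ℝ] ℝ) (tproj ν (x - x)) := by
    rw [sub_self, (tproj ν).map_zero, ← h.fderiv_zero]
    exact ((h.contDiffOn.contDiffAt (Metric.ball_mem_nhds 0 h.radius_pos)).differentiableAt
      (by norm_num)).hasFDerivAt
  have h1 : HasFDerivAt (fun z => tproj ν (z - x)) (tproj ν) x :=
    (tproj ν).hasFDerivAt.comp x ((hasFDerivAt_id x).sub_const x)
  have h2 : HasFDerivAt (fun z => inner ℝ ν (z - x)) (innerSL ℝ ν) x :=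
    (innerSL ℝ ν).hasFDerivAt.comp x ((hasFDerivAt_id x).sub_const x)
  have h3 := h2.sub (hg.comp x h1)
  rw [ContinuousLinearMap.zero_comp, sub_zero] at h3
  exact h3

theorem IsNormalGraph.graphHeight_self (h : IsNormalGraph Ω x ν r g) :
    graphHeight x ν g x = 0 := by
  simp [graphHeight, h.map_zero]

/-- Rays pointing to the interior side of the tangent plane enter `Ω`. -/
theorem IsNormalGraph.eventually_mem (h : IsNormalGraph Ω x ν r g) {w : E n}
    (hw : 0 < inner ℝ ν w) : ∀ᶠ s in 𝓝[>] (0 : ℝ), x + s • w ∈ Ω := by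
  have hline : HasDerivAt (fun s : ℝ => x + s • w) w 0 := by
    simpa using ((hasDerivAt_id (0 : ℝ)).smul_const w).const_add x
  have h0 : HasFDerivAt (graphHeight x ν g) (innerSL ℝ ν) (x + (0 : ℝ) • w) := by
    simpa using h.hasFDerivAt_graphHeight
  have hd := h0.comp_hasDerivAt 0 hline
  have hs := (hasDerivAt_iff_tendsto_slope_zero.mp hd).mono_left
    (nhdsWithin_mono (0 : ℝ) (s := Ioi 0) (t := {0}ᶜ) (fun s hs => ne_of_gt hs))
  have hU : ∀ᶠ s in 𝓝[>] (0 : ℝ), x + s • w ∈ Metric.ball x r := by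
    have : Tendsto (fun s : ℝ => x + s • w) (𝓝 0) (𝓝 x) := by
      simpa using hline.continuousAt.tendsto
    exact (this.mono_left nhdsWithin_le_nhds).eventually (Metric.ball_mem_nhds x h.radius_pos)
  filter_upwards [hs.eventually_const_lt (u := 0) (by simpa using hw), hU, self_mem_nhdsWithin]
    with s h1 h2 h3
  rw [h.isLocalDefining.mem_iff _ h2]
  simp only [Function.comp, zero_add, zero_smul, add_zero, h.graphHeight_self, sub_zero,
    smul_eq_mul] at h1
  have h3' : (0 : ℝ) < s := h3
  exact pos_of_mul_pos_right h1 (by positivity)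

theorem IsNormalGraph.add_mem_frontier (h : IsNormalGraph Ω x ν r g) (hΩ : IsOpen Ω)
    {v : (Submodule.span ℝ {ν})ᗮ} (hv : ‖v‖ < r) (hgv : |g v| < r) :
    x + (v : E n) + g v • ν ∈ frontier Ω := by
  rw [hΩ.frontier_eq]
  constructor
  · have ht : Tendsto (fun s : ℝ => x + (v : E n) + s • ν) (𝓝[>] (g v))
        (𝓝 (x + (v : E n) + g v • ν)) := by
      refine Tendsto.mono_left ?_ nhdsWithin_le_nhds
      exact (Continuous.tendsto (by fun_prop) _)
    refine mem_closure_of_tendsto ht ?_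
    have hcont : ∀ᶠ s in 𝓝[>] (g v), |s| < r :=
      ((continuous_abs.tendsto (g v)).eventually_lt_const hgv).filter_mono nhdsWithin_le_nhds
    filter_upwards [hcont, self_mem_nhdsWithin] with s hs hs'
    exact (h.mem_iff v s hv hs).2 hs'
  · rw [h.mem_iff v _ hv hgv]
    exact lt_irrefl _

/-- At a boundary point, the derivative of a local defining function is a positive multiple of
the interior normal. -/
theorem IsNormalGraph.fderiv_eq (h : IsNormalGraph Ω x ν r g) (hΩ : IsOpen Ω)
    (hx : x ∈ frontier Ω) {ϕ : E n → ℝ} {U : Set (E n)} (hϕ : IsLocalDefining Ω ϕ U)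
    (hxU : x ∈ U) : 1 ≤ fderiv ℝ ϕ x ν ∧ fderiv ℝ ϕ x = fderiv ℝ ϕ x ν • innerSL ℝ ν := by
  obtain ⟨h0, h1⟩ := eq_smul_innerSL_of_nonneg h.norm_normal (fderiv ℝ ϕ x)
    fun w hw => hϕ.fderiv_nonneg hΩ hxU hx (h.eventually_mem hw)
  refine ⟨?_, h1⟩
  -- The lower bound comes from `1 = Dϕ(e) = Dϕ(ν) ⟨ν, e⟩` with `⟨ν, e⟩ ≤ 1` and `Dϕ(ν) ≥ 0`.
  obtain ⟨e, he, hd⟩ := hϕ.exists_dir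
  have h2 := hd x hxU
  rw [h1] at h2
  simp only [_root_.smul_apply, innerSL_apply_apply, smul_eq_mul] at h2
  have h3 : inner ℝ ν e ≤ 1 := by
    have := real_inner_le_norm ν e
    rwa [h.norm_normal, he, one_mul] at this
  nlinarith

theorem IsNormalGraph.mem_frontier (h : IsNormalGraph Ω x ν r g) (hΩ : IsOpen Ω) :
    x ∈ frontier Ω := by
  have := h.add_mem_frontier hΩ (v := 0) (by simpa using h.radius_pos)
    (by simpa [h.map_zero] using h.radius_pos)
  simpa [h.map_zero] using this

theorem IsNormalGraph.contDiffAt (h : IsNormalGraph Ω x ν r g) : ContDiffAt ℝ 2 g 0 :=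
  h.contDiffOn.contDiffAt (Metric.ball_mem_nhds 0 h.radius_pos)

theorem IsNormalGraph.hessian_symm (h : IsNormalGraph Ω x ν r g)
    (v w : (Submodule.span ℝ {ν})ᗮ) : hessianForm g 0 v w = hessianForm g 0 w v :=
  (h.contDiffAt.isSymmSndFDerivAt (by simp)) v w

/-- The Hessian of the graph function in terms of a local defining function. -/
theorem IsNormalGraph.hessian_eq (h : IsNormalGraph Ω x ν r g) (hΩ : IsOpen Ω)
    {ϕ : E n → ℝ} {U : Set (E n)} (hϕ : IsLocalDefining Ω ϕ U)
    (hxU : x ∈ U) (v w : (Submodule.span ℝ {ν})ᗮ) :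
    hessianForm ϕ x v w + fderiv ℝ ϕ x ν * hessianForm g 0 v w = 0 := by
  -- `γ` parametrises `∂Ω` near `x`, so `ϕ ∘ γ` vanishes near `0`. The claim is its second
  -- derivative at `0`, where `Dγ` is the inclusion because `Dg(0) = 0`.
  set γ : (Submodule.span ℝ {ν})ᗮ → E n := fun v => x + (v : E n) + g v • ν with hγ
  have hγ0 : γ 0 = x := by simp [hγ, h.map_zero]
  have hgd : ∀ᶠ v in 𝓝 (0 : (Submodule.span ℝ {ν})ᗮ), HasFDerivAt g (fderiv ℝ g v) v := by
    filter_upwards [Metric.ball_mem_nhds _ h.radius_pos] with v hv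
    exact ((h.contDiffOn.contDiffAt (Metric.isOpen_ball.mem_nhds hv)).differentiableAt
      (by norm_num)).hasFDerivAt
  have hγd' : ∀ v, HasFDerivAt g (fderiv ℝ g v) v → HasFDerivAt γ
      ((Submodule.span ℝ {ν})ᗮ.subtypeL + (fderiv ℝ g v).smulRight ν) v := by
    intro v hv
    exact ((Submodule.span ℝ {ν})ᗮ.subtypeL.hasFDerivAt.const_add x).add (hv.smul_const ν)
  have hγd := hgd.mono hγd'
  have hγc : ContinuousAt γ 0 := hγd.self_of_nhds.continuousAt
  have hγt : Tendsto γ (𝓝 0) (𝓝 x) := by simpa [hγ0] using hγc.tendsto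
  have hγU : ∀ᶠ v in 𝓝 (0 : (Submodule.span ℝ {ν})ᗮ), γ v ∈ U :=
    hγt.eventually (hϕ.isOpen.mem_nhds hxU)
  have hgc : ContinuousAt g 0 := h.contDiffAt.continuousAt
  have hfr : ∀ᶠ v in 𝓝 (0 : (Submodule.span ℝ {ν})ᗮ), γ v ∈ frontier Ω := by
    have h1 : ∀ᶠ v in 𝓝 (0 : (Submodule.span ℝ {ν})ᗮ), |g v| < r :=
      hgc.abs.eventually_lt_const (by simpa [h.map_zero] using h.radius_pos)
    filter_upwards [h1, Metric.ball_mem_nhds _ h.radius_pos] with v hv1 hv2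
    exact h.add_mem_frontier hΩ (by simpa using hv2) hv1
  have hzero : ∀ᶠ v in 𝓝 (0 : (Submodule.span ℝ {ν})ᗮ), ϕ (γ v) = 0 := by
    filter_upwards [hγU, hfr] with v h1 h2 using hϕ.eq_zero hΩ h1 h2
  have hfirst : ∀ᶠ v in 𝓝 (0 : (Submodule.span ℝ {ν})ᗮ),
      fderiv ℝ ϕ (γ v) ((w : E n) + fderiv ℝ g v w • ν) = 0 := by
    filter_upwards [hγU, hγd, hzero.eventually_nhds] with v h1 h2 h3
    have h4 := (hϕ.hasFDerivAt h1).comp v h2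
    have h5 : HasFDerivAt (ϕ ∘ γ) (0 : (Submodule.span ℝ {ν})ᗮ →L[ℝ] ℝ) v :=
      (hasFDerivAt_const (0 : ℝ) v).congr_of_eventuallyEq h3
    have h6 := congrArg (fun L : (Submodule.span ℝ {ν})ᗮ →L[ℝ] ℝ => L w) (h4.unique h5)
    simpa using h6
  have hD2 : HasFDerivAt (fderiv ℝ ϕ) (hessianForm ϕ x) (γ 0) := by
    rw [hγ0]
    exact (((hϕ.contDiffAt hxU).fderiv_right (m := 1) (by norm_num)).differentiableAt
      (by norm_num)).hasFDerivAt
  have hG : HasFDerivAt (fderiv ℝ g) (hessianForm g 0) 0 :=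
    ((h.contDiffAt.fderiv_right (m := 1) (by norm_num)).differentiableAt
      (by norm_num)).hasFDerivAt
  have hA := hD2.comp 0 hγd.self_of_nhds
  have hGw : HasFDerivAt (fun v => fderiv ℝ g v w) ((hessianForm g 0).flip w) 0 := by
    simpa using hG.clm_apply (hasFDerivAt_const w 0)
  have hu : HasFDerivAt (fun v => (w : E n) + fderiv ℝ g v w • ν)
      (((hessianForm g 0).flip w).smulRight ν) 0 := (hGw.smul_const ν).const_add _
  have hB := hA.clm_apply hu
  have hC : HasFDerivAt (fun v => (fderiv ℝ ϕ ∘ γ) v ((w : E n) + fderiv ℝ g v w • ν))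
      (0 : (Submodule.span ℝ {ν})ᗮ →L[ℝ] ℝ) 0 :=
    (hasFDerivAt_const (0 : ℝ) _).congr_of_eventuallyEq hfirst
  have hE := congrArg (fun L : (Submodule.span ℝ {ν})ᗮ →L[ℝ] ℝ => L v) (hB.unique hC)
  simp [hγ0, h.fderiv_zero] at hE
  linarith

end NormalGraph

/-! ### The second fundamental form: independence of the graph and continuity -/

section Curvature

variable {n : ℕ} {Ω : Set (E n)}

/-- The unit vector along the gradient of `ϕ`. -/
def unitGradient (ϕ : E n → ℝ) (y : E n) : E n :=
  ‖fderiv ℝ ϕ y‖⁻¹ • (InnerProductSpace.toDual ℝ (E n)).symm (fderiv ℝ ϕ y)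

/-- Minus the tangential part of the Hessian of `ϕ`, normalised by the length of the gradient. -/
def levelForm (ϕ : E n → ℝ) (y v w : E n) : ℝ :=
  -(‖fderiv ℝ ϕ y‖⁻¹ * hessianForm ϕ y (v - inner ℝ (unitGradient ϕ y) v • unitGradient ϕ y)
    (w - inner ℝ (unitGradient ϕ y) w • unitGradient ϕ y))

/-- The derivative of `ϕ` is a positive multiple of `ν`; hence the normal of any graph at `x` is
determined by `ϕ` alone. -/
theorem IsNormalGraph.norm_fderiv_eq {x ν : E n} {r : ℝ} {g : (Submodule.span ℝ {ν})ᗮ → ℝ}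
    (h : IsNormalGraph Ω x ν r g) (hΩ : IsOpen Ω) {ϕ : E n → ℝ} {U : Set (E n)}
    (hϕ : IsLocalDefining Ω ϕ U) (hxU : x ∈ U) :
    ‖fderiv ℝ ϕ x‖ = fderiv ℝ ϕ x ν ∧ unitGradient ϕ x = ν := by
  obtain ⟨h1, h2⟩ := h.fderiv_eq hΩ (h.mem_frontier hΩ) hϕ hxU
  set c := fderiv ℝ ϕ x ν with hc
  have h3 : ‖fderiv ℝ ϕ x‖ = c := by
    rw [h2, norm_smul, innerSL_apply_norm, h.norm_normal, mul_one, Real.norm_of_nonneg]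
    linarith
  refine ⟨h3, ?_⟩
  have h4 : (InnerProductSpace.toDual ℝ (E n)).symm (innerSL ℝ ν) = ν := by
    rw [LinearIsometryEquiv.symm_apply_eq]
    ext w
    simp
  rw [unitGradient, h3, h2]
  rw [LinearIsometryEquiv.map_smulₛₗ, h4, smul_smul]
  have h5 : c⁻¹ * (starRingEnd ℝ) c = 1 := by
    simp only [conj_trivial]
    exact inv_mul_cancel₀ (by linarith)
  rw [h5, one_smul]

/-- The left side belongs to a chosen graph, the right side only to `ϕ`. This makes the curvature
form independent of the graph, and continuous, since one `ϕ` serves all nearby boundary points. -/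
theorem IsNormalGraph.extendForm_eq {x ν : E n} {r : ℝ} {g : (Submodule.span ℝ {ν})ᗮ → ℝ}
    (h : IsNormalGraph Ω x ν r g) (hΩ : IsOpen Ω) {ϕ : E n → ℝ} {U : Set (E n)}
    (hϕ : IsLocalDefining Ω ϕ U) (hxU : x ∈ U) (v w : E n) :
    extendForm _ (hessianForm g 0) v w = levelForm ϕ x v w := by
  obtain ⟨h1, -⟩ := h.fderiv_eq hΩ (h.mem_frontier hΩ) hϕ hxU
  obtain ⟨h3, h4⟩ := h.norm_fderiv_eq hΩ hϕ hxU
  have h5 := h.hessian_eq hΩ hϕ hxU (tproj ν v) (tproj ν w)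
  rw [coe_tproj h.norm_normal, coe_tproj h.norm_normal] at h5
  have hc : fderiv ℝ ϕ x ν ≠ 0 := by linarith
  rw [levelForm, h3, h4, extendForm_apply]
  field_simp
  linarith

theorem continuousOn_levelForm {ϕ : E n → ℝ} {U : Set (E n)} (hϕ : IsLocalDefining Ω ϕ U)
    (v w : E n) : ContinuousOn (fun y => levelForm ϕ y v w) U := by
  have h1 : ContDiffOn ℝ 1 (fderiv ℝ ϕ) U :=
    hϕ.contDiffOn.fderiv_of_isOpen hϕ.isOpen (by norm_num)
  have h2 : ContinuousOn (hessianForm ϕ) U :=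
    (h1.fderiv_of_isOpen (m := 0) hϕ.isOpen (by norm_num)).continuousOn
  have h0 : ∀ y ∈ U, ‖fderiv ℝ ϕ y‖ ≠ 0 := by
    intro y hy h0
    obtain ⟨e, -, he⟩ := hϕ.exists_dir
    have := he y hy
    rw [norm_eq_zero] at h0
    rw [h0] at this
    simp at this
  have h3 : ContinuousOn (fun y => ‖fderiv ℝ ϕ y‖⁻¹) U := h1.continuousOn.norm.inv₀ h0
  have h4 : ContinuousOn (unitGradient ϕ) U :=
    h3.smul ((InnerProductSpace.toDual ℝ (E n)).symm.continuous.comp_continuousOn h1.continuousOn)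
  have h5 : ∀ v : E n, ContinuousOn
      (fun y => v - inner ℝ (unitGradient ϕ y) v • unitGradient ϕ y) U := by
    intro v
    have h6 : ContinuousOn (fun y => inner ℝ (unitGradient ϕ y) v) U :=
      h4.inner continuousOn_const
    exact continuousOn_const.sub (h6.smul h4)
  exact (h3.mul ((h2.clm_apply (h5 v)).clm_apply (h5 w))).neg

open Classical in
/-- The second fundamental form of `∂Ω` at `y`, extended by zero to the normal direction. -/
def curvForm (Ω : Set (E n)) (y : E n) : E n →L[ℝ] E n →L[ℝ] ℝ :=
  if h : ∃ B : E n →L[ℝ] E n →L[ℝ] ℝ, ∃ (ν : E n) (r : ℝ) (g : (Submodule.span ℝ {ν})ᗮ → ℝ),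
    IsNormalGraph Ω y ν r g ∧ B = extendForm _ (hessianForm g 0) then h.choose else 0

theorem IsNormalGraph.curvForm_eq {x ν : E n} {r : ℝ} {g : (Submodule.span ℝ {ν})ᗮ → ℝ}
    (h : IsNormalGraph Ω x ν r g) (hΩ : IsOpen Ω) :
    curvForm Ω x = extendForm _ (hessianForm g 0) := by
  have hex : ∃ B : E n →L[ℝ] E n →L[ℝ] ℝ, ∃ (ν : E n) (r : ℝ) (g : (Submodule.span ℝ {ν})ᗮ → ℝ),
    IsNormalGraph Ω x ν r g ∧ B = extendForm _ (hessianForm g 0) := ⟨_, ν, r, g, h, rfl⟩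
  obtain ⟨ν', r', g', h', hB⟩ := hex.choose_spec
  rw [curvForm, dif_pos hex, hB]
  ext v w
  have hx := Metric.mem_ball_self (x := x) h.radius_pos
  rw [h'.extendForm_eq hΩ h.isLocalDefining hx, h.extendForm_eq hΩ h.isLocalDefining hx]

theorem HasC31Boundary.exists_normalGraph (h : HasC31Boundary Ω) {y : E n}
    (hy : y ∈ frontier Ω) : ∃ (ν : E n) (r : ℝ) (g : (Submodule.span ℝ {ν})ᗮ → ℝ),
      IsNormalGraph Ω y ν r g := by
  obtain ⟨ν, r, g, hg, -⟩ := h y hy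
  exact ⟨ν, r, g, hg⟩

/-- Near `y` every boundary point is covered by the same height function, whose `levelForm` is
continuous. -/
theorem continuousOn_curvForm (hΩ : IsOpen Ω) (hreg : HasC31Boundary Ω) :
    ContinuousOn (curvForm Ω) (frontier Ω) := by
  rw [continuousOn_clm_apply]
  intro v
  rw [continuousOn_clm_apply]
  intro w y hy
  obtain ⟨ν, r, g, hg⟩ := hreg.exists_normalGraph hy
  have hU := Metric.ball_mem_nhds y hg.radius_pos
  have hc := ((continuousOn_levelForm hg.isLocalDefining v w).continuousAt hU).continuousWithinAt
    (s := frontier Ω)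
  have heq : ∀ z ∈ frontier Ω, z ∈ Metric.ball y r →
      curvForm Ω z v w = levelForm (graphHeight y ν g) z v w := by
    intro z hz hzU
    obtain ⟨ν', r', g', hg'⟩ := hreg.exists_normalGraph hz
    rw [hg'.curvForm_eq hΩ, hg'.extendForm_eq hΩ hg.isLocalDefining hzU]
  refine hc.congr_of_eventuallyEq ?_ (heq y hy (mem_of_mem_nhds hU))
  filter_upwards [self_mem_nhdsWithin, mem_nhdsWithin_of_mem_nhds hU] with z hz hz'
    using heq z hz hz'

theorem IsPrincipalCurvatures.esymm_eq {y : E n} {ρ : Multiset ℝ}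
    (h : IsPrincipalCurvatures Ω y ρ) (hΩ : IsOpen Ω) (j : ℕ) :
    ρ.esymm j = formSymm j (curvForm Ω y) := by
  obtain ⟨ν, r, g, hg, rfl⟩ := h
  rw [hg.curvForm_eq hΩ, formSymm_extendForm, ← S_eq_formSymm hg.hessian_symm]
  rfl

theorem exists_isPrincipalCurvatures (hreg : HasC31Boundary Ω) {y : E n}
    (hy : y ∈ frontier Ω) : ∃ ρ, IsPrincipalCurvatures Ω y ρ := by
  obtain ⟨ν, r, g, hg⟩ := hreg.exists_normalGraph hy
  exact ⟨_, ν, r, g, hg, rfl⟩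

theorem curvatureValues_eq (hΩ : IsOpen Ω) (hreg : HasC31Boundary Ω) (j : ℕ) :
    curvatureValues j Ω = (fun y => formSymm j (curvForm Ω y)) '' frontier Ω := by
  ext s
  constructor
  · rintro ⟨y, hy, ρ, hρ, rfl⟩
    exact ⟨y, hy, (hρ.esymm_eq hΩ j).symm⟩
  · rintro ⟨y, hy, rfl⟩
    obtain ⟨ρ, hρ⟩ := exists_isPrincipalCurvatures hreg hy
    exact ⟨y, hy, ρ, hρ, (hρ.esymm_eq hΩ j).symm⟩

end Curvature

/-! ### Uniform interior ball condition -/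

section InteriorBall

variable {n : ℕ} {Ω : Set (E n)}

/-- Taylor's formula with Lipschitz `Dϕ`: as `ϕ` vanishes at `y` and `y'`, `|Dϕ(y)(y' - y)| ≤ K ‖y'
- y‖²`, and `Dϕ(y)` is at least one times the normal. -/
theorem exists_local_normal_bound (hΩ : IsOpen Ω) {ϕ : E n → ℝ} {U : Set (E n)}
    (hϕ : IsLocalDefining Ω ϕ U) {z : E n} (hz : z ∈ U) :
    ∃ K : ℝ, ∃ ρ > 0, ∀ y ∈ frontier Ω, y ∈ Metric.ball z ρ → ∀ y' ∈ frontier Ω,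
      y' ∈ Metric.ball z ρ → ∀ (ν : E n) (r : ℝ) (g : (Submodule.span ℝ {ν})ᗮ → ℝ),
        IsNormalGraph Ω y ν r g → inner ℝ ν (y' - y) ≤ K * ‖y' - y‖ ^ 2 := by
  obtain ⟨K, t, ht, hK⟩ :=
    ((hϕ.contDiffAt hz).fderiv_right (m := 1) (by norm_num)).exists_lipschitzOnWith
  obtain ⟨ρ, hρ, hsub⟩ := Metric.mem_nhds_iff.mp (inter_mem ht (hϕ.isOpen.mem_nhds hz))
  refine ⟨K, ρ, hρ, ?_⟩
  intro y hy hyρ y' hy' hy'ρ ν r g hg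
  have hseg : segment ℝ y y' ⊆ Metric.ball z ρ := (convex_ball z ρ).segment_subset hyρ hy'ρ
  have h1 := Convex.norm_image_sub_le_of_norm_hasFDerivWithin_le' (𝕜 := ℝ) (f := ϕ)
    (f' := fderiv ℝ ϕ) (φ := fderiv ℝ ϕ y) (C := K * ‖y' - y‖) (s := segment ℝ y y') (x := y)
    (y := y')
    (fun p hp => (hϕ.hasFDerivAt (hsub (hseg hp)).2).hasFDerivWithinAt)
    (fun p hp => by
      refine (hK.norm_sub_le (hsub (hseg hp)).1 (hsub hyρ).1).trans ?_
      gcongr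
      obtain ⟨θ, hθ, rfl⟩ :=
        (segment_eq_image' ℝ y y' ▸ hp : p ∈ (fun θ : ℝ => y + θ • (y' - y)) '' Icc 0 1)
      simp only [add_sub_cancel_left]
      rw [norm_smul, Real.norm_of_nonneg hθ.1]
      exact mul_le_of_le_one_left (norm_nonneg _) hθ.2)
    (convex_segment y y') (left_mem_segment ℝ y y') (right_mem_segment ℝ y y')
  rw [hϕ.eq_zero hΩ (hsub hyρ).2 hy, hϕ.eq_zero hΩ (hsub hy'ρ).2 hy'] at h1
  obtain ⟨hc, hL⟩ := hg.fderiv_eq hΩ hy hϕ (hsub hyρ).2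
  rw [hL, sub_self, zero_sub, norm_neg, Real.norm_eq_abs] at h1
  have h2 := (le_abs_self _).trans h1
  simp only [_root_.smul_apply, innerSL_apply_apply, smul_eq_mul] at h2
  have h3 : 0 ≤ (K : ℝ) * ‖y' - y‖ ^ 2 := by positivity
  nlinarith

/-- Uniform interior ball condition: all normals at boundary points are proximal with a common
constant. -/
theorem exists_normal_bound (hΩ : IsOpen Ω) (hreg : HasC31Boundary Ω)
    (hcpt : IsCompact (frontier Ω)) :
    ∃ κ > 0, ∀ y ∈ frontier Ω, ∀ y' ∈ frontier Ω, ∀ (ν : E n) (r : ℝ)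
      (g : (Submodule.span ℝ {ν})ᗮ → ℝ), IsNormalGraph Ω y ν r g →
        inner ℝ ν (y' - y) ≤ κ * ‖y' - y‖ ^ 2 := by
  by_contra hcon
  push Not at hcon
  have hcon' : ∀ i : ℕ, ∃ y ∈ frontier Ω, ∃ y' ∈ frontier Ω, ∃ (ν : E n) (r : ℝ)
      (g : (Submodule.span ℝ {ν})ᗮ → ℝ), IsNormalGraph Ω y ν r g ∧
        ((i : ℝ) + 1) * ‖y' - y‖ ^ 2 < inner ℝ ν (y' - y) := fun i => hcon _ (by positivity)
  choose y hy y' hy' ν r g hg hlt using hcon'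
  -- A violation with constant `i + 1` forces the two points together, because `⟨ν, y' - y⟩ ≤ ‖y' -
  -- y‖`. The local bound at a limit point then gives the contradiction.
  have hsmall : ∀ i, ‖y' i - y i‖ ≤ 1 / ((i : ℝ) + 1) := by
    intro i
    have h1 : inner ℝ (ν i) (y' i - y i) ≤ ‖y' i - y i‖ := by
      simpa [(hg i).norm_normal] using real_inner_le_norm (ν i) (y' i - y i)
    have h2 := (hlt i).trans_le h1
    have h3 : (0 : ℝ) < i + 1 := by positivity
    rw [le_div_iff₀ h3]
    by_contra hc
    push Not at hc
    have := norm_nonneg (y' i - y i)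
    nlinarith
  obtain ⟨z, hz, τ, hτ, hlim⟩ := hcpt.tendsto_subseq hy
  have hdiff : Tendsto (fun i => y' i - y i) atTop (𝓝 0) :=
    squeeze_zero_norm hsmall tendsto_one_div_add_atTop_nhds_zero_nat
  have hlim' : Tendsto (y' ∘ τ) atTop (𝓝 z) := by
    have := hlim.add (hdiff.comp hτ.tendsto_atTop)
    rw [add_zero] at this
    refine this.congr fun i => ?_
    simp
  obtain ⟨ν₀, r₀, g₀, hg₀⟩ := hreg.exists_normalGraph hz
  obtain ⟨K, ρ, hρ, hb⟩ := exists_local_normal_bound hΩ hg₀.isLocalDefining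
    (Metric.mem_ball_self hg₀.radius_pos)
  have hK : ∀ᶠ i in atTop, K ≤ ((τ i : ℕ) : ℝ) + 1 := by
    have : Tendsto (fun i => ((τ i : ℕ) : ℝ)) atTop atTop :=
      tendsto_natCast_atTop_atTop.comp hτ.tendsto_atTop
    filter_upwards [this.eventually_ge_atTop K] with i hi
    linarith
  obtain ⟨i, hi1, hi2, hi3⟩ := ((hlim.eventually (Metric.ball_mem_nhds z hρ)).and
    ((hlim'.eventually (Metric.ball_mem_nhds z hρ)).and hK)).exists
  have h1 := hb _ (hy (τ i)) hi1 _ (hy' (τ i)) hi2 _ _ _ (hg (τ i))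
  have h2 := hlt (τ i)
  have h3 : K * ‖y' (τ i) - y (τ i)‖ ^ 2 ≤ (((τ i : ℕ) : ℝ) + 1) * ‖y' (τ i) - y (τ i)‖ ^ 2 := by
    gcongr
  linarith

end InteriorBall

/-! ### Quadratics touching the distance function -/

section Touching

variable {n : ℕ} {Ω : Set (E n)} {x ν : E n} {r : ℝ} {g : (Submodule.span ℝ {ν})ᗮ → ℝ}

/-- The ball is connected, meets `Ω` and misses the frontier. -/
theorem ball_subset_of_le_infDist {x₀ : E n} {R : ℝ} (hx₀ : x₀ ∈ Ω) (hR : R ≤ d Ω x₀) :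
    Metric.ball x₀ R ⊆ Ω := by
  rcases le_or_gt R 0 with h | hRpos
  · rw [Metric.ball_eq_empty.mpr h]; exact empty_subset _
  by_contra hsub
  obtain ⟨z, hz, hzΩ⟩ := not_subset.mp hsub
  have hpre : IsPreconnected (Metric.ball x₀ R) := (convex_ball x₀ R).isPreconnected
  obtain ⟨y, hy, hyf⟩ : ∃ y ∈ Metric.ball x₀ R, y ∈ frontier Ω := by
    by_contra hno
    push Not at hno
    obtain ⟨p, -, hp, hp'⟩ := hpre (interior Ω) (closure Ω)ᶜ isOpen_interior
      isClosed_closure.isOpen_compl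
      (fun p hp => or_iff_not_imp_right.mpr fun hpc => by
        by_contra hpi
        exact hno p hp ⟨not_not.mp hpc, hpi⟩)
      ⟨x₀, Metric.mem_ball_self hRpos, by
        by_contra hpi
        exact hno x₀ (Metric.mem_ball_self hRpos) ⟨subset_closure hx₀, hpi⟩⟩
      ⟨z, hz, fun hzc => hno z hz ⟨hzc, fun hzi => hzΩ (interior_subset hzi)⟩⟩
    exact hp' (subset_closure (interior_subset hp))
  have h1 : d Ω x₀ ≤ dist x₀ y := Metric.infDist_le_dist_of_mem hyf
  rw [Metric.mem_ball, dist_comm] at hy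
  linarith

/-- The interior normal at a nearest boundary point points to the given interior point. -/
theorem IsNormalGraph.eq_add_smul_of_nearest (h : IsNormalGraph Ω x ν r g) (hΩ : IsOpen Ω)
    {x₀ : E n} (hx₀ : x₀ ∈ Ω) (hd : d Ω x₀ = dist x₀ x) (hpos : 0 < d Ω x₀) :
    x₀ = x + d Ω x₀ • ν := by
  set R := d Ω x₀ with hR
  have hnorm : ‖x₀ - x‖ = R := by rw [hd, dist_eq_norm]
  set μ : E n := R⁻¹ • (x₀ - x) with hμ
  have hμ1 : ‖μ‖ = 1 := by
    rw [hμ, norm_smul, hnorm, norm_inv, Real.norm_of_nonneg hpos.le, inv_mul_cancel₀ hpos.ne']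
  have hx₀' : x₀ - x = R • μ := by rw [hμ, smul_inv_smul₀ hpos.ne']
  -- The ball of radius `R` about `x₀` lies in `Ω` and has `x` on its sphere, so every such
  -- direction enters `Ω` from `x`. Then `ν` is nonnegative on the half space of `μ`, which forces
  -- `ν = μ`.
  have hpt : ∀ w, 0 < inner ℝ μ w → 0 ≤ innerSL ℝ ν w := by
    intro w hw
    rw [← h.hasFDerivAt_graphHeight.fderiv]
    refine h.isLocalDefining.fderiv_nonneg hΩ (Metric.mem_ball_self h.radius_pos)
      (h.mem_frontier hΩ) ?_
    have hlim : Tendsto (fun s : ℝ => s * ‖w‖ ^ 2) (𝓝[>] 0) (𝓝 0) := by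
      have : Tendsto (fun s : ℝ => s * ‖w‖ ^ 2) (𝓝 0) (𝓝 (0 * ‖w‖ ^ 2)) :=
        (tendsto_id).mul_const _
      rw [zero_mul] at this
      exact this.mono_left nhdsWithin_le_nhds
    filter_upwards [hlim.eventually_lt_const (u := R * inner ℝ μ w) (by positivity),
      self_mem_nhdsWithin] with s hs hs0
    have hs0' : (0 : ℝ) < s := hs0
    refine ball_subset_of_le_infDist hx₀ hR.le ?_
    rw [mem_ball_iff_norm]
    have h1 : x + s • w - x₀ = s • w - R • μ := by rw [← hx₀']; abel
    rw [h1]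
    have h2 : ‖s • w - R • μ‖ ^ 2 < R ^ 2 := by
      rw [norm_sub_sq_real, real_inner_smul_left, real_inner_smul_right, norm_smul, norm_smul,
        hμ1, Real.norm_of_nonneg hs0'.le, Real.norm_of_nonneg hpos.le, real_inner_comm μ w]
      have : s * (s * ‖w‖ ^ 2) < s * (R * inner ℝ μ w) := by gcongr
      have h5 : 0 < s * (R * inner ℝ μ w) := by positivity
      nlinarith
    exact lt_of_pow_lt_pow_left₀ 2 hpos.le h2
  obtain ⟨h1, h2⟩ := eq_smul_innerSL_of_nonneg hμ1 (innerSL ℝ ν) hpt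
  set c := innerSL ℝ ν μ with hc
  have h3 : ‖innerSL ℝ ν‖ = ‖c • innerSL ℝ μ‖ := by rw [← h2]
  rw [norm_smul, innerSL_apply_norm, innerSL_apply_norm, h.norm_normal, hμ1, mul_one,
    Real.norm_of_nonneg h1] at h3
  rw [← h3, one_smul] at h2
  have h4 : ν = μ := by
    refine ext_inner_right ℝ fun w => ?_
    simpa using congrArg (fun L : E n →L[ℝ] ℝ => L w) h2
  rw [h4, ← hx₀']; abel

/-- Second order Taylor expansion at a critical point with value zero. -/
theorem taylor_two {W : Type*} [NormedAddCommGroup W] [NormedSpace ℝ W] {g : W → ℝ}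
    (hg : ContDiffAt ℝ 2 g 0) (h0 : g 0 = 0) (h1 : fderiv ℝ g 0 = 0) {η : ℝ} (hη : 0 < η) :
    ∀ᶠ v in 𝓝 (0 : W), |g v - fderiv ℝ (fderiv ℝ g) 0 v v / 2| ≤ η * ‖v‖ ^ 2 := by
  set G := fderiv ℝ (fderiv ℝ g) 0 with hGdef
  have hsymm : ∀ v w, G v w = G w v := fun v w => (hg.isSymmSndFDerivAt (by simp)) v w
  have hG : HasFDerivAt (fderiv ℝ g) G 0 :=
    ((hg.fderiv_right (m := 1) (by norm_num)).differentiableAt (by norm_num)).hasFDerivAt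
  have hlo := hG.isLittleO.def hη
  simp only [h1, sub_zero] at hlo
  have hd : ∀ᶠ v in 𝓝 (0 : W), HasFDerivAt g (fderiv ℝ g v) v := by
    filter_upwards [hg.eventually (by simp)] with v hv
    exact (hv.differentiableAt (by norm_num)).hasFDerivAt
  obtain ⟨δ, hδ, hball⟩ := Metric.eventually_nhds_iff_ball.mp (hlo.and hd)
  filter_upwards [Metric.ball_mem_nhds _ hδ] with v hv
  have hsub : Metric.closedBall (0 : W) ‖v‖ ⊆ Metric.ball 0 δ := by
    refine Metric.closedBall_subset_ball ?_
    simpa using hv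
  -- The mean value inequality is applied to `g - G(w, w)/2`, whose derivative is at most `η ‖v‖` on
  -- this ball.
  have hder : ∀ w ∈ Metric.closedBall (0 : W) ‖v‖,
      HasFDerivWithinAt (fun w => g w - G w w / 2) (fderiv ℝ g w - G w)
        (Metric.closedBall 0 ‖v‖) w := by
    intro w hw
    have h2 := (G.hasFDerivAt (x := w)).clm_apply (hasFDerivAt_id w)
    have h3 := (hball w (hsub hw)).2.sub (h2.mul_const (1 / 2 : ℝ))
    refine (h3.congr_fderiv ?_).hasFDerivWithinAt.congr (fun z _ => by simp [div_eq_mul_inv])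
      (by simp [div_eq_mul_inv])
    ext u
    simp [hsymm u w]
    ring
  have hb : ∀ w ∈ Metric.closedBall (0 : W) ‖v‖, ‖fderiv ℝ g w - G w‖ ≤ η * ‖v‖ := by
    intro w hw
    refine (hball w (hsub hw)).1.trans ?_
    gcongr
    simpa using hw
  have := (convex_closedBall (0 : W) ‖v‖).norm_image_sub_le_of_norm_hasFDerivWithin_le
    (x := 0) (y := v) hder hb (by simp) (by simp)
  simpa [h0, pow_two, mul_assoc] using this

theorem IsNormalGraph.taylor (h : IsNormalGraph Ω x ν r g) {η : ℝ} (hη : 0 < η) :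
    ∀ᶠ v in 𝓝 (0 : (Submodule.span ℝ {ν})ᗮ),
      |g v - hessianForm g 0 v v / 2| ≤ η * ‖v‖ ^ 2 :=
  taylor_two h.contDiffAt h.map_zero h.fderiv_zero hη

/-- The scalar product of tangential components. -/
def tangentForm (ν : E n) : E n →L[ℝ] E n →L[ℝ] ℝ :=
  extendForm (Submodule.span ℝ {ν})ᗮ (innerSL ℝ)

theorem tangentForm_apply (v w : E n) :
    tangentForm ν v w = inner ℝ (tproj ν v) (tproj ν w) := rfl

theorem norm_smul_tangentForm_le (s : ℝ) : ‖s • tangentForm ν‖ ≤ |s| := by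
  refine ContinuousLinearMap.opNorm_le_bound₂ _ (abs_nonneg s) fun v w => ?_
  rw [_root_.smul_apply, _root_.smul_apply, norm_smul, tangentForm_apply, mul_assoc,
    Real.norm_eq_abs s]
  gcongr
  refine (norm_inner_le_norm _ _).trans ?_
  gcongr <;> exact norm_tproj_le _

/-- A quadratic approximation of the distance from the boundary near the normal line through
`y`. -/
def quadDist (y ν : E n) (B : E n →L[ℝ] E n →L[ℝ] ℝ) (z : E n) : ℝ :=
  inner ℝ ν (z - y) - B (z - y) (z - y) / 2

theorem continuous_quadDist (y ν : E n) (B : E n →L[ℝ] E n →L[ℝ] ℝ) :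
    Continuous (quadDist y ν B) := by
  unfold quadDist; fun_prop

theorem IsNormalGraph.quadDist_add (h : IsNormalGraph Ω x ν r g) (hΩ : IsOpen Ω) (ε : ℝ)
    (z : E n) : quadDist x ν (curvForm Ω x + ε • tangentForm ν) z =
      inner ℝ ν (z - x) - (hessianForm g 0 (tproj ν (z - x)) (tproj ν (z - x))) / 2
        - ε / 2 * ‖tproj ν (z - x)‖ ^ 2 := by
  rw [quadDist, h.curvForm_eq hΩ]
  simp only [_root_.add_apply, _root_.smul_apply, extendForm_apply, tangentForm_apply,
    real_inner_self_eq_norm_sq, smul_eq_mul]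
  ring

/-- Upper touching of the distance by a quadratic approximation. -/
theorem IsNormalGraph.eventually_le_quadDist (h : IsNormalGraph Ω x ν r g) (hΩ : IsOpen Ω)
    {ε t₀ : ℝ} (hε : 0 < ε) (ht₀ : 0 < t₀) : ∀ᶠ z in 𝓝 (x + t₀ • ν),
      d Ω z ≤ quadDist x ν (curvForm Ω x + (-ε) • tangentForm ν) z := by
  have hv0 : Tendsto (fun z => tproj ν (z - x)) (𝓝 (x + t₀ • ν)) (𝓝 0) := by
    have : Continuous (fun z : E n => tproj ν (z - x)) := by fun_prop
    refine (this.tendsto' _ _ ?_)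
    rw [add_sub_cancel_left, map_smul, tproj_normal, smul_zero]
  have ht : Tendsto (fun z => inner ℝ ν (z - x)) (𝓝 (x + t₀ • ν)) (𝓝 t₀) := by
    have : Continuous (fun z : E n => inner ℝ ν (z - x)) := by fun_prop
    refine (this.tendsto' _ _ ?_)
    rw [add_sub_cancel_left, real_inner_smul_right, real_inner_self_eq_norm_sq, h.norm_normal]
    simp
  have hg0 : Tendsto (fun z => g (tproj ν (z - x))) (𝓝 (x + t₀ • ν)) (𝓝 0) := by
    have := h.contDiffAt.continuousAt.tendsto.comp hv0
    rwa [h.map_zero] at this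
  filter_upwards [hv0.eventually (h.taylor (half_pos hε)),
    hv0.eventually (Metric.ball_mem_nhds _ h.radius_pos),
    hg0.abs.eventually_lt_const (u := r) (by simpa using h.radius_pos),
    hg0.eventually_lt ht ht₀] with z h1 h2 h3 h4
  rw [h.quadDist_add hΩ]
  set v := tproj ν (z - x) with hv
  set t := inner ℝ ν (z - x) with ht'
  -- The competitor for the distance is the boundary point on the line through `z` parallel to `ν`.
  have hmem := h.add_mem_frontier hΩ (v := v) (by simpa using h2) h3
  have hdist : d Ω z ≤ dist z _ := Metric.infDist_le_dist_of_mem hmem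
  have h5 : z - (x + (v : E n) + g v • ν) = (t - g v) • ν := by
    conv_lhs => rw [decomp h.norm_normal x z]
    rw [sub_smul]; abel
  rw [dist_eq_norm, h5, norm_smul, h.norm_normal, mul_one, Real.norm_of_nonneg (by linarith)]
    at hdist
  have h6 := (abs_le.mp h1).1
  linarith

/-- A lower bound for the hypotenuse, exceeding the leg `a` by a multiple of `ρ²`. Squaring leaves
the factor `a/(2t₀) + ρ²/(16t₀²)`, which is at most `3/4 + 1/4`. -/
theorem add_sq_div_le {a ρ t₀ N : ℝ} (hN : 0 ≤ N) (ht₀ : 0 < t₀)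
    (ha1 : a ≤ 3 / 2 * t₀) (hρ0 : 0 ≤ ρ) (hρt : ρ ≤ t₀ / 2) (h : ρ ^ 2 + a ^ 2 ≤ N ^ 2) :
    a + ρ ^ 2 / (4 * t₀) ≤ N := by
  have e1 : (a + ρ ^ 2 / (4 * t₀)) ^ 2 =
      a ^ 2 + ρ ^ 2 * (a / (2 * t₀) + ρ ^ 2 / (16 * t₀ ^ 2)) := by
    field_simp
    ring
  have e2 : a / (2 * t₀) ≤ 3 / 4 := by
    rw [div_le_iff₀ (by positivity)]; linarith
  have e3 : ρ ^ 2 / (16 * t₀ ^ 2) ≤ 1 / 4 := by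
    rw [div_le_iff₀ (by positivity)]; nlinarith
  have e4 : ρ ^ 2 * (a / (2 * t₀) + ρ ^ 2 / (16 * t₀ ^ 2)) ≤ ρ ^ 2 * 1 := by
    gcongr; linarith
  exact le_of_sq_le_sq (by linarith) hN

/-- Replacing `w` by `v` costs `K ‖v‖ ρ` and multiples of `ρ²`. Young's inequality turns the mixed
term into `ε/4 ‖v‖²` plus a multiple of `ρ²`, and all `ρ²` terms are absorbed because `t₀` is small.
-/
theorem quadratic_le {W : Type*} [NormedAddCommGroup W] [NormedSpace ℝ W]
    {G : W →L[ℝ] W →L[ℝ] ℝ} (hsymm : ∀ v w, G v w = G w v) {K ε t₀ : ℝ}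
    (hK : ∀ v w, |G v w| ≤ K * ‖v‖ * ‖w‖) (hε : 0 < ε)
    (hKt : K ^ 2 / ε + K / 2 + ε / 4 ≤ 1 / (4 * t₀)) (v w : W) :
    G w w / 2 + ε / 8 * ‖w‖ ^ 2 ≤ G v v / 2 + ε / 2 * ‖v‖ ^ 2 + ‖v - w‖ ^ 2 / (4 * t₀) := by
  set ρ := ‖v - w‖ with hρ
  have hG : G w w ≤ G v v + 2 * (K * ‖v‖ * ρ) + K * ρ * ρ := by
    have e0 : ‖w - v‖ = ρ := by rw [hρ, norm_sub_rev]
    have e1 := (abs_le.mp (hK v (w - v))).2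
    have e2 := (abs_le.mp (hK (w - v) (w - v))).2
    rw [e0] at e1 e2
    have e3 : G w w = G v v + 2 * G v (w - v) + G (w - v) (w - v) := by
      have e4 := hsymm v w
      simp only [map_sub, _root_.sub_apply]
      linarith
    rw [e3]; linarith
  have hw2 : ‖w‖ ^ 2 ≤ 2 * ‖v‖ ^ 2 + 2 * ρ ^ 2 := by
    have e1 : ‖w‖ ≤ ‖v‖ + ρ := by
      have := norm_sub_le v (v - w)
      rwa [sub_sub_cancel] at this
    nlinarith [norm_nonneg w, sq_nonneg (‖v‖ - ρ)]
  have hyoung : K * ‖v‖ * ρ ≤ ε / 4 * ‖v‖ ^ 2 + K ^ 2 / ε * ρ ^ 2 := by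
    have : 0 ≤ ε * (‖v‖ / 2 - K / ε * ρ) ^ 2 := by positivity
    have e : ε * (‖v‖ / 2 - K / ε * ρ) ^ 2 =
        ε / 4 * ‖v‖ ^ 2 + K ^ 2 / ε * ρ ^ 2 - K * ‖v‖ * ρ := by
      field_simp
      ring
    linarith
  have hlast : (K ^ 2 / ε + K / 2 + ε / 4) * ρ ^ 2 ≤ ρ ^ 2 / (4 * t₀) := by
    have := mul_le_mul_of_nonneg_right hKt (sq_nonneg ρ)
    rwa [one_div_mul_eq_div] at this
  have hε8 : ε / 8 * ‖w‖ ^ 2 ≤ ε / 8 * (2 * ‖v‖ ^ 2 + 2 * ρ ^ 2) := by gcongr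
  linarith

/-- Lower touching of the distance by a quadratic approximation. -/
theorem IsNormalGraph.eventually_quadDist_le (h : IsNormalGraph Ω x ν r g) (hΩ : IsOpen Ω)
    (hcpt : IsCompact (frontier Ω)) {ε t₀ K κ : ℝ} (hε : 0 < ε) (ht₀ : 0 < t₀)
    (hK : ∀ v w, |hessianForm g 0 v w| ≤ K * ‖v‖ * ‖w‖)
    (hκ : ∀ y ∈ frontier Ω, inner ℝ ν (y - x) ≤ κ * ‖y - x‖ ^ 2)
    (hκt : κ * t₀ ≤ 1 / 4) (hKt : K ^ 2 / ε + K / 2 + ε / 4 ≤ 1 / (4 * t₀)) :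
    ∀ᶠ z in 𝓝 (x + t₀ • ν),
      quadDist x ν (curvForm Ω x + ε • tangentForm ν) z ≤ d Ω z := by
  have hνν : inner ℝ ν ν = (1 : ℝ) := by
    rw [real_inner_self_eq_norm_sq, h.norm_normal]; norm_num
  have hv0 : Tendsto (fun z => tproj ν (z - x)) (𝓝 (x + t₀ • ν)) (𝓝 0) := by
    have : Continuous (fun z : E n => tproj ν (z - x)) := by fun_prop
    refine (this.tendsto' _ _ ?_)
    rw [add_sub_cancel_left, map_smul, tproj_normal, smul_zero]
  have ht : Tendsto (fun z => inner ℝ ν (z - x)) (𝓝 (x + t₀ • ν)) (𝓝 t₀) := by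
    have : Continuous (fun z : E n => inner ℝ ν (z - x)) := by fun_prop
    refine (this.tendsto' _ _ ?_)
    rw [add_sub_cancel_left, real_inner_smul_right, hνν, mul_one]
  obtain ⟨δ, hδ, hδb⟩ := Metric.eventually_nhds_iff_ball.mp
    (h.taylor (η := ε / 8) (by positivity))
  set r' := min (min δ r) (t₀ / 4) with hr'
  have hr'pos : 0 < r' := lt_min (lt_min hδ h.radius_pos) (by positivity)
  have hr'δ : r' ≤ δ := (min_le_left _ _).trans (min_le_left _ _)
  have hr'r : r' ≤ r := (min_le_left _ _).trans (min_le_right _ _)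
  have hr't : r' ≤ t₀ / 4 := min_le_right _ _
  -- By `hκ` and `κ t₀ ≤ 1/4`, boundary points at distance at least `r'` from `x` have distance at
  -- least `R > t₀` from `x + t₀ ν`.
  set R := Real.sqrt (t₀ ^ 2 + r' ^ 2 / 2) with hR
  have hRt : t₀ < R := by
    rw [hR]
    refine Real.lt_sqrt_of_sq_lt ?_
    have : 0 < r' ^ 2 / 2 := by positivity
    linarith
  have hD : Tendsto (fun z => quadDist x ν (curvForm Ω x + ε • tangentForm ν) z +
      ‖z - (x + t₀ • ν)‖) (𝓝 (x + t₀ • ν)) (𝓝 t₀) := by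
    have hc := continuous_quadDist x ν (curvForm Ω x + ε • tangentForm ν)
    refine Continuous.tendsto' (by fun_prop) _ _ ?_
    rw [h.quadDist_add hΩ, add_sub_cancel_left, map_smul, tproj_normal, real_inner_smul_right, hνν]
    simp
  have hne : (frontier Ω).Nonempty := ⟨x, h.mem_frontier hΩ⟩
  filter_upwards [hv0.norm.eventually_lt_const (u := t₀ / 4) (by simpa using ht₀),
    ht.eventually_lt_const (u := 5 / 4 * t₀) (by linarith),
    ht.eventually_const_lt (u := 3 / 4 * t₀) (by linarith),
    hD.eventually_lt_const hRt] with z h1 h2 h3 h4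
  obtain ⟨y, hy, hyd⟩ := hcpt.exists_infDist_eq_dist hne z
  change d Ω z = _ at hyd
  rw [hyd, dist_eq_norm]
  -- If the nearest boundary point `y` to `z` is close to `x`, it lies on the graph and Taylor's
  -- formula applies; otherwise `R` leaves strict room.
  rcases lt_or_ge ‖y - x‖ r' with hnear | hfar
  · rw [h.quadDist_add hΩ]
    set v := tproj ν (z - x) with hv
    set t := inner ℝ ν (z - x) with ht'
    set w := tproj ν (y - x) with hw
    set s := inner ℝ ν (y - x) with hs
    have hsg : s = g w := by
      have := h.isLocalDefining.eq_zero hΩ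
        (mem_ball_iff_norm.mpr (hnear.trans_le hr'r)) hy
      rw [graphHeight, sub_eq_zero] at this
      exact this
    have hwr : ‖w‖ < r' := (norm_tproj_le _).trans_lt hnear
    have hsr : |s| < r' := by
      refine (abs_real_inner_le_norm _ _).trans_lt ?_
      rwa [h.norm_normal, one_mul]
    have htay := hδb w (by simpa using hwr.trans_le hr'δ)
    rw [← hsg] at htay
    have htay' := (abs_le.mp htay).2
    have hzy : z - y = ((v - w : (Submodule.span ℝ {ν})ᗮ) : E n) + (t - s) • ν := by
      conv_lhs => rw [decomp h.norm_normal x z, decomp h.norm_normal x y]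
      rw [Submodule.coe_sub, sub_smul]; abel
    have hnorm : ‖z - y‖ ^ 2 = ‖v - w‖ ^ 2 + (t - s) ^ 2 := by
      rw [hzy, norm_coe_add_smul_sq h.norm_normal]
    set ρ := ‖v - w‖ with hρ
    have hρ0 : 0 ≤ ρ := norm_nonneg _
    have hρt : ρ ≤ t₀ / 2 := by
      have := norm_sub_le v w
      linarith
    have hs1 := (abs_lt.mp hsr).1
    have hs2 := (abs_lt.mp hsr).2
    have ha1 : t - s ≤ 3 / 2 * t₀ := by linarith
    refine le_trans ?_ (add_sq_div_le (norm_nonneg _) ht₀ ha1 hρ0 hρt hnorm.ge)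
    have hG := quadratic_le h.hessian_symm hK hε hKt v w
    rw [← hρ] at hG
    linarith
  · have hfar2 : R ≤ ‖y - (x + t₀ • ν)‖ := by
      rw [hR]
      refine Real.sqrt_le_iff.mpr ⟨norm_nonneg _, ?_⟩
      have e1 : y - (x + t₀ • ν) = (y - x) - t₀ • ν := by abel
      rw [e1, norm_sub_sq_real, real_inner_smul_right, norm_smul, h.norm_normal, mul_one,
        Real.norm_of_nonneg ht₀.le, real_inner_comm]
      have e2 : t₀ * inner ℝ ν (y - x) ≤ t₀ * (κ * ‖y - x‖ ^ 2) :=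
        mul_le_mul_of_nonneg_left (hκ y hy) ht₀.le
      have e3 : κ * t₀ * ‖y - x‖ ^ 2 ≤ 1 / 4 * ‖y - x‖ ^ 2 := by gcongr
      have e4 : r' ^ 2 ≤ ‖y - x‖ ^ 2 := by gcongr
      nlinarith
    have e1 := norm_sub_norm_le (y - (x + t₀ • ν)) (z - (x + t₀ • ν))
    rw [sub_sub_sub_cancel_right, norm_sub_rev y z] at e1
    linarith

end Touching

/-! ### Touching quadratics with uniform constants -/

section UniformTouching

variable {n : ℕ} {Ω : Set (E n)}

/-- The part of the data of a touching quadratic that controls its Hessian: `ν` is a unit null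
vector of the symmetric form `B`, the first `k - 1` elementary symmetric functions of `B` are at
least `c`, the `k`-th is bounded by `C`, and the `(k-1)`-th lies between `lo` and `hi`. -/
structure IsTouchingForm (k : ℕ) (c C lo hi : ℝ) (ν : E n) (B : E n →L[ℝ] E n →L[ℝ] ℝ) :
    Prop where
  norm_eq : ‖ν‖ = 1
  symm : ∀ v w, B v w = B w v
  null : ∀ w, B w ν = 0
  pos : ∀ j < k, c ≤ formSymm j B
  bound : |formSymm k B| ≤ C
  lower : lo ≤ formSymm (k - 1) B
  upper : formSymm (k - 1) B ≤ hi

theorem isCompact_frontier (hΩ : IsBoundedDomain Ω) : IsCompact (frontier Ω) :=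
  Metric.isCompact_of_isClosed_isBounded isClosed_frontier
    (hΩ.2.2.closure.subset frontier_subset_closure)

theorem nonempty_frontier (hn : 2 ≤ n) (hΩ : IsBoundedDomain Ω) : (frontier Ω).Nonempty := by
  rw [nonempty_frontier_iff]
  refine ⟨hΩ.2.1.nonempty, fun h => ?_⟩
  have : Nonempty (Fin n) := ⟨⟨0, by omega⟩⟩
  have := hΩ.2.2
  rw [h] at this
  exact NormedSpace.unbounded_univ ℝ (E n) this

theorem d_pos (hΩ : IsOpen Ω) (hne : (frontier Ω).Nonempty) {x : E n} (hx : x ∈ Ω) :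
    0 < d Ω x := by
  refine (isClosed_frontier.notMem_iff_infDist_pos hne).mp fun h => ?_
  rw [hΩ.frontier_eq] at h
  exact h.2 hx

theorem formSymm_curvForm_pos {k : ℕ} (hΩ : IsOpen Ω) (hreg : HasC31Boundary Ω)
    (hconv : IsStrictlyConvexOfOrder (k - 1) Ω) {y : E n} (hy : y ∈ frontier Ω) {j : ℕ}
    (hj : j < k) : 0 < formSymm j (curvForm Ω y) := by
  rcases Nat.eq_zero_or_pos j with rfl | hj0
  · rw [formSymm_zero]; exact one_pos
  obtain ⟨ρ, hρ⟩ := exists_isPrincipalCurvatures hreg hy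
  rw [← hρ.esymm_eq hΩ]
  exact hconv y hy ρ hρ j hj0 (by omega)

theorem exists_formSymm_lower_bound {k : ℕ} (hk : 1 ≤ k) (hΩ : IsBoundedDomain Ω)
    (hne : (frontier Ω).Nonempty) (hreg : HasC31Boundary Ω)
    (hconv : IsStrictlyConvexOfOrder (k - 1) Ω) :
    ∃ c > 0, ∀ j < k, ∀ y ∈ frontier Ω, c ≤ formSymm j (curvForm Ω y) := by
  have h1 : ∀ j : ℕ, ∃ c > 0, j < k → ∀ y ∈ frontier Ω, c ≤ formSymm j (curvForm Ω y) := by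
    intro j
    by_cases hj : j < k
    · obtain ⟨y, hy, hmin⟩ := (isCompact_frontier hΩ).exists_isMinOn hne
        ((continuous_formSymm j).comp_continuousOn (continuousOn_curvForm hΩ.1 hreg))
      exact ⟨_, formSymm_curvForm_pos hΩ.1 hreg hconv hy hj, fun _ z hz => hmin hz⟩
    · exact ⟨1, one_pos, fun h => absurd h hj⟩
  choose c hc hcb using h1
  have hne' : (Finset.range k).Nonempty := Finset.nonempty_range_iff.mpr (by omega)
  refine ⟨(Finset.range k).inf' hne' c, ?_, ?_⟩
  · exact (Finset.lt_inf'_iff hne').mpr fun j _ => hc j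
  · intro j hj y hy
    exact (Finset.inf'_le c (Finset.mem_range.mpr hj)).trans (hcb j hj y hy)

theorem formSymm_mem_Icc (k : ℕ) (hΩ : IsBoundedDomain Ω) (hreg : HasC31Boundary Ω)
    {y : E n} (hy : y ∈ frontier Ω) :
    l₀ k Ω ≤ formSymm (k - 1) (curvForm Ω y) ∧ formSymm (k - 1) (curvForm Ω y) ≤ L₀ k Ω := by
  have hcpt : IsCompact ((fun y => formSymm (k - 1) (curvForm Ω y)) '' frontier Ω) :=
    (isCompact_frontier hΩ).image_of_continuousOn
      ((continuous_formSymm _).comp_continuousOn (continuousOn_curvForm hΩ.1 hreg))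
  rw [l₀, L₀, curvatureValues_eq hΩ.1 hreg]
  exact ⟨csInf_le hcpt.bddBelow ⟨y, hy, rfl⟩, le_csSup hcpt.bddAbove ⟨y, hy, rfl⟩⟩

theorem l₀_pos {k : ℕ} (hk : 1 ≤ k) (hΩ : IsBoundedDomain Ω)
    (hne : (frontier Ω).Nonempty) (hreg : HasC31Boundary Ω)
    (hconv : IsStrictlyConvexOfOrder (k - 1) Ω) : 0 < l₀ k Ω := by
  obtain ⟨c, hc, hcb⟩ := exists_formSymm_lower_bound hk hΩ hne hreg hconv
  refine hc.trans_le ?_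
  rw [l₀, curvatureValues_eq hΩ.1 hreg]
  refine le_csInf (hne.image _) ?_
  rintro _ ⟨y, hy, rfl⟩
  exact hcb _ (by omega) y hy

theorem l₀_le_L₀ (k : ℕ) (hΩ : IsBoundedDomain Ω) (hne : (frontier Ω).Nonempty)
    (hreg : HasC31Boundary Ω) : l₀ k Ω ≤ L₀ k Ω := by
  obtain ⟨y, hy⟩ := hne
  have := formSymm_mem_Icc k hΩ hreg hy
  exact this.1.trans this.2

/-- Uniform continuity at the points of the compact set of curvature forms; `B` itself need not be
one. -/
theorem exists_formSymm_perturbation (k : ℕ) (hΩ : IsBoundedDomain Ω) (hreg : HasC31Boundary Ω)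
    {ε : ℝ} (hε : 0 < ε) : ∃ θ > 0, ∀ y ∈ frontier Ω, ∀ B : E n →L[ℝ] E n →L[ℝ] ℝ,
      dist (curvForm Ω y) B < θ → ∀ j ≤ k,
        |formSymm j (curvForm Ω y) - formSymm j B| < ε := by
  have hcpt : IsCompact (curvForm Ω '' frontier Ω) :=
    (isCompact_frontier hΩ).image_of_continuousOn (continuousOn_curvForm hΩ.1 hreg)
  have h1 : ∀ j ∈ Finset.range (k + 1),
      ∀ᶠ p : (E n →L[ℝ] E n →L[ℝ] ℝ) × (E n →L[ℝ] E n →L[ℝ] ℝ) in uniformity _,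
        p.1 ∈ curvForm Ω '' frontier Ω → |formSymm j p.1 - formSymm j p.2| < ε := by
    intro j _
    have := hcpt.uniformContinuousAt_of_continuousAt (formSymm j)
      (fun a _ => (continuous_formSymm j).continuousAt) (Metric.dist_mem_uniformity hε)
    filter_upwards [this] with p hp hps
    have := hp hps
    rwa [← Real.dist_eq]
  obtain ⟨θ, hθ, hsub⟩ := (Metric.mem_uniformity_dist (α := E n →L[ℝ] E n →L[ℝ] ℝ)).mp
    ((Finset.eventually_all _).mpr h1)
  refine ⟨θ, hθ, fun y hy B hB j hj => ?_⟩
  exact hsub hB j (Finset.mem_range.mpr (by omega)) ⟨y, hy, rfl⟩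

/-- Near the boundary the distance function is touched from both sides by quadratic functions
whose Hessians are close to minus the second fundamental form. -/
theorem exists_touching {k : ℕ} (hk : 1 ≤ k) (hΩ : IsBoundedDomain Ω)
    (hne : (frontier Ω).Nonempty) (hreg : HasC31Boundary Ω)
    (hconv : IsStrictlyConvexOfOrder (k - 1) Ω) :
    ∃ c > 0, ∃ C, ∀ ε > 0, ∃ δ > 0, ∀ x₀ ∈ Ω, d Ω x₀ < δ → ∃ (y ν : E n)
      (B₁ B₂ : E n →L[ℝ] E n →L[ℝ] ℝ), x₀ = y + d Ω x₀ • ν ∧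
        IsTouchingForm k c C (l₀ k Ω - ε) (L₀ k Ω + ε) ν B₁ ∧
        IsTouchingForm k c C (l₀ k Ω - ε) (L₀ k Ω + ε) ν B₂ ∧
        (∀ᶠ z in 𝓝 x₀, quadDist y ν B₁ z ≤ d Ω z) ∧
        (∀ᶠ z in 𝓝 x₀, d Ω z ≤ quadDist y ν B₂ z) := by
  obtain ⟨c, hc, hcb⟩ := exists_formSymm_lower_bound hk hΩ hne hreg hconv
  have hcpt := isCompact_frontier hΩ
  have hcurv := continuousOn_curvForm hΩ.1 hreg
  obtain ⟨C, hC⟩ := hcpt.exists_bound_of_continuousOn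
    ((continuous_formSymm k).comp_continuousOn hcurv)
  obtain ⟨K, hK⟩ := IsCompact.exists_bound_of_continuousOn (E := E n →L[ℝ] E n →L[ℝ] ℝ) hcpt hcurv
  obtain ⟨κ, hκ, hκb⟩ := exists_normal_bound hΩ.1 hreg hcpt
  refine ⟨c / 2, half_pos hc, C + c / 2, fun ε hε => ?_⟩
  -- The tolerance `c / 2` keeps the bounds `c / 2` and `C + c / 2` independent of `ε`.
  obtain ⟨θ, hθ, hθb⟩ := exists_formSymm_perturbation k hΩ hreg (lt_min hε (half_pos hc))
  set e := θ / 2 with he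
  have hepos : 0 < e := half_pos hθ
  set Q := K ^ 2 / e + K / 2 + e / 4 with hQ
  set Q' := max Q 1 with hQ'
  have hQ'pos : 0 < Q' := lt_max_of_lt_right one_pos
  -- These are the two smallness conditions on `t₀ = d Ω x₀` for touching from below; `Q'` replaces
  -- `Q` only to have a positive denominator.
  refine ⟨min (1 / (4 * κ)) (1 / (4 * Q')), by positivity, fun x₀ hx₀ hdx => ?_⟩
  have hd0 := d_pos hΩ.1 hne hx₀
  obtain ⟨y, hy, hyd⟩ := hcpt.exists_infDist_eq_dist hne x₀
  obtain ⟨ν, r, g, hg⟩ := hreg.exists_normalGraph hy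
  have hx₀y := hg.eq_add_smul_of_nearest hΩ.1 hx₀ hyd hd0
  have hform : ∀ s : ℝ, |s| ≤ e → IsTouchingForm k (c / 2) (C + c / 2) (l₀ k Ω - ε) (L₀ k Ω + ε) ν
      (curvForm Ω y + s • tangentForm ν) := by
    intro s hs
    have hdist : dist (curvForm Ω y) (curvForm Ω y + s • tangentForm ν) < θ := by
      calc dist (curvForm Ω y) (curvForm Ω y + s • tangentForm ν) = ‖s • tangentForm ν‖ :=
            dist_self_add_right (E := E n →L[ℝ] E n →L[ℝ] ℝ) _ _
        _ ≤ e := (norm_smul_tangentForm_le s).trans hs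
        _ < θ := by rw [he]; linarith
    have hpert := hθb y hy _ hdist
    obtain ⟨hl, hL⟩ := formSymm_mem_Icc k hΩ hreg hy
    refine ⟨hg.norm_normal, ?_, ?_, ?_, ?_, ?_, ?_⟩
    · intro v w
      simp only [hg.curvForm_eq hΩ.1, _root_.add_apply, _root_.smul_apply, extendForm_apply,
        tangentForm_apply]
      rw [hg.hessian_symm, real_inner_comm]
    · intro w
      simp [hg.curvForm_eq hΩ.1, tangentForm_apply, tproj_normal]
    · intro j hj
      have h1 := (abs_lt.mp ((hpert j hj.le).trans_le (min_le_right _ _))).2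
      have h2 := hcb j hj y hy
      linarith
    · have h1 := (hpert k le_rfl).trans_le (min_le_right _ _)
      have h2 := hC y hy
      rw [Function.comp, Real.norm_eq_abs] at h2
      rw [abs_sub_comm] at h1
      have h3 := abs_sub_abs_le_abs_sub (formSymm k (curvForm Ω y + s • tangentForm ν))
        (formSymm k (curvForm Ω y))
      linarith
    · have h1 := (abs_lt.mp ((hpert (k - 1) (by omega)).trans_le (min_le_left _ _))).2
      linarith
    · have h1 := (abs_lt.mp ((hpert (k - 1) (by omega)).trans_le (min_le_left _ _))).1
      linarith
  refine ⟨y, ν, curvForm Ω y + e • tangentForm ν, curvForm Ω y + (-e) • tangentForm ν, hx₀y,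
    hform _ (abs_of_pos hepos).le, hform _ (by rw [abs_neg, abs_of_pos hepos]), ?_, ?_⟩
  · have hKb : ∀ v w, |hessianForm g 0 v w| ≤ K * ‖v‖ * ‖w‖ := by
      intro v w
      have h1 : hessianForm g 0 v w = curvForm Ω y (v : E n) (w : E n) := by
        rw [hg.curvForm_eq hΩ.1, extendForm_apply, tproj_coe, tproj_coe]
      rw [h1, ← Real.norm_eq_abs]
      refine ((curvForm Ω y).le_opNorm₂ _ _).trans ?_
      have := hK y hy
      simp only [Submodule.coe_norm]
      gcongr
    have h1 := hg.eventually_quadDist_le hΩ.1 hcpt (t₀ := d Ω x₀) hepos hd0 hKb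
      (fun z hz => hκb y hy z hz ν r g hg) (by
        have := (hdx.trans_le (min_le_left _ _)).le
        rw [le_div_iff₀ (by positivity)] at this
        linarith) (by
        have := (hdx.trans_le (min_le_right _ _)).le
        rw [le_div_iff₀ (by positivity)] at this
        rw [le_div_iff₀ (by positivity)]
        have hQQ : Q ≤ Q' := le_max_left _ _
        nlinarith)
    rwa [← hx₀y] at h1
  · have h1 := hg.eventually_le_quadDist hΩ.1 hepos hd0
    rwa [← hx₀y] at h1

end UniformTouching

/-! ### Admissibility near a point -/

section TestFunction

variable {V : Type*} [NormedAddCommGroup V] [InnerProductSpace ℝ V] [FiniteDimensional ℝ V]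

/-- Positivity at `x` spreads to a neighbourhood, since the Hessian and its symmetric functions are
continuous. Test functions need only be checked at the touching point. -/
theorem exists_isAdmissible {k : ℕ} {ψ : V → ℝ} {x : V} (hψ : ContDiffAt ℝ 2 ψ x)
    (hpos : ∀ j, 1 ≤ j → j ≤ k → 0 < S j ψ x) :
    ∃ A : Set V, IsOpen A ∧ x ∈ A ∧ IsAdmissible k A ψ := by
  have hsm : ∀ z, ContDiffAt ℝ 2 ψ z → ∀ v w, hessianForm ψ z v w = hessianForm ψ z w v :=
    fun z hz v w => (hz.isSymmSndFDerivAt (by simp)) v w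
  have hcont : ContinuousAt (hessianForm ψ) x :=
    ((hψ.fderiv_right (m := 1) (by norm_num)).fderiv_right (m := 0) (by norm_num)).continuousAt
  have hev : ∀ j ∈ Finset.Icc 1 k, ∀ᶠ z in 𝓝 x, 0 < formSymm j (hessianForm ψ z) := by
    intro j hj
    rw [Finset.mem_Icc] at hj
    have hc : ContinuousAt (fun z => formSymm j (hessianForm ψ z)) x :=
      (continuous_formSymm j).continuousAt.comp hcont
    refine hc.eventually_const_lt ?_
    change 0 < formSymm j (hessianForm ψ x)
    rw [← S_eq_formSymm (hsm x hψ)]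
    exact hpos j hj.1 hj.2
  obtain ⟨A, hA, hAo, hxA⟩ := eventually_nhds_iff.mp
    (((Finset.eventually_all _).mpr hev).and (hψ.eventually (by simp)))
  refine ⟨A, hAo, hxA, fun z hz => (hA z hz).2.contDiffWithinAt, fun z hz j hj1 hjk => ?_⟩
  rw [S_eq_formSymm (hsm z (hA z hz).2)]
  exact (hA z hz).1 j (Finset.mem_Icc.mpr ⟨hj1, hjk⟩)

end TestFunction

/-! ### Functions of a touching quadratic -/

section RadialTest

variable {n : ℕ} {y ν : E n} {B : E n →L[ℝ] E n →L[ℝ] ℝ}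

theorem hasFDerivAt_quadDist (hsymm : ∀ v w, B v w = B w v) (z : E n) :
    HasFDerivAt (quadDist y ν B) (innerSL ℝ ν - B (z - y)) z := by
  have h1 : HasFDerivAt (fun z => inner ℝ ν (z - y)) (innerSL ℝ ν) z :=
    (innerSL ℝ ν).hasFDerivAt.comp z ((hasFDerivAt_id z).sub_const y)
  have h2 : HasFDerivAt (fun z => z - y) (ContinuousLinearMap.id ℝ (E n)) z :=
    (hasFDerivAt_id z).sub_const y
  have h3 := ((B.hasFDerivAt.comp z h2).clm_apply h2).mul_const (1 / 2 : ℝ)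
  refine ((h1.sub h3).congr_fderiv ?_).congr_of_eventuallyEq
    (Eventually.of_forall fun w => by simp [quadDist, div_eq_mul_inv])
  ext u
  have := hsymm u (z - y)
  simp only [map_sub, _root_.sub_apply] at this
  simp
  linarith

theorem contDiff_quadDist : ContDiff ℝ 2 (quadDist y ν B) := by
  have h1 : ContDiff ℝ 2 fun z : E n => z - y := contDiff_id.sub contDiff_const
  have h2 : ContDiff ℝ 2 fun z : E n => B (z - y) (z - y) :=
    (B.contDiff.comp h1).clm_apply h1
  exact (contDiff_const.inner ℝ h1).sub (h2.div_const 2)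

theorem quadDist_normal (hν : ‖ν‖ = 1) (hnull : ∀ w, B w ν = 0) (t : ℝ) :
    quadDist y ν B (y + t • ν) = t := by
  rw [quadDist, add_sub_cancel_left, real_inner_smul_right, real_inner_self_eq_norm_sq, hν,
    map_smul, hnull]
  simp

/-- The chain rule gives `η' D²Q + η'' DQ ⊗ DQ`. Here `D²Q = -B`, and on the normal line `DQ = ν`
because `ν` is null for `B`. -/
theorem hessianForm_comp_quadDist (hν : ‖ν‖ = 1) (hsymm : ∀ v w, B v w = B w v)
    (hnull : ∀ w, B w ν = 0) {t : ℝ} {η η₁ : ℝ → ℝ} {q : ℝ}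
    (hη : ∀ᶠ s in 𝓝 t, HasDerivAt η (η₁ s) s) (hη₁ : HasDerivAt η₁ q t) (v w : E n) :
    hessianForm (fun z => η (quadDist y ν B z)) (y + t • ν) v w =
      -η₁ t * B v w + q * (inner ℝ ν v * inner ℝ ν w) := by
  set D := quadDist y ν B
  set x := y + t • ν
  have hDx : D x = t := quadDist_normal hν hnull t
  have hD : ∀ z, HasFDerivAt D (innerSL ℝ ν - B (z - y)) z := hasFDerivAt_quadDist hsymm
  have hnear : ∀ᶠ z in 𝓝 x, HasDerivAt η (η₁ (D z)) (D z) := by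
    have hDt : Tendsto D (𝓝 x) (𝓝 t) := hDx ▸ (hD x).continuousAt.tendsto
    exact hDt.eventually hη
  have hf1 : fderiv ℝ (fun z => η (D z)) =ᶠ[𝓝 x]
      fun z => η₁ (D z) • (innerSL ℝ ν - B (z - y)) := by
    filter_upwards [hnear] with z hz
    exact (hz.comp_hasFDerivAt z (hD z)).fderiv
  have hη2 : HasDerivAt η₁ q (D x) := by rwa [hDx]
  have h1 : HasFDerivAt (fun z => η₁ (D z)) _ x := hη2.comp_hasFDerivAt x (hD x)
  have h2 : HasFDerivAt (fun z => innerSL ℝ ν - B (z - y)) (-B) x := by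
    have := (B.hasFDerivAt.comp x ((hasFDerivAt_id x).sub_const y)).const_sub (innerSL ℝ ν)
    simpa using this
  have h3 : HasFDerivAt (fun z => η₁ (D z) • (innerSL ℝ ν - B (z - y))) _ x := h1.smul h2
  rw [hessianForm, hf1.fderiv_eq, h3.fderiv]
  have hBν : ∀ u, B ν u = 0 := fun u => by rw [hsymm, hnull]
  have hxy : x - y = t • ν := add_sub_cancel_left _ _
  simp [hDx, hxy, hBν]
  ring

end RadialTest

/-! ### Primitives of positive monotone functions -/

section Primitive

/-- Monotonicity bounds `m` by `m t` on `(0, t]`, so integrability up to `0` needs no assumption at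
`0`. It serves both `F` and `M`. -/
theorem primitive_properties {m : ℝ → ℝ} {δ : ℝ} (hc : ContinuousOn m (Ioo 0 δ))
    (hpos : ∀ t ∈ Ioo 0 δ, 0 < m t) (hmono : MonotoneOn m (Ioo 0 δ)) {t : ℝ} (ht : t ∈ Ioo 0 δ) :
    HasDerivAt (fun t => ∫ s in (0 : ℝ)..t, m s) (m t) t ∧ 0 < ∫ s in (0 : ℝ)..t, m s ∧
      ∫ s in (0 : ℝ)..t, m s ≤ t * m t := by
  have hsub : Ioc 0 t ⊆ Ioo 0 δ := fun s hs => ⟨hs.1, hs.2.trans_lt ht.2⟩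
  have hint : IntervalIntegrable m volume 0 t := by
    rw [intervalIntegrable_iff_integrableOn_Ioc_of_le ht.1.le]
    refine Integrable.of_bound ((hc.mono hsub).aestronglyMeasurable measurableSet_Ioc) (m t) ?_
    refine (ae_restrict_iff' measurableSet_Ioc).mpr (Eventually.of_forall fun s hs => ?_)
    rw [Real.norm_of_nonneg (hpos s (hsub hs)).le]
    exact hmono (hsub hs) ht hs.2
  refine ⟨?_, ?_, ?_⟩
  · exact intervalIntegral.integral_hasDerivAt_right hint
      (hc.stronglyMeasurableAtFilter isOpen_Ioo t ht)
      (hc.continuousAt (isOpen_Ioo.mem_nhds ht))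
  · exact intervalIntegral.intervalIntegral_pos_of_pos_on hint
      (fun s hs => hpos s (hsub ⟨hs.1, hs.2.le⟩)) ht.1
  · have h1 : ∫ s in (0 : ℝ)..t, m s ≤ ∫ _ in (0 : ℝ)..t, m t :=
      intervalIntegral.integral_mono_on_of_le_Ioo ht.1.le hint
        intervalIntegrable_const (fun s hs => hmono (hsub ⟨hs.1, hs.2.le⟩) ht hs.2.le)
    simpa using h1

end Primitive

/-! ### The functions `H`, `Φ` and `φ` -/

section Nonlinearity

variable {k : ℕ} {f : ℝ → ℝ}

theorem F_properties (hf : CondF1 f) {s : ℝ} (hs : 0 < s) :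
    HasDerivAt (F f) (f s) s ∧ 0 < F f s := by
  have h := primitive_properties (m := f) (δ := s + 1) (t := s)
    (hf.1.continuousOn.mono fun x hx => hx.1) (fun x hx => hf.2.1 x hx.1)
    (hf.2.2.mono fun x hx => hx.1) ⟨hs, by linarith⟩
  exact ⟨h.1, h.2.1⟩

theorem H_pos (hf : CondF1 f) {s : ℝ} (hs : 0 < s) : 0 < H k f s := by
  have := (F_properties hf hs).2
  exact Real.rpow_pos_of_pos (by positivity) _

/-- This is the identity `H^k H' = f`, by which `f` appears in the Hessian of the barrier. -/
theorem hasDerivAt_H (hf : CondF1 f) {s : ℝ} (hs : 0 < s) :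
    HasDerivAt (H k f) (f s / H k f s ^ k) s := by
  obtain ⟨h1, h2⟩ := F_properties hf hs
  have hk : (0 : ℝ) < (k : ℝ) + 1 := by positivity
  have hX : 0 < ((k : ℝ) + 1) * F f s := by positivity
  have h3 := (h1.const_mul ((k : ℝ) + 1)).rpow_const (p := 1 / ((k : ℝ) + 1)) (Or.inl hX.ne')
  refine h3.congr_deriv ?_
  have h4 : (((k : ℝ) + 1) * F f s) ^ (1 / ((k : ℝ) + 1) - 1) = (H k f s ^ k)⁻¹ := by
    rw [H, ← Real.rpow_natCast, ← Real.rpow_mul hX.le, ← Real.rpow_neg hX.le]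
    congr 1
    field_simp
    ring
  rw [h4]
  field_simp

theorem deriv_H (hf : CondF1 f) {s : ℝ} (hs : 0 < s) :
    deriv (H k f) s = f s / H k f s ^ k := (hasDerivAt_H hf hs).deriv

theorem deriv_H_pos (hf : CondF1 f) {s : ℝ} (hs : 0 < s) : 0 < deriv (H k f) s := by
  rw [deriv_H hf hs]
  exact div_pos (hf.2.1 s hs) (pow_pos (H_pos hf hs) k)

theorem continuousOn_H (hf : CondF1 f) : ContinuousOn (H k f) (Ioi 0) := fun _ hs =>
  (hasDerivAt_H hf hs).continuousAt.continuousWithinAt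

theorem continuousOn_deriv_H (hf : CondF1 f) : ContinuousOn (deriv (H k f)) (Ioi 0) := by
  refine ContinuousOn.congr (f := fun s => f s / H k f s ^ k) ?_ fun s hs => deriv_H hf hs
  exact hf.1.continuousOn.div ((continuousOn_H hf).pow k) fun s hs => (pow_pos (H_pos hf hs) k).ne'

theorem hasDerivAt_Φ (hf : CondF1 f) (hf2 : CondF2 k f) {s : ℝ} (hs : 0 < s) :
    HasDerivAt (Φ k f) (-(1 / H k f s)) s := by
  have hcont : ContinuousOn (fun τ => 1 / H k f τ) (Ioi 0) :=
    continuousOn_const.div (continuousOn_H hf) fun τ hτ => (H_pos hf hτ).ne'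
  set a := s / 2
  have ha : 0 < a := half_pos hs
  have has : a < s := half_lt_self hs
  have hint : ∀ t, a < t → IntervalIntegrable (fun τ => 1 / H k f τ) volume a t := by
    intro t ht
    rw [intervalIntegrable_iff_integrableOn_Ioc_of_le ht.le]
    exact (hf2 a ha).mono_set Ioc_subset_Ioi_self
  have h1 : HasDerivAt (fun t => ∫ τ in a..t, 1 / H k f τ) (1 / H k f s) s :=
    intervalIntegral.integral_hasDerivAt_right (hint s has)
      (hcont.stronglyMeasurableAtFilter isOpen_Ioi s hs)
      (hcont.continuousAt (isOpen_Ioi.mem_nhds hs))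
  refine (h1.const_sub (Φ k f a)).congr_of_eventuallyEq ?_
  filter_upwards [isOpen_Ioi.mem_nhds has] with t ht
  have := intervalIntegral.integral_interval_add_Ioi (hf2 a ha) (hf2 t (ha.trans ht))
  rw [Φ, Φ, ← this]
  ring

theorem strictAntiOn_Φ (hf : CondF1 f) (hf2 : CondF2 k f) : StrictAntiOn (Φ k f) (Ioi 0) := by
  refine strictAntiOn_of_deriv_neg (convex_Ioi 0)
    (fun s hs => (hasDerivAt_Φ hf hf2 hs).continuousAt.continuousWithinAt) fun s hs => ?_
  rw [interior_Ioi] at hs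
  rw [(hasDerivAt_Φ hf hf2 hs).deriv]
  have := H_pos (k := k) hf hs
  simp [this]

theorem tendsto_Φ (hf2 : CondF2 k f) : Tendsto (Φ k f) atTop (𝓝 0) := by
  have h1 := intervalIntegral_tendsto_integral_Ioi 1 (hf2 1 one_pos) tendsto_id
  have h2 := h1.const_sub (Φ k f 1)
  rw [show Φ k f 1 - ∫ τ in Ioi 1, 1 / H k f τ = 0 from sub_self _] at h2
  refine h2.congr' ?_
  filter_upwards [eventually_gt_atTop 1] with t ht
  have := intervalIntegral.integral_interval_add_Ioi (hf2 1 one_pos) (hf2 t (one_pos.trans ht))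
  rw [Φ, Φ, ← this]
  simp

theorem Φ_pos (hf : CondF1 f) (hf2 : CondF2 k f) {s : ℝ} (hs : 0 < s) : 0 < Φ k f s := by
  have h1 : Φ k f (s + 1) < Φ k f s :=
    strictAntiOn_Φ hf hf2 hs (by simp; linarith) (by linarith)
  refine lt_of_le_of_lt (le_of_tendsto (tendsto_Φ hf2) ?_) h1
  filter_upwards [eventually_ge_atTop (s + 1)] with t ht
  exact (strictAntiOn_Φ hf hf2).antitoneOn (by simp; linarith) (by simp; linarith) ht

theorem φ_Φ (hf : CondF1 f) (hf2 : CondF2 k f) {s : ℝ} (hs : 0 < s) :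
    φ k f (Φ k f s) = s :=
  (strictAntiOn_Φ hf hf2).injOn.leftInvOn_invFunOn hs

theorem Φ_surjOn (hf : CondF1 f) (hf2 : CondF2 k f) {a t : ℝ} (ha : 0 < a) (ht : 0 < t)
    (hta : t < Φ k f a) : ∃ s, a < s ∧ Φ k f s = t := by
  obtain ⟨b, hb1, hb2⟩ := (((tendsto_Φ hf2).eventually_lt_const ht).and
    (eventually_gt_atTop a)).exists
  obtain ⟨s, hs, hst⟩ := intermediate_value_Icc' hb2.le
    (f := Φ k f) (fun s hs => (hasDerivAt_Φ hf hf2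
      (ha.trans_le hs.1)).continuousAt.continuousWithinAt) ⟨hb1.le, hta.le⟩
  refine ⟨s, lt_of_le_of_ne hs.1 ?_, hst⟩
  rintro rfl
  linarith

/-- Below `Φ(a)` the value `t` is attained by `Φ`, so `φ` is a genuine inverse there. -/
theorem φ_gt (hf : CondF1 f) (hf2 : CondF2 k f) {a t : ℝ} (ha : 0 < a) (ht : 0 < t)
    (hta : t < Φ k f a) : a < φ k f t ∧ Φ k f (φ k f t) = t := by
  obtain ⟨s, hs, rfl⟩ := Φ_surjOn hf hf2 ha ht hta
  rw [φ_Φ hf hf2 (ha.trans hs)]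
  exact ⟨hs, rfl⟩

theorem φ_lt (hf : CondF1 f) (hf2 : CondF2 k f) {a b t : ℝ} (hb : 0 < b) (ha : 0 < a) (ht : 0 < t)
    (hta : t < Φ k f a) (htb : Φ k f b < t) : φ k f t < b := by
  obtain ⟨h1, h2⟩ := φ_gt hf hf2 ha ht hta
  rw [← h2] at htb
  exact ((strictAntiOn_Φ hf hf2).lt_iff_gt hb (ha.trans h1)).mp htb

theorem tendsto_φ (hf : CondF1 f) (hf2 : CondF2 k f) :
    Tendsto (φ k f) (𝓝[>] 0) atTop := by
  refine tendsto_atTop.mpr fun N => ?_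
  have hN : 0 < max N 1 := lt_max_of_lt_right one_pos
  filter_upwards [Ioo_mem_nhdsGT (Φ_pos hf hf2 hN)] with t ht
  exact (le_max_left N 1).trans (φ_gt hf hf2 hN ht.1 ht.2).1.le

theorem hasDerivAt_φ (hf : CondF1 f) (hf2 : CondF2 k f) {t : ℝ} (ht : 0 < t)
    (ht1 : t < Φ k f 1) : HasDerivAt (φ k f) (-H k f (φ k f t)) t := by
  obtain ⟨h1, h2⟩ := φ_gt hf hf2 one_pos ht ht1
  have h0 : 0 < φ k f t := one_pos.trans h1
  have hd := hasDerivAt_Φ hf hf2 h0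
  have hH := H_pos (k := k) hf h0
  have hcont : ContinuousAt (φ k f) t := by
    refine tendsto_order.mpr ⟨fun a ha => ?_, fun b hb => ?_⟩
    · have ha' : 0 < max a 1 := lt_max_of_lt_right one_pos
      have h3 : t < Φ k f (max a 1) := by
        rw [← h2]
        exact strictAntiOn_Φ hf hf2 ha' h0 (max_lt ha h1)
      filter_upwards [Ioo_mem_nhds ht h3] with s hs
      exact (le_max_left a 1).trans_lt (φ_gt hf hf2 ha' hs.1 hs.2).1
    · have h3 : Φ k f b < t := by
        conv_rhs => rw [← h2]
        exact strictAntiOn_Φ hf hf2 h0 (h0.trans hb) hb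
      filter_upwards [Ioo_mem_nhds h3 ht1, Ioi_mem_nhds ht] with s hs hs0
      exact φ_lt hf hf2 (h0.trans hb) one_pos hs0 hs.2 hs.1
  have h4 := HasDerivAt.of_local_left_inverse hcont hd (by simp [hH.ne']) (by
    filter_upwards [Ioo_mem_nhds ht ht1] with s hs
    exact (φ_gt hf hf2 one_pos hs.1 hs.2).2)
  simpa using h4

/-- A power of `t` times `φ t` is nondecreasing near `0`. -/
theorem exists_pow_mul_φ_mono (hf : CondF1 f) (hf2 : CondF2 k f) {Cf : ℝ} (hf3 : CondF3 k f Cf) :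
    ∃ N : ℕ, ∃ T > 0, MonotoneOn (fun t => t ^ N * φ k f t) (Ioo 0 T) := by
  obtain ⟨s₀, hs₀⟩ := eventually_atTop.mp
    ((hf3.2.eventually_lt_const (lt_add_one Cf)).and (eventually_ge_atTop 1))
  have hs₀1 : 1 ≤ s₀ := (hs₀ s₀ le_rfl).2
  -- `(Φ H)' = -1 + Φ H'` is eventually below `Cf + 1`, so `g` increases and `Φ H` grows at most
  -- linearly.
  set g : ℝ → ℝ := fun s => (Cf + 1) * s - Φ k f s * H k f s with hg
  have hgd : ∀ s, 0 < s → HasDerivAt g (Cf + 1 - (-1 + Φ k f s * deriv (H k f) s)) s := by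
    intro s hs
    have hH := H_pos (k := k) hf hs
    have h1 := ((hasDerivAt_id s).const_mul (Cf + 1)).sub (
      (hasDerivAt_Φ hf hf2 hs).mul (hasDerivAt_H (k := k) hf hs))
    refine h1.congr_deriv ?_
    rw [deriv_H hf hs]
    field_simp
  have hgm : MonotoneOn g (Ici s₀) := by
    refine monotoneOn_of_deriv_nonneg (convex_Ici s₀) ?_ ?_ ?_
    · intro s hs
      exact (hgd s (one_pos.trans_le (hs₀1.trans hs))).continuousAt.continuousWithinAt
    · intro s hs
      rw [interior_Ici] at hs
      exact (hgd s (one_pos.trans_le (hs₀1.trans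
        (le_of_lt hs)))).differentiableAt.differentiableWithinAt
    · intro s hs
      rw [interior_Ici] at hs
      rw [(hgd s (one_pos.trans_le (hs₀1.trans (le_of_lt hs)))).deriv]
      have := (hs₀ s (le_of_lt hs)).1
      rw [mul_comm] at this
      linarith
  -- The term `|g s₀|` absorbs the constant of integration, as `s ≥ 1`.
  obtain ⟨N, hN⟩ := exists_nat_ge (Cf + 1 + |g s₀|)
  have hCf := hf3.1
  have hN1 : N ≠ 0 := by
    rintro rfl
    have := abs_nonneg (g s₀)
    norm_num at hN
    linarith
  have hbound : ∀ s, s₀ ≤ s → Φ k f s * H k f s ≤ N * s := by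
    intro s hs
    have h1 := hgm self_mem_Ici hs hs
    have h2 := neg_abs_le (g s₀)
    have h3 : |g s₀| * 1 ≤ |g s₀| * s := by
      gcongr
      linarith
    have h4 : (Cf + 1 + |g s₀|) * s ≤ N * s := by
      gcongr
      linarith
    have h5 : g s = (Cf + 1) * s - Φ k f s * H k f s := rfl
    linarith
  have hs₀0 : 0 < s₀ := one_pos.trans_le hs₀1
  have hle : Φ k f s₀ ≤ Φ k f 1 :=
    (strictAntiOn_Φ hf hf2).antitoneOn (mem_Ioi.mpr one_pos) hs₀0 hs₀1
  refine ⟨N, Φ k f s₀, Φ_pos hf hf2 hs₀0, ?_⟩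
  have hder : ∀ t ∈ Ioo 0 (Φ k f s₀), HasDerivAt (fun t => t ^ N * φ k f t)
      (N * t ^ (N - 1) * φ k f t + t ^ N * (-H k f (φ k f t))) t := fun t ht =>
    (hasDerivAt_pow N t).mul (hasDerivAt_φ hf hf2 ht.1 (ht.2.trans_le hle))
  refine monotoneOn_of_deriv_nonneg (convex_Ioo _ _) ?_ ?_ ?_
  · exact fun t ht => (hder t ht).continuousAt.continuousWithinAt
  · intro t ht
    rw [interior_Ioo] at ht
    exact (hder t ht).differentiableAt.differentiableWithinAt
  · intro t ht
    rw [interior_Ioo] at ht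
    rw [(hder t ht).deriv]
    obtain ⟨h1, h2⟩ := φ_gt hf hf2 hs₀0 ht.1 ht.2
    have h3 := hbound _ h1.le
    rw [h2] at h3
    have h4 : t ^ N = t ^ (N - 1) * t := (pow_sub_one_mul hN1 t).symm
    have h5 : 0 ≤ t ^ (N - 1) := pow_nonneg ht.1.le _
    -- With `s = φ t` and `t = Φ(s)`, the derivative is `t^(N-1) (N s - Φ(s) H(s))`, which `hbound`
    -- makes nonnegative.
    rw [h4]
    nlinarith

end Nonlinearity

/-! ### The weight `m` and its primitive -/

section Weight

variable {n k : ℕ} {Ω : Set (E n)} {b : E n → ℝ} {m : ℝ → ℝ} {δ₀ blo bhi Cm : ℝ}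

theorem M_properties (hb : CondB2 k Ω b m δ₀ blo bhi Cm) {t : ℝ} (ht : t ∈ Ioo 0 δ₀) :
    HasDerivAt (M m) (m t) t ∧ 0 < M m t ∧ M m t ≤ t * m t :=
  primitive_properties hb.m_contDiffOn.continuousOn hb.m_pos hb.m_mono ht

theorem hasDerivAt_weight (hb : CondB2 k Ω b m δ₀ blo bhi Cm) {t : ℝ} (ht : t ∈ Ioo 0 δ₀) :
    HasDerivAt m (deriv m t) t :=
  ((hb.m_contDiffOn.contDiffAt (isOpen_Ioo.mem_nhds ht)).differentiableAt
    (by norm_num)).hasDerivAt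

theorem tendsto_M_div (hb : CondB2 k Ω b m δ₀ blo bhi Cm) :
    Tendsto (fun t => M m t / m t) (𝓝[>] 0) (𝓝 0) := by
  have h0 : Tendsto (fun t : ℝ => t) (𝓝[>] 0) (𝓝 0) := nhdsWithin_le_nhds
  refine tendsto_of_tendsto_of_tendsto_of_le_of_le' tendsto_const_nhds h0 ?_ ?_
  · filter_upwards [Ioo_mem_nhdsGT hb.delta_pos] with t ht
    exact (div_pos (M_properties hb ht).2.1 (hb.m_pos t ht)).le
  · filter_upwards [Ioo_mem_nhdsGT hb.delta_pos] with t ht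
    rw [div_le_iff₀ (hb.m_pos t ht)]
    exact (M_properties hb ht).2.2

theorem tendsto_M (hb : CondB2 k Ω b m δ₀ blo bhi Cm) :
    Tendsto (M m) (𝓝[>] 0) (𝓝[>] 0) := by
  have hmem : δ₀ / 2 ∈ Ioo 0 δ₀ := ⟨half_pos hb.delta_pos, half_lt_self hb.delta_pos⟩
  refine tendsto_nhdsWithin_iff.mpr ⟨?_, ?_⟩
  · have h0 : Tendsto (fun t : ℝ => t * m (δ₀ / 2)) (𝓝[>] 0) (𝓝 0) := by
      have : Tendsto (fun t : ℝ => t * m (δ₀ / 2)) (𝓝 0) (𝓝 (0 * m (δ₀ / 2))) :=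
        tendsto_id.mul_const _
      rw [zero_mul] at this
      exact this.mono_left nhdsWithin_le_nhds
    refine tendsto_of_tendsto_of_tendsto_of_le_of_le' tendsto_const_nhds h0 ?_ ?_
    · filter_upwards [Ioo_mem_nhdsGT hb.delta_pos] with t ht using (M_properties hb ht).2.1.le
    · filter_upwards [Ioo_mem_nhdsGT hmem.1] with t ht
      have ht' : t ∈ Ioo 0 δ₀ := ⟨ht.1, ht.2.trans hmem.2⟩
      refine (M_properties hb ht').2.2.trans ?_
      exact mul_le_mul_of_nonneg_left (hb.m_mono ht' hmem ht.2.le) ht.1.le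
  · filter_upwards [Ioo_mem_nhdsGT hb.delta_pos] with t ht using (M_properties hb ht).2.1

/-- From `(M/m)' = 1 - M m'/m²`. -/
theorem tendsto_M_mul_deriv (hb : CondB2 k Ω b m δ₀ blo bhi Cm) :
    Tendsto (fun t => M m t * deriv m t / m t ^ 2) (𝓝[>] 0) (𝓝 (1 - Cm)) := by
  refine (hb.tendsto_deriv.const_sub 1).congr' ?_
  filter_upwards [Ioo_mem_nhdsGT hb.delta_pos] with t ht
  have hm := (hb.m_pos t ht).ne'
  have h1 : HasDerivAt (fun s => M m s / m s) _ t :=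
    (M_properties hb ht).1.div (hasDerivAt_weight hb ht) hm
  rw [h1.deriv]
  field_simp
  ring

end Weight

/-! ### The barrier profile and its asymptotics -/

section Barrier

variable {n k : ℕ} {Ω : Set (E n)} {b : E n → ℝ} {m f : ℝ → ℝ} {δ₀ blo bhi Cm Cf : ℝ}

/-- The profile `φ(a M(t))`. -/
def profile (k : ℕ) (f m : ℝ → ℝ) (a t : ℝ) : ℝ := φ k f (a * M m t)

/-- The derivative of `profile`. -/
def profileDeriv (k : ℕ) (f m : ℝ → ℝ) (a t : ℝ) : ℝ := -(a * m t * H k f (profile k f m a t))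

/-- The second derivative of `profile`. -/
def profileDeriv₂ (k : ℕ) (f m : ℝ → ℝ) (a t : ℝ) : ℝ :=
  -(a * deriv m t * H k f (profile k f m a t)) + a ^ 2 * m t ^ 2 * H k f (profile k f m a t) *
    deriv (H k f) (profile k f m a t)

theorem tendsto_mul_M (hb : CondB2 k Ω b m δ₀ blo bhi Cm) {a : ℝ} (ha : 0 < a) :
    Tendsto (fun t => a * M m t) (𝓝[>] 0) (𝓝[>] 0) := by
  have h := tendsto_nhdsWithin_iff.mp (tendsto_M hb)
  refine tendsto_nhdsWithin_iff.mpr ⟨by simpa using h.1.const_mul a, ?_⟩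
  filter_upwards [h.2] with t ht
  exact mul_pos ha ht

theorem tendsto_profile (hf : CondF1 f) (hf2 : CondF2 k f)
    (hb : CondB2 k Ω b m δ₀ blo bhi Cm) {a : ℝ} (ha : 0 < a) :
    Tendsto (profile k f m a) (𝓝[>] 0) atTop :=
  (tendsto_φ hf hf2).comp (tendsto_mul_M hb ha)

theorem exists_profile_regular (hf : CondF1 f) (hf2 : CondF2 k f)
    (hb : CondB2 k Ω b m δ₀ blo bhi Cm) {a : ℝ} (ha : 0 < a) :
    ∃ T > 0, T ≤ δ₀ ∧ ContDiffOn ℝ 2 (profile k f m a) (Ioo 0 T) ∧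
      ∀ t ∈ Ioo 0 T, HasDerivAt (profile k f m a) (profileDeriv k f m a t) t ∧
        HasDerivAt (profileDeriv k f m a) (profileDeriv₂ k f m a t) t ∧
        0 < profile k f m a t ∧ profileDeriv k f m a t < 0 ∧
        Φ k f (profile k f m a t) = a * M m t := by
  -- This keeps `a * M m t` in the range where `φ` inverts `Φ`.
  have hev : ∀ᶠ t in 𝓝[>] (0 : ℝ), a * M m t < Φ k f 1 :=
    ((tendsto_mul_M hb ha).mono_right nhdsWithin_le_nhds).eventually_lt_const
      (Φ_pos hf hf2 one_pos)
  obtain ⟨T, hT, hTsub⟩ := mem_nhdsGT_iff_exists_Ioo_subset.mp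
    (hev.and (Ioo_mem_nhdsGT hb.delta_pos))
  have hT0 : (0 : ℝ) < T := hT
  have hmain : ∀ t ∈ Ioo 0 T, HasDerivAt (profile k f m a) (profileDeriv k f m a t) t ∧
        HasDerivAt (profileDeriv k f m a) (profileDeriv₂ k f m a t) t ∧
        0 < profile k f m a t ∧ profileDeriv k f m a t < 0 ∧
        Φ k f (profile k f m a t) = a * M m t := by
    intro t ht
    obtain ⟨h1, h2⟩ := hTsub ht
    obtain ⟨hM1, hM2, -⟩ := M_properties hb h2
    obtain ⟨h3, h4⟩ := φ_gt hf hf2 one_pos (mul_pos ha hM2) h1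
    have hpos : 0 < profile k f m a t := one_pos.trans h3
    have hd : HasDerivAt (profile k f m a) (profileDeriv k f m a t) t := by
      have h5 := (hasDerivAt_φ hf hf2 (mul_pos ha hM2) h1).comp t (hM1.const_mul a)
      refine h5.congr_deriv ?_
      rw [profileDeriv, profile]
      ring
    refine ⟨hd, ?_, hpos, ?_, h4⟩
    · have h6 := (((hasDerivAt_weight hb h2).const_mul a).mul
        ((hasDerivAt_H (k := k) hf hpos).comp t hd)).neg
      refine h6.congr_deriv ?_
      rw [profileDeriv₂, profileDeriv, deriv_H hf hpos, Function.comp]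
      ring
    · rw [profileDeriv, neg_lt_zero]
      have := H_pos (k := k) hf hpos
      have := hb.m_pos t h2
      positivity
  have hTδ : T ≤ δ₀ := by
    by_contra hlt
    push Not at hlt
    exact absurd (hTsub ⟨hb.delta_pos, hlt⟩).2.2 (lt_irrefl _)
  refine ⟨T, hT0, hTδ, ?_, hmain⟩
  have hcd1 : ContinuousOn (profileDeriv₂ k f m a) (Ioo 0 T) := by
    have hsub : Ioo 0 T ⊆ Ioo 0 δ₀ := Ioo_subset_Ioo_right hTδ
    have c1 : ContinuousOn (profile k f m a) (Ioo 0 T) := fun t ht =>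
      (hmain t ht).1.continuousAt.continuousWithinAt
    have hmaps : MapsTo (profile k f m a) (Ioo 0 T) (Ioi 0) := fun t ht => (hmain t ht).2.2.1
    have c2 := (continuousOn_H (k := k) hf).comp c1 hmaps
    have c3 := (continuousOn_deriv_H (k := k) hf).comp c1 hmaps
    have c4 : ContinuousOn (deriv m) (Ioo 0 T) :=
      (hb.m_contDiffOn.continuousOn_deriv_of_isOpen isOpen_Ioo le_rfl).mono hsub
    have c5 : ContinuousOn m (Ioo 0 T) := hb.m_contDiffOn.continuousOn.mono hsub
    exact ((continuousOn_const.mul c4).mul c2).neg.add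
      (((continuousOn_const.mul (c5.pow 2)).mul c2).mul c3)
  have hcd2 : ContDiffOn ℝ 1 (profileDeriv k f m a) (Ioo 0 T) := by
    rw [show (1 : WithTop ℕ∞) = 0 + 1 by norm_num, contDiffOn_succ_iff_deriv_of_isOpen isOpen_Ioo]
    refine ⟨fun t ht => (hmain t ht).2.1.differentiableAt.differentiableWithinAt, by simp, ?_⟩
    rw [contDiffOn_zero]
    exact hcd1.congr fun t ht => (hmain t ht).2.1.deriv
  rw [show (2 : WithTop ℕ∞) = 1 + 1 by norm_num, contDiffOn_succ_iff_deriv_of_isOpen isOpen_Ioo]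
  refine ⟨fun t ht => (hmain t ht).1.differentiableAt.differentiableWithinAt, by simp, ?_⟩
  exact hcd2.congr fun t ht => (hmain t ht).1.deriv

/-- Asymptotics of the derivatives of the profile near the boundary. -/
theorem profile_asymptotics (hk : 1 ≤ k) (hf : CondF1 f) (hf2 : CondF2 k f)
    (hf3 : CondF3 k f Cf) (hb : CondB2 k Ω b m δ₀ blo bhi Cm) (hC : 1 - Cm < Cf) {a : ℝ}
    (ha : 0 < a) {ε : ℝ} (hε : 0 < ε) :
    ∀ᶠ t in 𝓝[>] 0, 0 < profileDeriv₂ k f m a t ∧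
      -profileDeriv k f m a t ≤ ε * profileDeriv₂ k f m a t ∧
      a ^ (k + 1) * (1 - Cf⁻¹ * (1 - Cm) - ε) * (m t ^ (k + 1) * f (profile k f m a t)) ≤
        (-profileDeriv k f m a t) ^ (k - 1) * profileDeriv₂ k f m a t ∧
      (-profileDeriv k f m a t) ^ (k - 1) * profileDeriv₂ k f m a t ≤
        a ^ (k + 1) * (1 - Cf⁻¹ * (1 - Cm) + ε) * (m t ^ (k + 1) * f (profile k f m a t)) := by
  have hCf := hf3.1
  set θ := 1 - Cf⁻¹ * (1 - Cm) with hθ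
  have hθpos : 0 < θ := by
    rw [hθ, sub_pos, inv_mul_lt_iff₀ hCf, mul_one]
    exact hC
  obtain ⟨T, hT, hTδ, -, hreg⟩ := exists_profile_regular hf hf2 hb ha
  set h := profile k f m a with hh
  have hlim1 : Tendsto (fun t => a * M m t * deriv (H k f) (h t)) (𝓝[>] 0) (𝓝 Cf) := by
    refine (hf3.2.comp (tendsto_profile hf hf2 hb ha)).congr' ?_
    filter_upwards [Ioo_mem_nhdsGT hT] with t ht
    rw [Function.comp, (hreg t ht).2.2.2.2, mul_comm]
  -- `β` is the ratio of the second derivative to its leading part `a² m² H H'`.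
  set β : ℝ → ℝ := fun t => 1 - (M m t * deriv m t / m t ^ 2) / (a * M m t * deriv (H k f) (h t))
    with hβdef
  have hβ : Tendsto β (𝓝[>] 0) (𝓝 θ) := by
    have := ((tendsto_M_mul_deriv hb).div hlim1 hCf.ne').const_sub 1
    rwa [show 1 - (1 - Cm) / Cf = θ by rw [hθ, div_eq_inv_mul]] at this
  -- This quotient equals `-h'/h''`; it tends to `0` because `M/m` does.
  have hγ : Tendsto (fun t => (M m t / m t) / (a * M m t * deriv (H k f) (h t) * β t)) (𝓝[>] 0)
      (𝓝 0) := by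
    have := (tendsto_M_div hb).div (hlim1.mul hβ) (mul_pos hCf hθpos).ne'
    rwa [zero_div] at this
  filter_upwards [Ioo_mem_nhdsGT hT, hβ.eventually_const_lt hθpos, hγ.eventually_lt_const hε,
    hβ.eventually_const_lt (sub_lt_self θ hε), hβ.eventually_lt_const (lt_add_of_pos_right θ hε)]
    with t ht hβ0 hγε hβ1 hβ2
  obtain ⟨-, -, hpos, hneg, -⟩ := hreg t ht
  have ht' : t ∈ Ioo 0 δ₀ := ⟨ht.1, ht.2.trans_le hTδ⟩
  have hm := hb.m_pos t ht'
  have hM := (M_properties hb ht').2.1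
  have hH := H_pos (k := k) hf hpos
  have hH' := deriv_H_pos (k := k) hf hpos
  have hfp := hf.2.1 _ hpos
  have hfH : f (h t) = H k f (h t) ^ k * deriv (H k f) (h t) := by
    rw [deriv_H hf hpos]
    field_simp
  have hq : profileDeriv₂ k f m a t =
      a ^ 2 * m t ^ 2 * H k f (h t) * deriv (H k f) (h t) * β t := by
    rw [profileDeriv₂, hβdef]
    simp only [← hh]
    field_simp
    ring
  have hp : -profileDeriv k f m a t = a * m t * H k f (h t) := by
    rw [profileDeriv, neg_neg]
  have hqpos : 0 < profileDeriv₂ k f m a t := by rw [hq]; positivity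
  have hprod : (-profileDeriv k f m a t) ^ (k - 1) * profileDeriv₂ k f m a t =
      a ^ (k + 1) * β t * (m t ^ (k + 1) * f (h t)) := by
    obtain ⟨j, rfl⟩ : ∃ j, k = j + 1 := ⟨k - 1, by omega⟩
    rw [hp, hq, hfH, Nat.add_sub_cancel]
    ring
  refine ⟨hqpos, ?_, ?_, ?_⟩
  · have e : -profileDeriv k f m a t = (M m t / m t) /
        (a * M m t * deriv (H k f) (h t) * β t) * profileDeriv₂ k f m a t := by
      rw [hp, hq]
      field_simp
    rw [e]
    exact mul_le_mul_of_nonneg_right hγε.le hqpos.le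
  · rw [hprod]
    gcongr
  · rw [hprod]
    gcongr

end Barrier

/-! ### Boundary strips -/

section NearBoundary

variable {n : ℕ} {Ω : Set (E n)}

theorem eventually_nearBoundary_iff {P : E n → Prop} :
    (∀ᶠ x in nearBoundary Ω, P x) ↔ ∃ δ > 0, ∀ x ∈ Ω, d Ω x < δ → P x := by
  rw [nearBoundary, eventually_inf_principal,
    ((Metric.nhds_basis_ball (x := (0 : ℝ))).comap (d Ω)).eventually_iff]
  refine exists_congr fun δ => and_congr_right fun _ => ?_
  have h0 : ∀ x, 0 ≤ d Ω x := fun x => Metric.infDist_nonneg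
  simp only [mem_preimage, mem_ball_zero_iff, Real.norm_eq_abs]
  exact ⟨fun h x hx hd => h (by rwa [abs_of_nonneg (h0 x)]) hx,
    fun h x hd hx => h x hx (by rwa [abs_of_nonneg (h0 x)] at hd)⟩

theorem tendsto_d_nearBoundary (hΩ : IsOpen Ω) (hne : (frontier Ω).Nonempty) :
    Tendsto (d Ω) (nearBoundary Ω) (𝓝[>] 0) := by
  refine tendsto_nhdsWithin_iff.mpr ⟨tendsto_comap.mono_left inf_le_left, ?_⟩
  exact eventually_nearBoundary_iff.mpr ⟨1, one_pos, fun x hx _ => d_pos hΩ hne hx⟩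

theorem continuous_d : Continuous (d Ω) := Metric.continuous_infDist_pt _

theorem isCompact_strip (hΩ : IsBoundedDomain Ω) {s : ℝ} (hs : 0 < s) (t : ℝ) :
    IsCompact {x | x ∈ Ω ∧ s ≤ d Ω x ∧ d Ω x ≤ t} := by
  have heq : {x | x ∈ Ω ∧ s ≤ d Ω x ∧ d Ω x ≤ t} = closure Ω ∩ d Ω ⁻¹' Icc s t := by
    ext x
    refine ⟨fun h => ⟨subset_closure h.1, h.2⟩, fun h => ⟨?_, h.2⟩⟩
    by_contra hx
    have hfr : x ∈ frontier Ω := by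
      rw [hΩ.1.frontier_eq]
      exact ⟨h.1, hx⟩
    have h0 : d Ω x = 0 := Metric.infDist_zero_of_mem hfr
    have := h.2.1
    linarith
  rw [heq]
  exact Metric.isCompact_of_isClosed_isBounded
    (isClosed_closure.inter (isClosed_Icc.preimage continuous_d))
    (hΩ.2.2.closure.subset inter_subset_left)

theorem strip_mem_nhds (hΩ : IsOpen Ω) {x : E n} {s t : ℝ} (hx : x ∈ Ω) (hs : s < d Ω x)
    (ht : d Ω x < t) : {x | x ∈ Ω ∧ s ≤ d Ω x ∧ d Ω x ≤ t} ∈ 𝓝 x := by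
  filter_upwards [hΩ.mem_nhds hx, continuous_d.continuousAt.eventually_const_lt hs,
    continuous_d.continuousAt.eventually_lt_const ht] with z h1 h2 h3
  exact ⟨h1, h2.le, h3.le⟩

end NearBoundary

/-! ### Hessian bounds for the test functions -/

section RadialTest

variable {n k : ℕ} {c C lo hi : ℝ} {y ν : E n} {B : E n →L[ℝ] E n →L[ℝ] ℝ}

/-- A decreasing convex function of a touching quadratic is admissible, with explicit bounds on
its `k`-Hessian. -/
theorem IsTouchingForm.test_function (hB : IsTouchingForm k c C lo hi ν B) (hk : 1 ≤ k)
    (hc : 0 < c) {t q ε : ℝ} {η η₁ : ℝ → ℝ} (hηc : ContDiffAt ℝ 2 η t)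
    (hη : ∀ᶠ s in 𝓝 t, HasDerivAt η (η₁ s) s) (hη₁ : HasDerivAt η₁ q t) (hp : η₁ t < 0)
    (hq : 0 < q) (hpos : -η₁ t * C < q * c) (hε : -η₁ t * C ≤ ε * q) :
    (∃ A : Set (E n), IsOpen A ∧ y + t • ν ∈ A ∧
      IsAdmissible k A fun z => η (quadDist y ν B z)) ∧
    (-η₁ t) ^ (k - 1) * q * (lo - ε) ≤ S k (fun z => η (quadDist y ν B z)) (y + t • ν) ∧
    S k (fun z => η (quadDist y ν B z)) (y + t • ν) ≤ (-η₁ t) ^ (k - 1) * q * (hi + ε) := by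
  set p := -η₁ t with hpdef
  have hp0 : 0 < p := by rw [hpdef]; linarith
  set ψ : E n → ℝ := fun z => η (quadDist y ν B z) with hψ
  have hhess := hessianForm_comp_quadDist (y := y) hB.norm_eq hB.symm hB.null hη hη₁
  have hsym : ∀ v w, hessianForm ψ (y + t • ν) v w = hessianForm ψ (y + t • ν) w v := by
    intro v w
    rw [hhess, hhess, hB.symm v w]
    ring
  have hS : ∀ j, S (j + 1) ψ (y + t • ν) = p ^ j * (p * formSymm (j + 1) B + q * formSymm j B) := by
    intro j
    rw [S_eq_formSymm hsym, formSymm_succ_smul_add hB.norm_eq hB.null hhess]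
    ring
  have hcd : ContDiffAt ℝ 2 ψ (y + t • ν) := by
    have : ContDiffAt ℝ 2 η (quadDist y ν B (y + t • ν)) := by
      rwa [quadDist_normal hB.norm_eq hB.null]
    exact this.comp _ contDiff_quadDist.contDiffAt
  have hCk := abs_le.mp hB.bound
  have h1 : p * formSymm k B ≤ p * C := mul_le_mul_of_nonneg_left hCk.2 hp0.le
  have h2 : p * -C ≤ p * formSymm k B := mul_le_mul_of_nonneg_left hCk.1 hp0.le
  obtain ⟨i, rfl⟩ : ∃ i, k = i + 1 := ⟨k - 1, by omega⟩
  rw [Nat.add_sub_cancel]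
  have hlo := hB.lower
  have hhi := hB.upper
  rw [Nat.add_sub_cancel] at hlo hhi
  refine ⟨exists_isAdmissible hcd ?_, ?_, ?_⟩
  · intro j hj1 hjk
    obtain ⟨j, rfl⟩ : ∃ l, j = l + 1 := ⟨j - 1, by omega⟩
    rw [hS]
    have h3 : q * c ≤ q * formSymm j B := mul_le_mul_of_nonneg_left (hB.pos j (by omega)) hq.le
    refine mul_pos (pow_pos hp0 j) ?_
    rcases Nat.lt_or_ge (j + 1) (i + 1) with hlt | hge
    -- Below the top index both terms are positive. At the top index `formSymm k B` has no sign, and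
    -- `hpos` lets the other term dominate.
    · have h4 : 0 < formSymm (j + 1) B := hc.trans_le (hB.pos _ hlt)
      have := mul_pos hp0 h4
      have := mul_pos hq hc
      linarith
    · obtain rfl : j = i := by omega
      linarith
  · rw [hS, mul_assoc]
    refine mul_le_mul_of_nonneg_left ?_ (pow_pos hp0 i).le
    have := mul_le_mul_of_nonneg_left hlo hq.le
    linarith
  · rw [hS, mul_assoc]
    refine mul_le_mul_of_nonneg_left ?_ (pow_pos hp0 i).le
    have := mul_le_mul_of_nonneg_left hhi hq.le
    linarith

end RadialTest

/-! ### Comparison at an interior extremum -/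

section LocalComparison

variable {n k : ℕ} {Ω : Set (E n)} {b : E n → ℝ} {m f : ℝ → ℝ} {δ₀ blo bhi Cm Cf : ℝ}
  {u : E n → ℝ}

theorem CondB2.eventually_lower (hb : CondB2 k Ω b m δ₀ blo bhi Cm) {β : ℝ} (hβ : β < blo) :
    ∃ δ > 0, δ ≤ δ₀ ∧ ∀ x ∈ Ω, 0 < d Ω x → d Ω x < δ → β * m (d Ω x) ^ (k + 1) < b x := by
  have h1 := eventually_lt_of_lt_liminf
    (show ((β : ℝ) : EReal) < _ from hb.liminf_eq ▸ EReal.coe_lt_coe_iff.mpr hβ)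
  obtain ⟨δ, hδ, h⟩ := eventually_nearBoundary_iff.mp h1
  refine ⟨min δ δ₀, lt_min hδ hb.delta_pos, min_le_right _ _, fun x hx hx0 hxd => ?_⟩
  have h2 := EReal.coe_lt_coe_iff.mp (h x hx (hxd.trans_le (min_le_left _ _)))
  rwa [lt_div_iff₀ (pow_pos (hb.m_pos _ ⟨hx0, hxd.trans_le (min_le_right _ _)⟩) _)] at h2

theorem CondB2.eventually_upper (hb : CondB2 k Ω b m δ₀ blo bhi Cm) {β : ℝ} (hβ : bhi < β) :
    ∃ δ > 0, δ ≤ δ₀ ∧ ∀ x ∈ Ω, 0 < d Ω x → d Ω x < δ → b x < β * m (d Ω x) ^ (k + 1) := by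
  have h1 := eventually_lt_of_limsup_lt
    (show _ < ((β : ℝ) : EReal) from hb.limsup_eq ▸ EReal.coe_lt_coe_iff.mpr hβ)
  obtain ⟨δ, hδ, h⟩ := eventually_nearBoundary_iff.mp h1
  refine ⟨min δ δ₀, lt_min hδ hb.delta_pos, min_le_right _ _, fun x hx hx0 hxd => ?_⟩
  have h2 := EReal.coe_lt_coe_iff.mp (h x hx (hxd.trans_le (min_le_left _ _)))
  rwa [div_lt_iff₀ (pow_pos (hb.m_pos _ ⟨hx0, hxd.trans_le (min_le_right _ _)⟩) _)] at h2

theorem strictAntiOn_profile {T a : ℝ} (h : ∀ t ∈ Ioo 0 T,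
    HasDerivAt (profile k f m a) (profileDeriv k f m a t) t ∧
        HasDerivAt (profileDeriv k f m a) (profileDeriv₂ k f m a t) t ∧
        0 < profile k f m a t ∧ profileDeriv k f m a t < 0 ∧
        Φ k f (profile k f m a t) = a * M m t) :
    StrictAntiOn (profile k f m a) (Ioo 0 T) := by
  refine strictAntiOn_of_deriv_neg (convex_Ioo 0 T)
    (fun t ht => (h t ht).1.continuousAt.continuousWithinAt) fun t ht => ?_
  rw [interior_Ioo] at ht
  rw [(h t ht).1.deriv]
  exact (h t ht).2.2.2.1

/-- Shifting a profile: derivatives of `s ↦ profile (s + σ)`. -/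
theorem profile_shift {T a : ℝ} (hcd : ContDiffOn ℝ 2 (profile k f m a) (Ioo 0 T))
    (h : ∀ t ∈ Ioo 0 T,
    HasDerivAt (profile k f m a) (profileDeriv k f m a t) t ∧
        HasDerivAt (profileDeriv k f m a) (profileDeriv₂ k f m a t) t ∧
        0 < profile k f m a t ∧ profileDeriv k f m a t < 0 ∧
        Φ k f (profile k f m a t) = a * M m t) {t σ : ℝ} (ht : t + σ ∈ Ioo 0 T) :
    ContDiffAt ℝ 2 (fun s => profile k f m a (s + σ)) t ∧
    (∀ᶠ s in 𝓝 t, HasDerivAt (fun s => profile k f m a (s + σ)) (profileDeriv k f m a (s + σ)) s) ∧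
    HasDerivAt (fun s => profileDeriv k f m a (s + σ)) (profileDeriv₂ k f m a (t + σ)) t := by
  refine ⟨?_, ?_, ?_⟩
  · have h1 : ContDiffAt ℝ 2 (profile k f m a) (t + σ) :=
      hcd.contDiffAt (isOpen_Ioo.mem_nhds ht)
    have h2 : ContDiffAt ℝ 2 (fun s : ℝ => s + σ) t :=
      (contDiff_id.add contDiff_const).contDiffAt
    exact ContDiffAt.comp (g := profile k f m a) (f := fun s : ℝ => s + σ) t h1 h2
  · have hc : ContinuousAt (fun s : ℝ => s + σ) t := by fun_prop
    filter_upwards [hc.preimage_mem_nhds (isOpen_Ioo.mem_nhds ht)] with s hs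
    exact (h _ hs).1.comp_add_const s σ
  · exact (h _ ht).2.1.comp_add_const t σ

/-- Parameters close to the critical ones for the upper barrier. -/
theorem exists_slack_upper {A θ L β : ℝ} (h : A * θ * L < β) :
    ∃ ε > 0, A * (θ + ε) * (L + ε + ε) < β - ε := by
  have h1 : Tendsto (fun ε : ℝ => β - ε - A * (θ + ε) * (L + ε + ε)) (𝓝[>] 0)
      (𝓝 (β - 0 - A * (θ + 0) * (L + 0 + 0))) :=
    (Continuous.tendsto (f := fun ε : ℝ => β - ε - A * (θ + ε) * (L + ε + ε))
      (by fun_prop) 0).mono_left nhdsWithin_le_nhds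
  obtain ⟨ε, hε1, hε2⟩ := ((h1.eventually_const_lt (u := 0) (by simpa using h)).and
    self_mem_nhdsWithin).exists
  exact ⟨ε, hε2, by linarith⟩

theorem exists_slack_lower {A θ L β : ℝ} (h : β < A * θ * L) (hL : 0 < L) :
    ∃ ε > 0, ε + ε < L ∧ β + ε < A * (θ - ε) * (L - ε - ε) := by
  have h1 : Tendsto (fun ε : ℝ => A * (θ - ε) * (L - ε - ε) - (β + ε)) (𝓝[>] 0)
      (𝓝 (A * (θ - 0) * (L - 0 - 0) - (β + 0))) :=
    (Continuous.tendsto (f := fun ε : ℝ => A * (θ - ε) * (L - ε - ε) - (β + ε))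
      (by fun_prop) 0).mono_left nhdsWithin_le_nhds
  have h2 : Tendsto (fun ε : ℝ => ε + ε) (𝓝[>] 0) (𝓝 (0 + 0)) :=
    (Continuous.tendsto (f := fun ε : ℝ => ε + ε) (by fun_prop) 0).mono_left nhdsWithin_le_nhds
  obtain ⟨ε, hε1, hε3, hε2⟩ := ((h1.eventually_const_lt (u := 0) (by simpa using h)).and
    ((h2.eventually_lt_const (u := L) (by simpa using hL)).and self_mem_nhdsWithin)).exists
  exact ⟨ε, hε2, hε3, by linarith⟩

/-- At a local maximum of `u` minus a shifted upper barrier, `u` lies below the barrier. -/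
theorem upper_local_comparison (hk : 1 ≤ k) (hΩ : IsBoundedDomain Ω)
    (hne : (frontier Ω).Nonempty) (hreg : HasC31Boundary Ω)
    (hconv : IsStrictlyConvexOfOrder (k - 1) Ω) (hf : CondF1 f) (hf2 : CondF2 k f)
    (hf3 : CondF3 k f Cf) (hb : CondB2 k Ω b m δ₀ blo bhi Cm) (hC : 1 - Cm < Cf)
    (hu : IsViscositySubsolution k Ω b f u) {a : ℝ} (ha : 0 < a)
    (hab : a ^ (k + 1) * (1 - Cf⁻¹ * (1 - Cm)) * L₀ k Ω < blo) :
    ∃ δ > 0, ∀ x₀ ∈ Ω, d Ω x₀ < δ → ∀ σ, 0 ≤ σ → σ < d Ω x₀ →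
      IsLocalMax (fun x => u x - profile k f m a (d Ω x + -σ)) x₀ →
      u x₀ < profile k f m a (d Ω x₀ + -σ) := by
  obtain ⟨T, hT, hTδ, hcd, hprof⟩ := exists_profile_regular hf hf2 hb ha
  have hanti := strictAntiOn_profile hprof
  obtain ⟨c, hc, C, htouch⟩ := exists_touching hk hΩ hne hreg hconv
  obtain ⟨ε, hε, hslack⟩ := exists_slack_upper hab
  obtain ⟨δ₁, hδ₁, htouch⟩ := htouch ε hε
  obtain ⟨δ₂, hδ₂, hδ₂δ₀, hblo⟩ := hb.eventually_lower (sub_lt_self blo hε)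
  set C' := |C| + 1 with hC'
  have hC'pos : 0 < C' := by positivity
  have hCC' : C ≤ C' := (le_abs_self C).trans (by linarith)
  -- The bound `-h' ≤ e h''` must absorb the `σ_k` term twice: `c / 2` for admissibility and `ε` for
  -- the Hessian estimate. The outer `ε` is the error in `θ`.
  set e := min (min ε (c / 2) / C') ε with he
  have hepos : 0 < e := by positivity
  obtain ⟨δ₃, hδ₃, hasym⟩ := mem_nhdsGT_iff_exists_Ioo_subset.mp
    (profile_asymptotics hk hf hf2 hf3 hb hC ha hepos)
  refine ⟨min (min δ₁ δ₂) (min δ₃ T), lt_min (lt_min hδ₁ hδ₂) (lt_min hδ₃ hT), ?_⟩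
  intro x₀ hx₀ hdx σ hσ hσd hmax
  simp only [lt_min_iff] at hdx
  obtain ⟨⟨hd1, hd2⟩, hd3, hdT⟩ := hdx
  have hd0 := d_pos hΩ.1 hne hx₀
  set t := d Ω x₀ + -σ with ht
  have ht0 : 0 < t := by rw [ht]; linarith
  have htd : t ≤ d Ω x₀ := by rw [ht]; linarith
  have htT : t ∈ Ioo 0 T := ⟨ht0, htd.trans_lt hdT⟩
  obtain ⟨hq, hpq, -, hup⟩ := hasym ⟨ht0, htd.trans_lt hd3⟩
  obtain ⟨-, -, hpos, hneg, -⟩ := hprof t htT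
  obtain ⟨y, ν, B, -, hxy, hB, -, htl, -⟩ := htouch x₀ hx₀ hd1
  obtain ⟨hs1, hs2, hs3⟩ := profile_shift (t := d Ω x₀) hcd hprof htT
  have hpC : -profileDeriv k f m a t * C ≤ min ε (c / 2) * profileDeriv₂ k f m a t := by
    have h1 : -profileDeriv k f m a t * C ≤ -profileDeriv k f m a t * C' :=
      mul_le_mul_of_nonneg_left hCC' (by linarith)
    have h2 : e * C' ≤ min ε (c / 2) := by
      rw [← le_div_iff₀ hC'pos]
      exact min_le_left _ _
    have h3 := mul_le_mul_of_nonneg_right hpq hC'pos.le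
    have h4 := mul_le_mul_of_nonneg_right h2 hq.le
    linarith
  obtain ⟨⟨A, hA, hxA, hadm⟩, -, hS⟩ := hB.test_function (y := y) (ε := ε) hk hc hs1 hs2 hs3 hneg hq
    (by
      have h1 := mul_le_mul_of_nonneg_right (min_le_right ε (c / 2)) hq.le
      have h2 : c / 2 * profileDeriv₂ k f m a t < profileDeriv₂ k f m a t * c := by
        rw [mul_comm]
        exact mul_lt_mul_of_pos_left (half_lt_self hc) hq
      exact hpC.trans_lt (h1.trans_lt h2))
    (hpC.trans (mul_le_mul_of_nonneg_right (min_le_left _ _) hq.le))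
  rw [← hxy] at hxA hS
  have hQ0 : quadDist y ν B x₀ = d Ω x₀ := by
    conv_lhs => rw [hxy]
    exact quadDist_normal hB.norm_eq hB.null _
  -- `Q ≤ d` with equality at `x₀`, and the profile decreases, so replacing `d` by `Q` raises the
  -- barrier and preserves the maximum.
  have hmaxψ : IsLocalMax (fun x => u x - profile k f m a (quadDist y ν B x + -σ)) x₀ := by
    have hc1 : ContinuousAt (fun x => quadDist y ν B x + -σ) x₀ :=
      ((continuous_quadDist y ν B).add continuous_const).continuousAt
    have hc2 : ContinuousAt (fun x => d Ω x + -σ) x₀ :=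
      (continuous_d.add continuous_const).continuousAt
    have hn1 : ∀ᶠ x in 𝓝 x₀, quadDist y ν B x + -σ ∈ Ioo 0 T :=
      hc1.preimage_mem_nhds (isOpen_Ioo.mem_nhds (by rw [hQ0]; exact htT))
    have hn2 : ∀ᶠ x in 𝓝 x₀, d Ω x + -σ ∈ Ioo 0 T :=
      hc2.preimage_mem_nhds (isOpen_Ioo.mem_nhds htT)
    filter_upwards [hmax, htl, hn1, hn2] with x h1 h2 h3 h4
    have h5 := hanti.antitoneOn h3 h4 (by linarith)
    simp only [hQ0]
    linarith
  have hvisc := hu x₀ hx₀ A hA hxA _ hadm hmaxψ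
  by_contra hle
  push Not at hle
  have hfm : f (profile k f m a t) ≤ f (u x₀) := hf.2.2 hpos (hpos.trans_le hle) hle
  have hfpos := hf.2.1 _ hpos
  have hm := hb.m_pos t ⟨ht0, htT.2.trans_le hTδ⟩
  have hbx := hblo x₀ hx₀ hd0 hd2
  -- The shift goes the right way: `t ≤ d Ω x₀` and `m` is nondecreasing, so the lower bound for `b`
  -- survives with `m t`.
  have hmm : m t ^ (k + 1) ≤ m (d Ω x₀) ^ (k + 1) := by
    have := hb.m_mono ⟨ht0, htT.2.trans_le hTδ⟩ ⟨hd0, hdT.trans_le hTδ⟩ htd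
    gcongr
  obtain ⟨z, hz⟩ := hne
  have hL := (l₀_pos hk hΩ ⟨z, hz⟩ hreg hconv).trans_le (l₀_le_L₀ k hΩ ⟨z, hz⟩ hreg)
  set Y := m t ^ (k + 1) * f (profile k f m a t) with hY
  have hYpos : 0 < Y := by positivity
  set θ := 1 - Cf⁻¹ * (1 - Cm) with hθ
  have hθpos : 0 < θ := by
    rw [hθ, sub_pos, inv_mul_lt_iff₀ hf3.1, mul_one]
    exact hC
  have hβ : 0 < blo - ε := lt_trans (by positivity) hslack
  have e1 : (-profileDeriv k f m a t) ^ (k - 1) * profileDeriv₂ k f m a t *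
      (L₀ k Ω + ε + ε) ≤ a ^ (k + 1) * (θ + ε) * Y * (L₀ k Ω + ε + ε) := by
    refine mul_le_mul_of_nonneg_right (hup.trans ?_) (by positivity)
    gcongr
    exact min_le_right _ _
  have e2 : a ^ (k + 1) * (θ + ε) * (L₀ k Ω + ε + ε) * Y < (blo - ε) * Y :=
    mul_lt_mul_of_pos_right hslack hYpos
  have e3 : (blo - ε) * Y ≤ b x₀ * f (profile k f m a t) := by
    have h1 : (blo - ε) * m t ^ (k + 1) ≤ b x₀ :=
      (mul_le_mul_of_nonneg_left hmm hβ.le).trans hbx.le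
    have := mul_le_mul_of_nonneg_right h1 hfpos.le
    rw [hY]
    linarith
  have e4 : b x₀ * f (profile k f m a t) ≤ b x₀ * f (u x₀) := by
    refine mul_le_mul_of_nonneg_left hfm (le_trans ?_ hbx.le)
    have : 0 < m (d Ω x₀) := hb.m_pos _ ⟨hd0, hdT.trans_le hTδ⟩
    positivity
  linarith

/-- At a local minimum of `u` minus a shifted lower barrier, `u` lies above the barrier. -/
theorem lower_local_comparison (hk : 1 ≤ k) (hΩ : IsBoundedDomain Ω)
    (hne : (frontier Ω).Nonempty) (hreg : HasC31Boundary Ω)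
    (hconv : IsStrictlyConvexOfOrder (k - 1) Ω) (hf : CondF1 f) (hf2 : CondF2 k f)
    (hf3 : CondF3 k f Cf) (hb1 : ∀ x ∈ Ω, 0 < b x) (hb : CondB2 k Ω b m δ₀ blo bhi Cm)
    (hC : 1 - Cm < Cf)
    (hu : IsViscositySupersolution k Ω b f u) {a : ℝ} (ha : 0 < a)
    (hab : bhi < a ^ (k + 1) * (1 - Cf⁻¹ * (1 - Cm)) * l₀ k Ω) :
    ∃ δ > 0, ∀ x₀ ∈ Ω, ∀ σ, 0 ≤ σ → d Ω x₀ + σ < δ →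
      IsLocalMin (fun x => u x - profile k f m a (d Ω x + σ)) x₀ → 0 < u x₀ →
      profile k f m a (d Ω x₀ + σ) < u x₀ := by
  obtain ⟨T, hT, hTδ, hcd, hprof⟩ := exists_profile_regular hf hf2 hb ha
  have hanti := strictAntiOn_profile hprof
  obtain ⟨c, hc, C, htouch⟩ := exists_touching hk hΩ hne hreg hconv
  obtain ⟨ε, hε, hεl, hslack⟩ := exists_slack_lower hab (l₀_pos hk hΩ hne hreg hconv)
  obtain ⟨δ₁, hδ₁, htouch⟩ := htouch ε hε
  obtain ⟨δ₂, hδ₂, hδ₂δ₀, hbhi⟩ := hb.eventually_upper (lt_add_of_pos_right bhi hε)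
  set C' := |C| + 1 with hC'
  have hC'pos : 0 < C' := by positivity
  have hCC' : C ≤ C' := (le_abs_self C).trans (by linarith)
  set e := min (min ε (c / 2) / C') ε with he
  have hepos : 0 < e := by positivity
  obtain ⟨δ₃, hδ₃, hasym⟩ := mem_nhdsGT_iff_exists_Ioo_subset.mp
    (profile_asymptotics hk hf hf2 hf3 hb hC ha hepos)
  refine ⟨min (min δ₁ δ₂) (min δ₃ T), lt_min (lt_min hδ₁ hδ₂) (lt_min hδ₃ hT), ?_⟩
  intro x₀ hx₀ σ hσ hdx hmin hupos
  simp only [lt_min_iff] at hdx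
  obtain ⟨⟨hd1, hd2⟩, hd3, hdT⟩ := hdx
  have hd0 := d_pos hΩ.1 hne hx₀
  set t := d Ω x₀ + σ with ht
  have htd : d Ω x₀ ≤ t := by rw [ht]; linarith
  have ht0 : 0 < t := hd0.trans_le htd
  have htT : t ∈ Ioo 0 T := ⟨ht0, hdT⟩
  obtain ⟨hq, hpq, hlow, -⟩ := hasym ⟨ht0, hd3⟩
  obtain ⟨-, -, hpos, hneg, -⟩ := hprof t htT
  obtain ⟨y, ν, -, B, hxy, -, hB, -, htu⟩ := htouch x₀ hx₀ (htd.trans_lt hd1)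
  obtain ⟨hs1, hs2, hs3⟩ := profile_shift (t := d Ω x₀) hcd hprof htT
  have hpC : -profileDeriv k f m a t * C ≤ min ε (c / 2) * profileDeriv₂ k f m a t := by
    have h1 : -profileDeriv k f m a t * C ≤ -profileDeriv k f m a t * C' :=
      mul_le_mul_of_nonneg_left hCC' (by linarith)
    have h2 : e * C' ≤ min ε (c / 2) := by
      rw [← le_div_iff₀ hC'pos]
      exact min_le_left _ _
    have h3 := mul_le_mul_of_nonneg_right hpq hC'pos.le
    have h4 := mul_le_mul_of_nonneg_right h2 hq.le
    linarith
  obtain ⟨⟨A, hA, hxA, hadm⟩, hS, -⟩ := hB.test_function (y := y) (ε := ε) hk hc hs1 hs2 hs3 hneg hq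
    (by
      have h1 := mul_le_mul_of_nonneg_right (min_le_right ε (c / 2)) hq.le
      have h2 : c / 2 * profileDeriv₂ k f m a t < profileDeriv₂ k f m a t * c := by
        rw [mul_comm]
        exact mul_lt_mul_of_pos_left (half_lt_self hc) hq
      exact hpC.trans_lt (h1.trans_lt h2))
    (hpC.trans (mul_le_mul_of_nonneg_right (min_le_left _ _) hq.le))
  rw [← hxy] at hxA hS
  have hQ0 : quadDist y ν B x₀ = d Ω x₀ := by
    conv_lhs => rw [hxy]
    exact quadDist_normal hB.norm_eq hB.null _
  -- Here `d ≤ Q` near `x₀`, so the barrier is lowered and the minimum is preserved.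
  have hminψ : IsLocalMin (fun x => u x - profile k f m a (quadDist y ν B x + σ)) x₀ := by
    have hc1 : ContinuousAt (fun x => quadDist y ν B x + σ) x₀ :=
      ((continuous_quadDist y ν B).add continuous_const).continuousAt
    have hc2 : ContinuousAt (fun x => d Ω x + σ) x₀ :=
      (continuous_d.add continuous_const).continuousAt
    have hn1 : ∀ᶠ x in 𝓝 x₀, quadDist y ν B x + σ ∈ Ioo 0 T :=
      hc1.preimage_mem_nhds (isOpen_Ioo.mem_nhds (by rw [hQ0]; exact htT))
    have hn2 : ∀ᶠ x in 𝓝 x₀, d Ω x + σ ∈ Ioo 0 T :=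
      hc2.preimage_mem_nhds (isOpen_Ioo.mem_nhds htT)
    filter_upwards [hmin, htu, hn1, hn2] with x h1 h2 h3 h4
    have h5 := hanti.antitoneOn h4 h3 (by linarith)
    simp only [hQ0]
    linarith
  have hvisc := hu x₀ hx₀ A hA hxA _ hadm hminψ
  by_contra hle
  push Not at hle
  -- Positivity of `u x₀` is essential, since `f` is monotone only on `(0, ∞)`.
  have hfm : f (u x₀) ≤ f (profile k f m a t) := hf.2.2 hupos hpos hle
  have hfpos := hf.2.1 _ hpos
  have hdδ₀ : d Ω x₀ ∈ Ioo 0 δ₀ := ⟨hd0, htd.trans_lt (hdT.trans_le hTδ)⟩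
  have htδ₀ : t ∈ Ioo 0 δ₀ := ⟨ht0, hdT.trans_le hTδ⟩
  have hm := hb.m_pos t htδ₀
  have hbx := hbhi x₀ hx₀ hd0 (htd.trans_lt hd2)
  have hmm : m (d Ω x₀) ^ (k + 1) ≤ m t ^ (k + 1) := by
    have := hb.m_mono hdδ₀ htδ₀ htd
    have := hb.m_pos _ hdδ₀
    gcongr
  set Y := m t ^ (k + 1) * f (profile k f m a t) with hY
  have hYpos : 0 < Y := by positivity
  set θ := 1 - Cf⁻¹ * (1 - Cm) with hθ
  have hbhi0 := hb.bhi_pos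
  have e1 : a ^ (k + 1) * (θ - ε) * Y * (l₀ k Ω - ε - ε) ≤
      (-profileDeriv k f m a t) ^ (k - 1) * profileDeriv₂ k f m a t * (l₀ k Ω - ε - ε) := by
    refine mul_le_mul_of_nonneg_right (le_trans ?_ hlow) (by linarith)
    gcongr
    exact min_le_right _ _
  have e2 : (bhi + ε) * Y < a ^ (k + 1) * (θ - ε) * (l₀ k Ω - ε - ε) * Y :=
    mul_lt_mul_of_pos_right hslack hYpos
  have e3 : b x₀ * f (profile k f m a t) ≤ (bhi + ε) * Y := by
    have h1 : b x₀ ≤ (bhi + ε) * m t ^ (k + 1) :=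
      hbx.le.trans (mul_le_mul_of_nonneg_left hmm (by linarith))
    have := mul_le_mul_of_nonneg_right h1 hfpos.le
    rw [hY]
    linarith
  have e4 : b x₀ * f (u x₀) ≤ b x₀ * f (profile k f m a t) :=
    mul_le_mul_of_nonneg_left hfm (hb1 x₀ hx₀).le
  linarith

end LocalComparison

/-! ### Comparison in a boundary strip and change of constants -/

section GlobalComparison

variable {n k : ℕ} {Ω : Set (E n)} {b : E n → ℝ} {m f : ℝ → ℝ} {δ₀ blo bhi Cm Cf : ℝ}
  {u : E n → ℝ}

/-- An interior maximum of `u - h(d - σ)` has a negative value, so a value above `|C|` could occur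
only at an edge: at `d = δ'` the constant excludes it, near `d = σ` the barrier is too large. -/
theorem IsBlowupSolution.le_profile_add (hk : 1 ≤ k) (hΩ : IsBoundedDomain Ω)
    (hne : (frontier Ω).Nonempty) (hreg : HasC31Boundary Ω)
    (hconv : IsStrictlyConvexOfOrder (k - 1) Ω) (hf : CondF1 f) (hf2 : CondF2 k f)
    (hf3 : CondF3 k f Cf) (hb : CondB2 k Ω b m δ₀ blo bhi Cm) (hC : 1 - Cm < Cf)
    (hu : IsBlowupSolution k Ω b f u) {a : ℝ} (ha : 0 < a)
    (hab : a ^ (k + 1) * (1 - Cf⁻¹ * (1 - Cm)) * L₀ k Ω < blo) :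
    ∃ C, ∀ᶠ x in nearBoundary Ω, u x ≤ profile k f m a (d Ω x) + C := by
  obtain ⟨T, hT, -, -, hprof⟩ := exists_profile_regular hf hf2 hb ha
  obtain ⟨δ, hδ, hloc⟩ := upper_local_comparison hk hΩ hne hreg hconv hf hf2 hf3 hb hC
    hu.subsolution ha hab
  set δ' := min δ T / 2 with hδ'
  have hminpos : 0 < min δ T := lt_min hδ hT
  have hδ'0 : 0 < δ' := half_pos hminpos
  have hδ'δ : δ' < δ := (half_lt_self hminpos).trans_le (min_le_left _ _)
  have hδ'T : δ' < T := (half_lt_self hminpos).trans_le (min_le_right _ _)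
  have hsub : ∀ s t, {x | x ∈ Ω ∧ s ≤ d Ω x ∧ d Ω x ≤ t} ⊆ Ω := fun s t x hx => hx.1
  obtain ⟨C, hC⟩ := (isCompact_strip hΩ hδ'0 δ').exists_bound_of_continuousOn
    (hu.continuousOn.mono (hsub _ _))
  have hprofc : ∀ t ∈ Ioo 0 T, ContinuousAt (profile k f m a) t := fun t ht =>
    (hprof t ht).1.continuousAt
  have key : ∀ x₁ ∈ Ω, d Ω x₁ ≤ δ' → ∀ σ, 0 < σ → σ < d Ω x₁ →
      u x₁ ≤ profile k f m a (d Ω x₁ + -σ) + |C| := by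
    intro x₁ hx₁ hd1 σ hσ hσd
    by_contra hcon
    push Not at hcon
    obtain ⟨U, hU⟩ := (isCompact_strip hΩ hσ δ').exists_bound_of_continuousOn
      (hu.continuousOn.mono (hsub _ _))
    -- For `d - σ < ρ` the barrier exceeds the bound `U` of `u` on the strip, so the maximum is not
    -- at the edge `d = σ + τ`.
    obtain ⟨ρ, hρ, hρU⟩ := mem_nhdsGT_iff_exists_Ioo_subset.mp
      ((tendsto_profile hf hf2 hb ha).eventually_gt_atTop U)
    have hρ' : (0 : ℝ) < ρ := hρ
    set τ := min ρ (d Ω x₁ - σ) / 2 with hτ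
    have hmin' : 0 < min ρ (d Ω x₁ - σ) := lt_min hρ' (by linarith)
    have hτ0 : 0 < τ := half_pos hmin'
    have hτρ : τ < ρ := (half_lt_self hmin').trans_le (min_le_left _ _)
    have hτd : τ < d Ω x₁ - σ := (half_lt_self hmin').trans_le (min_le_right _ _)
    set K := {x | x ∈ Ω ∧ σ + τ ≤ d Ω x ∧ d Ω x ≤ δ'} with hK
    have hmemT : ∀ x ∈ K, d Ω x + -σ ∈ Ioo 0 T := fun x hx =>
      ⟨by linarith [hx.2.1], by linarith [hx.2.2]⟩
    have hcont : ContinuousOn (fun x => u x - profile k f m a (d Ω x + -σ)) K := by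
      refine (hu.continuousOn.mono (hsub _ _)).sub fun x hx => ?_
      have h1 : ContinuousAt (fun x => d Ω x + -σ) x :=
        (continuous_d.add continuous_const).continuousAt
      exact (ContinuousAt.comp (g := profile k f m a) (f := fun x => d Ω x + -σ)
        (hprofc _ (hmemT x hx)) h1).continuousWithinAt
    obtain ⟨x₀, hx₀, hmax⟩ := (isCompact_strip hΩ (add_pos hσ hτ0) δ').exists_isMaxOn
      ⟨x₁, hx₁, by linarith, hd1⟩ hcont
    have hgt : |C| < u x₀ - profile k f m a (d Ω x₀ + -σ) := by
      have h1 : u x₁ - profile k f m a (d Ω x₁ + -σ) ≤ u x₀ - profile k f m a (d Ω x₀ + -σ) :=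
        hmax ⟨hx₁, by linarith, hd1⟩
      linarith
    have hv0 := (hprof _ (hmemT x₀ hx₀)).2.2.1
    have hC0 := abs_nonneg C
    have hneδ : d Ω x₀ < δ' := by
      refine lt_of_le_of_ne hx₀.2.2 fun heq => ?_
      have h1 := (le_abs_self _).trans (hC x₀ ⟨hx₀.1, heq.ge, heq.le⟩)
      have h2 := le_abs_self C
      linarith
    have hneσ : σ + τ < d Ω x₀ := by
      refine lt_of_le_of_ne hx₀.2.1 fun heq => ?_
      have h1 := (le_abs_self _).trans (hU x₀ ⟨hx₀.1, by linarith, hx₀.2.2⟩)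
      have h2 : U < profile k f m a (d Ω x₀ + -σ) := hρU ⟨by linarith, by linarith⟩
      linarith
    have h3 := hloc x₀ hx₀.1 (hneδ.trans hδ'δ) σ hσ.le (by linarith)
      (hmax.isLocalMax (strip_mem_nhds hΩ.1 hx₀.1 hneσ hneδ))
    linarith
  refine ⟨|C|, eventually_nearBoundary_iff.mpr ⟨δ', hδ'0, fun x hx hxd => ?_⟩⟩
  have hd0 := d_pos hΩ.1 hne hx
  have hlim : Tendsto (fun σ => profile k f m a (d Ω x + -σ) + |C|) (𝓝[>] 0)
      (𝓝 (profile k f m a (d Ω x) + |C|)) := by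
    have h1 : Tendsto (fun σ => d Ω x + -σ) (𝓝[>] 0) (𝓝 (d Ω x)) := by
      refine (Continuous.tendsto' (by fun_prop) _ _ ?_).mono_left nhdsWithin_le_nhds
      simp
    exact ((hprofc _ ⟨hd0, hxd.trans hδ'T⟩).tendsto.comp h1).add_const _
  refine ge_of_tendsto hlim ?_
  filter_upwards [Ioo_mem_nhdsGT hd0] with σ hσ using key x hx hxd.le σ hσ.1 hσ.2

/-- The mirror argument with `h(d + σ)`. At `d = δ'` positivity of `u` suffices, because `h(δ' + σ)
≤ h(δ') = C`. -/
theorem IsBlowupSolution.profile_sub_le (hk : 1 ≤ k) (hΩ : IsBoundedDomain Ω)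
    (hne : (frontier Ω).Nonempty) (hreg : HasC31Boundary Ω)
    (hconv : IsStrictlyConvexOfOrder (k - 1) Ω) (hf : CondF1 f) (hf2 : CondF2 k f)
    (hf3 : CondF3 k f Cf) (hb1 : ∀ x ∈ Ω, 0 < b x) (hb : CondB2 k Ω b m δ₀ blo bhi Cm)
    (hC : 1 - Cm < Cf) (hu : IsBlowupSolution k Ω b f u) {a : ℝ} (ha : 0 < a)
    (hab : bhi < a ^ (k + 1) * (1 - Cf⁻¹ * (1 - Cm)) * l₀ k Ω) :
    ∃ C, ∀ᶠ x in nearBoundary Ω, profile k f m a (d Ω x) - C ≤ u x := by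
  obtain ⟨T, hT, -, -, hprof⟩ := exists_profile_regular hf hf2 hb ha
  have hanti := (strictAntiOn_profile hprof).antitoneOn
  obtain ⟨δ, hδ, hloc⟩ := lower_local_comparison hk hΩ hne hreg hconv hf hf2 hf3 hb1 hb hC
    hu.supersolution ha hab
  obtain ⟨δu, hδu, hupos⟩ := eventually_nearBoundary_iff.mp (hu.blowup.eventually_gt_atTop 0)
  set δ' := min (min δ T) δu / 2 with hδ'
  have hminpos : 0 < min (min δ T) δu := lt_min (lt_min hδ hT) hδu
  have hδ'0 : 0 < δ' := half_pos hminpos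
  have h2δ : δ' + δ' = min (min δ T) δu := add_halves _
  have h2δ1 : δ' + δ' ≤ δ := h2δ.le.trans ((min_le_left _ _).trans (min_le_left _ _))
  have h2δ2 : δ' + δ' ≤ T := h2δ.le.trans ((min_le_left _ _).trans (min_le_right _ _))
  have h2δ3 : δ' + δ' ≤ δu := h2δ.le.trans (min_le_right _ _)
  have hsub : ∀ s t, {x | x ∈ Ω ∧ s ≤ d Ω x ∧ d Ω x ≤ t} ⊆ Ω := fun s t x hx => hx.1
  have hprofc : ∀ t ∈ Ioo 0 T, ContinuousAt (profile k f m a) t := fun t ht =>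
    (hprof t ht).1.continuousAt
  have hδ'T : δ' ∈ Ioo 0 T := ⟨hδ'0, by linarith⟩
  set C := profile k f m a δ' with hCdef
  have hCpos : 0 < C := (hprof _ hδ'T).2.2.1
  have key : ∀ x₁ ∈ Ω, d Ω x₁ ≤ δ' → ∀ σ, 0 < σ → σ < δ' →
      profile k f m a (d Ω x₁ + σ) - C ≤ u x₁ := by
    intro x₁ hx₁ hd1 σ hσ hσδ
    by_contra hcon
    push Not at hcon
    have hσT : σ ∈ Ioo 0 T := ⟨hσ, by linarith⟩
    have hd1pos := d_pos hΩ.1 hne hx₁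
    -- Near `∂Ω` the solution exceeds `h(σ)`, the supremum of the shifted barrier, so the minimum is
    -- not at `d = τ`.
    obtain ⟨ρ, hρ, hρu⟩ := eventually_nearBoundary_iff.mp
      (hu.blowup.eventually_ge_atTop (profile k f m a σ))
    set τ := min ρ (d Ω x₁) / 2 with hτ
    have hmin' : 0 < min ρ (d Ω x₁) := lt_min hρ hd1pos
    have hτ0 : 0 < τ := half_pos hmin'
    have hτρ : τ < ρ := (half_lt_self hmin').trans_le (min_le_left _ _)
    have hτd : τ < d Ω x₁ := (half_lt_self hmin').trans_le (min_le_right _ _)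
    set K := {x | x ∈ Ω ∧ τ ≤ d Ω x ∧ d Ω x ≤ δ'} with hK
    have hmemT : ∀ x ∈ K, d Ω x + σ ∈ Ioo 0 T := fun x hx =>
      ⟨by linarith [hx.2.1], by linarith [hx.2.2]⟩
    have hcont : ContinuousOn (fun x => u x - profile k f m a (d Ω x + σ)) K := by
      refine (hu.continuousOn.mono (hsub _ _)).sub fun x hx => ?_
      have h1 : ContinuousAt (fun x => d Ω x + σ) x :=
        (continuous_d.add continuous_const).continuousAt
      exact (ContinuousAt.comp (g := profile k f m a) (f := fun x => d Ω x + σ)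
        (hprofc _ (hmemT x hx)) h1).continuousWithinAt
    obtain ⟨x₀, hx₀, hmin⟩ := (isCompact_strip hΩ hτ0 δ').exists_isMinOn
      ⟨x₁, hx₁, hτd.le, hd1⟩ hcont
    have hlt : u x₀ - profile k f m a (d Ω x₀ + σ) < -C := by
      have h1 : u x₀ - profile k f m a (d Ω x₀ + σ) ≤ u x₁ - profile k f m a (d Ω x₁ + σ) :=
        hmin ⟨hx₁, hτd.le, hd1⟩
      linarith
    have hu0 : 0 < u x₀ := hupos x₀ hx₀.1 (by linarith [hx₀.2.2])
    have hneδ : d Ω x₀ < δ' := by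
      refine lt_of_le_of_ne hx₀.2.2 fun heq => ?_
      have h1 := hanti hδ'T (hmemT x₀ hx₀) (by linarith)
      linarith
    have hneτ : τ < d Ω x₀ := by
      refine lt_of_le_of_ne hx₀.2.1 fun heq => ?_
      have h1 := hρu x₀ hx₀.1 (by linarith)
      have h2 := hanti hσT (hmemT x₀ hx₀) (by linarith)
      linarith
    have h3 := hloc x₀ hx₀.1 σ hσ.le (by linarith)
      (hmin.isLocalMin (strip_mem_nhds hΩ.1 hx₀.1 hneτ hneδ)) hu0
    linarith
  refine ⟨C, eventually_nearBoundary_iff.mpr ⟨δ', hδ'0, fun x hx hxd => ?_⟩⟩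
  have hd0 := d_pos hΩ.1 hne hx
  have hlim : Tendsto (fun σ => profile k f m a (d Ω x + σ) - C) (𝓝[>] 0)
      (𝓝 (profile k f m a (d Ω x) - C)) := by
    have h1 : Tendsto (fun σ => d Ω x + σ) (𝓝[>] 0) (𝓝 (d Ω x)) := by
      refine (Continuous.tendsto' (by fun_prop) _ _ ?_).mono_left nhdsWithin_le_nhds
      simp
    exact ((hprofc _ ⟨hd0, by linarith⟩).tendsto.comp h1).sub_const _
  refine le_of_tendsto hlim ?_
  filter_upwards [Ioo_mem_nhdsGT hδ'0] with σ hσ using key x hx hxd.le σ hσ.1 hσ.2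

/-- Comparison of two profiles with different constants. -/
theorem exists_profile_ratio (hf : CondF1 f) (hf2 : CondF2 k f) (hf3 : CondF3 k f Cf)
    (hb : CondB2 k Ω b m δ₀ blo bhi Cm) :
    ∃ N : ℕ, ∀ a ρ : ℝ, 0 < a → 1 ≤ ρ →
      ∀ᶠ t in 𝓝[>] 0, profile k f m a t ≤ ρ ^ N * profile k f m (a * ρ) t := by
  obtain ⟨N, T, hT, hmono⟩ := exists_pow_mul_φ_mono hf hf2 hf3
  refine ⟨N, fun a ρ ha hρ => ?_⟩
  have hρ0 : 0 < ρ := one_pos.trans_le hρ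
  filter_upwards [(tendsto_mul_M hb ha).eventually (Ioo_mem_nhdsGT hT),
    (tendsto_mul_M hb (mul_pos ha hρ0)).eventually (Ioo_mem_nhdsGT hT)] with t h1 h2
  have h3 : a * M m t ≤ a * ρ * M m t := by
    have := mul_le_mul_of_nonneg_left hρ h1.1.le
    linarith
  have h4 : (a * M m t) ^ N * φ k f (a * M m t) ≤
      (a * ρ * M m t) ^ N * φ k f (a * ρ * M m t) := hmono h1 h2 h3
  have h5 : (a * ρ * M m t) ^ N = (a * M m t) ^ N * ρ ^ N := by rw [← mul_pow]; ring
  rw [h5, mul_assoc] at h4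
  exact le_of_mul_le_mul_left h4 (pow_pos h1.1 N)

/-- `ξ` is the equality case of the barrier condition; a factor `ρ > 1` makes it strict. -/
theorem ξ_pow {β κ : ℝ} (hβ : 0 < β) (hκ : 0 < κ) (hθ : 0 < 1 - Cf⁻¹ * (1 - Cm)) :
    0 < ξ k β κ Cf Cm ∧
      ξ k β κ Cf Cm ^ (k + 1) * (1 - Cf⁻¹ * (1 - Cm)) * κ = β := by
  have hX : 0 < β / (κ * (1 - Cf⁻¹ * (1 - Cm))) := by positivity
  refine ⟨Real.rpow_pos_of_pos hX _, ?_⟩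
  have h1 : ξ k β κ Cf Cm ^ (k + 1) = β / (κ * (1 - Cf⁻¹ * (1 - Cm))) := by
    rw [ξ, ← Real.rpow_natCast, ← Real.rpow_mul hX.le]
    push_cast
    rw [one_div, inv_mul_cancel₀ (by positivity), Real.rpow_one]
  rw [h1]
  generalize 1 - Cf⁻¹ * (1 - Cm) = θ at hθ
  field_simp

theorem exists_gt_one_pow_mul_lt {N : ℕ} {x y : ℝ} (h : x < y) : ∃ ρ > 1, ρ ^ N * x < y := by
  have h1 : Tendsto (fun ρ : ℝ => ρ ^ N * x) (𝓝[>] 1) (𝓝 x) := by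
    refine (Continuous.tendsto' (by fun_prop) _ _ ?_).mono_left nhdsWithin_le_nhds
    simp
  obtain ⟨ρ, hρ1, hρ2⟩ := ((h1.eventually_lt_const h).and self_mem_nhdsWithin).exists
  exact ⟨ρ, hρ2, hρ1⟩

end GlobalComparison

end HessianBlowup

end

/-! ### The boundary asymptotics -/

theorem theorem1p2 (n k : ℕ) (hn : 2 ≤ n) (hk : 1 ≤ k) (hkn : k ≤ n)
    (Ω : Set (E n)) (hΩ : IsBoundedDomain Ω) (hΩreg : HasC31Boundary Ω)
    (hΩconv : IsStrictlyConvexOfOrder (k - 1) Ω)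
    (f : ℝ → ℝ) (Cf : ℝ) (hf1 : CondF1 f) (hf2 : CondF2 k f) (hf3 : CondF3 k f Cf)
    (b : E n → ℝ) (m : ℝ → ℝ) (δ₀ blo bhi Cm : ℝ)
    (hb1 : CondB1 Ω b) (hb2 : CondB2 k Ω b m δ₀ blo bhi Cm)
    (hC : 1 - Cm < Cf)
    (u : E n → ℝ) (hu : IsBlowupSolution k Ω b f u) :
    1 ≤ liminf (fun x =>
        ((u x / φ k f (ξ k bhi (l₀ k Ω) Cf Cm * M m (d Ω x)) : ℝ) : EReal)) (nearBoundary Ω) ∧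
    limsup (fun x =>
        ((u x / φ k f (ξ k blo (L₀ k Ω) Cf Cm * M m (d Ω x)) : ℝ) : EReal)) (nearBoundary Ω)
      ≤ 1 := by
  have hne := nonempty_frontier hn hΩ
  have hl := l₀_pos hk hΩ hne hΩreg hΩconv
  have hL := hl.trans_le (l₀_le_L₀ k hΩ hne hΩreg)
  have hθ : 0 < 1 - Cf⁻¹ * (1 - Cm) := by
    rw [sub_pos, inv_mul_lt_iff₀ hf3.1, mul_one]
    exact hC
  have hd := tendsto_d_nearBoundary hΩ.1 hne
  obtain ⟨N, hratio⟩ := exists_profile_ratio (k := k) hf1 hf2 hf3 hb2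
  constructor
  · obtain ⟨hξ, hξeq⟩ := ξ_pow (k := k) hb2.bhi_pos hl hθ
    set a := ξ k bhi (l₀ k Ω) Cf Cm
    refine EReal.ge_of_forall_gt_iff_ge.mp fun c hc => ?_
    have hc1 : c < 1 := EReal.coe_lt_coe_iff.mp hc
    -- Half of the gap between `c` and `1` pays for the factor `ρ ^ N`, the other half for the
    -- additive constant `C`.
    obtain ⟨ρ, hρ, hρc⟩ := exists_gt_one_pow_mul_lt (N := N) (x := (1 + c) / 2) (y := 1)
      (by linarith)
    have hρ0 : 0 < ρ := one_pos.trans hρ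
    have hgap : bhi < (a * ρ) ^ (k + 1) * (1 - Cf⁻¹ * (1 - Cm)) * l₀ k Ω := by
      have h1 : 1 < ρ ^ (k + 1) := one_lt_pow₀ hρ (by omega)
      have h2 : (a * ρ) ^ (k + 1) * (1 - Cf⁻¹ * (1 - Cm)) * l₀ k Ω = bhi * ρ ^ (k + 1) := by
        rw [← hξeq]; ring
      rw [h2]
      exact lt_mul_of_one_lt_right hb2.bhi_pos h1
    obtain ⟨C, hbar⟩ := hu.profile_sub_le hk hΩ hne hΩreg hΩconv hf1 hf2 hf3 hb1.2 hb2 hC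
      (mul_pos hξ hρ0) hgap
    refine le_liminf_of_le (by isBoundedDefault) ?_
    filter_upwards [hbar, hd.eventually (hratio a ρ hξ hρ.le),
      hd.eventually ((tendsto_profile hf1 hf2 hb2 hξ).eventually_ge_atTop
        (max 1 (C / ((1 - c) / 2))))] with x h1 h2 h3
    refine EReal.coe_le_coe_iff.mpr ?_
    change c ≤ u x / profile k f m a (d Ω x)
    set P := profile k f m a (d Ω x)
    have hP : 0 < P := one_pos.trans_le ((le_max_left _ _).trans h3)
    have hCP : C ≤ P * ((1 - c) / 2) := by
      rw [← div_le_iff₀ (by linarith)]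
      exact (le_max_right _ _).trans h3
    have hNpos : 0 < ρ ^ N := pow_pos hρ0 N
    rw [le_div_iff₀ hP]
    have h4 : (1 + c) / 2 * P ≤ profile k f m (a * ρ) (d Ω x) := by
      have h5 : ρ ^ N * ((1 + c) / 2 * P) ≤ ρ ^ N * profile k f m (a * ρ) (d Ω x) := by
        have := mul_le_mul_of_nonneg_right hρc.le hP.le
        linarith
      exact le_of_mul_le_mul_left h5 hNpos
    linarith
  · obtain ⟨hξ, hξeq⟩ := ξ_pow (k := k) hb2.blo_pos hL hθ
    set a := ξ k blo (L₀ k Ω) Cf Cm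
    refine EReal.le_of_forall_lt_iff_le.mp fun c hc => ?_
    have hc1 : 1 < c := EReal.coe_lt_coe_iff.mp hc
    -- The same splitting of the gap; the barrier now has the smaller constant `a / ρ`.
    obtain ⟨ρ, hρ, hρc⟩ := exists_gt_one_pow_mul_lt (N := N) (x := 1) (y := (1 + c) / 2)
      (by linarith)
    have hρ0 : 0 < ρ := one_pos.trans hρ
    have haρ : a / ρ * ρ = a := div_mul_cancel₀ a hρ0.ne'
    have hgap : (a / ρ) ^ (k + 1) * (1 - Cf⁻¹ * (1 - Cm)) * L₀ k Ω < blo := by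
      have h1 : 1 < ρ ^ (k + 1) := one_lt_pow₀ hρ (by omega)
      have h2 : (a / ρ) ^ (k + 1) * (1 - Cf⁻¹ * (1 - Cm)) * L₀ k Ω = blo / ρ ^ (k + 1) := by
        rw [← hξeq, div_pow]; ring
      rw [h2]
      exact div_lt_self hb2.blo_pos h1
    obtain ⟨C, hbar⟩ := hu.le_profile_add hk hΩ hne hΩreg hΩconv hf1 hf2 hf3 hb2 hC
      (div_pos hξ hρ0) hgap
    refine limsup_le_of_le (by isBoundedDefault) ?_
    filter_upwards [hbar, hd.eventually (hratio (a / ρ) ρ (div_pos hξ hρ0) hρ.le),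
      hd.eventually ((tendsto_profile hf1 hf2 hb2 hξ).eventually_ge_atTop
        (max 1 (C / ((c - 1) / 2))))] with x h1 h2 h3
    refine EReal.coe_le_coe_iff.mpr ?_
    change u x / profile k f m a (d Ω x) ≤ c
    rw [haρ] at h2
    set P := profile k f m a (d Ω x)
    have hP : 0 < P := one_pos.trans_le ((le_max_left _ _).trans h3)
    have hCP : C ≤ P * ((c - 1) / 2) := by
      rw [← div_le_iff₀ (by linarith)]
      exact (le_max_right _ _).trans h3
    rw [div_le_iff₀ hP]
    rw [mul_one] at hρc
    have h4 := mul_le_mul_of_nonneg_right hρc.le hP.le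
    linarith
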